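/- Let $N\in\mathbb N$, $1<p<N$, $\alpha,q\in\mathbb R$, let $\Omega\subset\mathbb R^N$ be open and connected with $0\in\Omega$, and put $\Omega'=\Omega\setminus\{0\}$. A (continuous) solution of $$-\Delta_p u=|x|^\alpha u^q,\qquad \Delta_p u=\mathrm{div}(|\nabla u|^{p-2}\nabla u),\tag{E}$$ in an open set $D$ is a continuous function $u$ on $D$ with weak gradient $\nabla u\in L^p_{loc}(D)$ and $|x|^\alpha u^q\in L^1_{loc}(D)$ such that $\int_D|\nabla u|^{p-2}\nabla u\cdot\nabla\varphi\,dx=\int_D|x|^\alpha u^q\varphi\,dx$ for all $\varphi\in C_c^\infty(D)$. Let $\omega_{N-1}$ be the area of the unit sphere of $\mathbb R^N$ and $$\mu(x)=\frac{p-1}{N-p}\,\omega_{N-1}^{-1/(p-1)}\,|x|^{\frac{p-N}{p-1}}.$$ Let $u$ be a positive radial solution of (E) in $\Omega'$. We say that the singularity is removable if $u$ extends to a solution of (E) in $\Omega$ which, in case $\alpha>-1$, belongs to $C^1(\Omega)$. 1. (Subcritical case) If $p-1<q<\frac{(N+\alpha)(p-1)}{N-p}$, then either the singularity is removable, or there are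 constants $C>0$ and $\tilde C>0$ such that $\lim_{x\to0}\frac{u(x)}{\mu(x)}=C$ and $-\Delta_pu-|x|^\alpha u^q=\tilde C\delta_0$ in the sense of distributions in $\Omega$; that is, $|\nabla u|^{p-2}\nabla u$ and $|x|^\alpha u^q$ are in $L^1_{loc}(\Omega)$ and $\int_\Omega|\nabla u|^{p-2}\nabla u\cdot\nabla\varphi\,dx-\int_\Omega|x|^\alpha u^q\varphi\,dx=\tilde C\varphi(0)$ for all $\varphi\in C_c^\infty(\Omega)$. 2. (Critical case) If $p-1<q=\frac{(N+\alpha)(p-1)}{N-p}$, then either the singularity is removable, or $$\lim_{x\to0}|x|^{\frac{N-p}{p-1}}\Big(\ln\frac1{|x|}\Big)^{\frac{N-p}{(p+\alpha)(p-1)}}u(x)=\left[\frac{N-p}{p+\alpha}\Big(\frac{N-p}{p-1}\Big)^{p-1}\right]^{\frac{N-p}{(p+\alpha)(p-1)}}.$$ 3. (Supercritical case) If $\frac{(N+\alpha)(p-1)}{N-p}<q<\frac{(N+\alpha)p}{N-p}-1$, then either the singularity is removable, or $$\lim_{x\to0}|x|^{\frac{p+\alpha}{q+1-p}}u(x)=\lambda=\left[\Big(\frac{p+\alpha}{q+1-p}\Big)^{p-1}\Big(N-\frac{pq+\alpha(p-1)}{q+1-p}\Big)\right]^{\frac1{q+1-p}}.$$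 -/

import Mathlib

open MeasureTheory Filter Topology Set
open scoped ContDiff

noncomputable section

/-- `φ ∈ C_c^∞(Ω)`. -/
structure IsTestFunction {N : ℕ} (Ω : Set (EuclideanSpace ℝ (Fin N)))
    (φ : EuclideanSpace ℝ (Fin N) → ℝ) : Prop where
  smooth : ContDiff ℝ ∞ φ
  compactSupport : HasCompactSupport φ
  support_subset : tsupport φ ⊆ Ω

/-- `G` is the weak (distributional) gradient of `u` in `Ω`. -/
structure IsWeakGradient {N : ℕ} (Ω : Set (EuclideanSpace ℝ (Fin N)))
    (u : EuclideanSpace ℝ (Fin N) → ℝ)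
    (G : EuclideanSpace ℝ (Fin N) → EuclideanSpace ℝ (Fin N)) : Prop where
  locallyIntegrable : LocallyIntegrableOn u Ω
  locallyIntegrable_grad : LocallyIntegrableOn G Ω
  integral_eq : ∀ φ, IsTestFunction Ω φ →
    ∫ x in Ω, u x • gradient φ x = - ∫ x in Ω, φ x • G x

/-- The flux `|ξ|^{p-2} ξ` of the `p`-Laplacian (it is `0` at `ξ = 0`). -/
def pFlux {N : ℕ} (p : ℝ) (ξ : EuclideanSpace ℝ (Fin N)) : EuclideanSpace ℝ (Fin N) :=
  ‖ξ‖ ^ (p - 2) • ξ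

/-- The Hénon source term `|x|^α u^q`. -/
def henonSource {N : ℕ} (α q : ℝ) (u : EuclideanSpace ℝ (Fin N) → ℝ)
    (x : EuclideanSpace ℝ (Fin N)) : ℝ :=
  ‖x‖ ^ α * u x ^ q

/-- `u` is a continuous solution of `-Δ_p u = |x|^α u^q` in `Ω`: it is continuous in `Ω`, its weak
gradient is in `L^p_loc(Ω)`, the source is locally integrable (so that it can be tested), and
`∫ |∇u|^{p-2} ∇u ⬝ ∇φ = ∫ |x|^α u^q φ` for all `φ ∈ C_c^∞(Ω)`. -/
def IsHenonSolution {N : ℕ} (p α q : ℝ) (Ω : Set (EuclideanSpace ℝ (Fin N)))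
    (u : EuclideanSpace ℝ (Fin N) → ℝ) : Prop :=
  ContinuousOn u Ω ∧ LocallyIntegrableOn (henonSource α q u) Ω ∧
    ∃ G : EuclideanSpace ℝ (Fin N) → EuclideanSpace ℝ (Fin N),
      IsWeakGradient Ω u G ∧
      (∀ K ⊆ Ω, IsCompact K → MemLp G (ENNReal.ofReal p) (volume.restrict K)) ∧
      ∀ φ, IsTestFunction Ω φ →
        ∫ x in Ω, inner ℝ (pFlux p (G x)) (gradient φ x) = ∫ x in Ω, henonSource α q u x * φ x

/-- `u`, given in `Ω \ {0}`, extends to a continuous solution in `Ω`, of class `C^1` if `α > -1`.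
(If `α ≤ -1`, a positive radial solution across `0` is never `C^1` at `0`.) -/
def ExtendsAcrossZero {N : ℕ} (p α q : ℝ) (Ω : Set (EuclideanSpace ℝ (Fin N)))
    (u : EuclideanSpace ℝ (Fin N) → ℝ) : Prop :=
  ∃ U : EuclideanSpace ℝ (Fin N) → ℝ, EqOn U u (Ω \ {0}) ∧ IsHenonSolution p α q Ω U ∧
    (-1 < α → ContDiffOn ℝ 1 U Ω)

/-- `-Δ_p u - |x|^α u^q = c δ_0` in the sense of distributions in `Ω`. Here `∇u` is the weak
gradient of `u` in `Ω \ {0}`, which determines it almost everywhere in `Ω`, and both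
`|∇u|^{p-2} ∇u` and `|x|^α u^q` are locally integrable in `Ω`, hence distributions. -/
def HasDiracSource {N : ℕ} (p α q c : ℝ) (Ω : Set (EuclideanSpace ℝ (Fin N)))
    (u : EuclideanSpace ℝ (Fin N) → ℝ) : Prop :=
  ∃ G : EuclideanSpace ℝ (Fin N) → EuclideanSpace ℝ (Fin N),
    IsWeakGradient (Ω \ {0}) u G ∧
    LocallyIntegrableOn (fun x => pFlux p (G x)) Ω ∧
    LocallyIntegrableOn (henonSource α q u) Ω ∧
    ∀ φ, IsTestFunction Ω φ →
      (∫ x in Ω, inner ℝ (pFlux p (G x)) (gradient φ x)) -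
          (∫ x in Ω, henonSource α q u x * φ x) = c * φ 0

/-- The area `ω_{N-1}` of the unit sphere of `ℝ^N`. -/
def sphereArea (N : ℕ) : ℝ :=
  ((volume : Measure (EuclideanSpace ℝ (Fin N))).toSphere univ).toReal

/-- The fundamental solution `μ` of `-Δ_p μ = δ_0` in `ℝ^N`, for `1 < p < N`. -/
def pFundamental (N : ℕ) (p : ℝ) (x : EuclideanSpace ℝ (Fin N)) : ℝ :=
  (p - 1) / (N - p) * sphereArea N ^ (-1 / (p - 1)) * ‖x‖ ^ ((p - N) / (p - 1))

/-- `u` is a radial function in `Ω`. -/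
def IsRadialOn {N : ℕ} (Ω : Set (EuclideanSpace ℝ (Fin N)))
    (u : EuclideanSpace ℝ (Fin N) → ℝ) : Prop :=
  ∃ f : ℝ → ℝ, ∀ x ∈ Ω, u x = f ‖x‖

end

/-! ### Real functions with derivative bounds near `+∞` -/

/-! A radial solution obeys an ordinary differential equation, and in `t = -ln |x|` the origin
becomes `t → +∞`. Put `m = p - 1`, `β = (N - p)/(p - 1)`, `θ = N + α`. With `F(t) = u(e^{-t})` and
`w` the flux through the sphere of radius `e^{-t}` (divided by its constant `ω_{N-1}`), the equation
reads `F' = w^{1/m} e^{βt}`, `w' = -e^{-θt} F^q`. The flux is positive, since otherwise `F` would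
become negative; so `F` increases, and `w` decreases to some `c ≥ 0`.

By L'Hôpital, `F e^{-βt}` tends to `c^{1/m}/β`. If `c > 0`, `u` is comparable to `μ` and the flux
`c` is the Dirac mass. This requires `qβ < θ`: when `qβ ≥ θ` the growth of `F` would make `w'`
bounded away from zero (`flux_limit_eq_zero`).

Let now `c = 0`. The logarithmic slopes `X = F'/F`, `Y = -w'/w` and the scale invariant quantity `P
= X^m Y` satisfy `X' = X (β - X - Y/m)` and `P' = P ((q - m) X - (θ - βm))`. If `P → 0`, then `X`
eventually stays below any small level or tends to `β`. A small slope bootstraps to a bound on `F`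
(`bounded_of_slope_lt`). The alternative `X → β` contradicts `w → 0` in the subcritical case and `P
→ 0` in the supercritical one; in the critical case it integrates to the logarithmic rate.

In the supercritical case `P` need not vanish. The rescaled unknown `y = e^{-γt} F`, with `γ = (p +
α)/(q + 1 - p)`, solves an autonomous system with an energy that is nonincreasing exactly because
`q` is below the Sobolev exponent. Its dissipation forces `y` to converge to `0` or to `λ`, and the
limit `0` gives `P → 0`, hence boundedness (`bounded_or_tendsto_of_supercritical`).

Two bridges to the weak formulation remain. Away from the origin, a radial weak solution is
classical: since `Ω` need not contain whole spheres, the equation is tested with products of a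
function of `|x|` and a bump in the direction `x/|x|`, and the du Bois-Reymond lemma applies on an
interval of radii (`exists_radial_regularity`). At the origin, the defect of the weak equation is
computed with cutoffs and equals the limit of the flux (`integral_sub_integral_eq`). A bounded
profile with zero flux satisfies `u = L + O(r^{γ'+1})` and `u' = O(r^{γ'})` with `γ' = (α + 1)/(p -
1) > -1`. This gives a continuous solution across `0`, which is `C^1` when `γ' > 0`. -/

theorem monotoneOn_Ioi_of_hasDerivAt_nonneg {f f' : ℝ → ℝ} {T : ℝ}
    (hf : ∀ t, T < t → HasDerivAt f (f' t) t) (h : ∀ t, T < t → 0 ≤ f' t) :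
    MonotoneOn f (Ioi T) := by
  refine monotoneOn_of_hasDerivWithinAt_nonneg (f' := f') (convex_Ioi T)
    (fun t ht => (hf t ht).continuousAt.continuousWithinAt) ?_ ?_
  · intro t ht
    rw [interior_Ioi] at ht
    exact (hf t ht).hasDerivWithinAt
  · intro t ht
    rw [interior_Ioi] at ht
    exact h t ht

theorem antitoneOn_Ioi_of_hasDerivAt_nonpos {f f' : ℝ → ℝ} {T : ℝ}
    (hf : ∀ t, T < t → HasDerivAt f (f' t) t) (h : ∀ t, T < t → f' t ≤ 0) :
    AntitoneOn f (Ioi T) := by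
  refine antitoneOn_of_hasDerivWithinAt_nonpos (f' := f') (convex_Ioi T)
    (fun t ht => (hf t ht).continuousAt.continuousWithinAt) ?_ ?_
  · intro t ht
    rw [interior_Ioi] at ht
    exact (hf t ht).hasDerivWithinAt
  · intro t ht
    rw [interior_Ioi] at ht
    exact h t ht

theorem eventually_atTop_gt {p : ℝ → Prop} (h : ∀ᶠ t in atTop, p t) (T : ℝ) :
    ∃ S, T ≤ S ∧ ∀ t, S < t → p t := by
  obtain ⟨S, hS⟩ := eventually_atTop.1 h
  exact ⟨max S T, le_max_right _ _, fun t ht => hS t (le_trans (le_max_left _ _) ht.le)⟩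

/-- The difference `f - b g` is nonincreasing, hence bounded above by a constant `C`, and `C / g →
0`. -/
theorem eventually_div_lt_of_deriv_le {f f' g g' : ℝ → ℝ} {b b' : ℝ} (hb : b < b')
    (hf : ∀ᶠ t in atTop, HasDerivAt f (f' t) t) (hg : ∀ᶠ t in atTop, HasDerivAt g (g' t) t)
    (hle : ∀ᶠ t in atTop, f' t ≤ b * g' t) (hgt : Tendsto g atTop atTop) :
    ∀ᶠ t in atTop, f t / g t < b' := by
  obtain ⟨T, -, hT⟩ := eventually_atTop_gt (hf.and (hg.and hle)) 0
  have hanti : AntitoneOn (fun t => f t - b * g t) (Ioi T) :=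
    antitoneOn_Ioi_of_hasDerivAt_nonpos (f' := fun t => f' t - b * g' t)
      (fun t ht => (hT t ht).1.sub ((hT t ht).2.1.const_mul b))
      (fun t ht => sub_nonpos.2 (hT t ht).2.2)
  set C := f (T + 1) - b * g (T + 1)
  filter_upwards [eventually_ge_atTop (T + 1), hgt.eventually_gt_atTop 0,
    hgt.eventually_gt_atTop (C / (b' - b))] with t ht hg0 hgC
  have h1 : f t - b * g t ≤ C := hanti (by simp) (by simp; linarith) ht
  have hbb : 0 < b' - b := sub_pos.2 hb
  rw [div_lt_iff₀ hbb] at hgC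
  rw [div_lt_iff₀ hg0]
  nlinarith

/-- L'Hôpital's rule at `+∞` for a denominator tending to `+∞`. -/
theorem tendsto_div_of_tendsto_deriv_div {f f' g g' : ℝ → ℝ} {a : ℝ}
    (hf : ∀ᶠ t in atTop, HasDerivAt f (f' t) t) (hg : ∀ᶠ t in atTop, HasDerivAt g (g' t) t)
    (hg' : ∀ᶠ t in atTop, 0 < g' t) (hgt : Tendsto g atTop atTop)
    (h : Tendsto (fun t => f' t / g' t) atTop (𝓝 a)) :
    Tendsto (fun t => f t / g t) atTop (𝓝 a) := by
  refine tendsto_order.2 ⟨fun b hb => ?_, fun b hb => ?_⟩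
  · obtain ⟨c, hbc, hca⟩ := exists_between hb
    have := eventually_div_lt_of_deriv_le (f := fun t => -f t) (f' := fun t => -f' t)
      (b := -c) (b' := -b) (neg_lt_neg hbc) (hf.mono fun t ht => ht.neg) hg ?_ hgt
    · filter_upwards [this] with t ht
      rw [neg_div] at ht
      linarith
    · filter_upwards [hg', h.eventually (eventually_gt_nhds hca)] with t h1 h2
      rw [lt_div_iff₀ h1] at h2
      linarith
  · obtain ⟨c, hac, hcb⟩ := exists_between hb
    refine eventually_div_lt_of_deriv_le hcb hf hg ?_ hgt
    filter_upwards [hg', h.eventually (eventually_lt_nhds hac)] with t h1 h2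
    rw [div_lt_iff₀ h1] at h2
    exact h2.le

theorem tendsto_div_self_of_tendsto_deriv {f f' : ℝ → ℝ} {a : ℝ}
    (hf : ∀ᶠ t in atTop, HasDerivAt f (f' t) t) (h : Tendsto f' atTop (𝓝 a)) :
    Tendsto (fun t => f t / t) atTop (𝓝 a) :=
  tendsto_div_of_tendsto_deriv_div (g := fun t => t) (g' := fun _ => 1) hf
    (Eventually.of_forall fun t => hasDerivAt_id t) (Eventually.of_forall fun _ => one_pos)
    tendsto_id (by simpa using h)

theorem tendsto_atTop_of_hasDerivAt_ge {f f' : ℝ → ℝ} {k : ℝ} (hk : 0 < k)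
    (hf : ∀ᶠ t in atTop, HasDerivAt f (f' t) t) (h : ∀ᶠ t in atTop, k ≤ f' t) :
    Tendsto f atTop atTop := by
  obtain ⟨T, -, hT⟩ := eventually_atTop_gt (hf.and h) 0
  have hmono : MonotoneOn (fun t => f t - k * t) (Ioi T) :=
    monotoneOn_Ioi_of_hasDerivAt_nonneg (f' := fun t => f' t - k * 1)
      (fun t ht => (hT t ht).1.sub ((hasDerivAt_id t).const_mul k))
      (fun t ht => by have := (hT t ht).2; linarith)
  refine tendsto_atTop_mono' atTop (f₁ := fun t => (f (T + 1) - k * (T + 1)) + k * t) ?_ ?_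
  · filter_upwards [eventually_ge_atTop (T + 1)] with t ht
    have := hmono (by simp : T + 1 ∈ Ioi T) (by simp; linarith) ht
    simp only at this
    linarith
  · exact tendsto_atTop_add_const_left _ _ (tendsto_id.const_mul_atTop hk)

theorem tendsto_atBot_of_hasDerivAt_le {f f' : ℝ → ℝ} {k : ℝ} (hk : 0 < k)
    (hf : ∀ᶠ t in atTop, HasDerivAt f (f' t) t) (h : ∀ᶠ t in atTop, f' t ≤ -k) :
    Tendsto f atTop atBot := by
  have := tendsto_atTop_of_hasDerivAt_ge (f := fun t => -f t) (f' := fun t => -f' t) hk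
    (hf.mono fun t ht => ht.neg) (h.mono fun t ht => by linarith)
  simpa [Function.comp_def] using tendsto_neg_atTop_atBot.comp this

theorem eq_zero_of_tendsto_of_tendsto_deriv {f f' : ℝ → ℝ} {a b : ℝ}
    (hf : ∀ᶠ t in atTop, HasDerivAt f (f' t) t) (h : Tendsto f' atTop (𝓝 a))
    (hb : Tendsto f atTop (𝓝 b)) : a = 0 :=
  tendsto_nhds_unique (tendsto_div_self_of_tendsto_deriv hf h) (hb.div_atTop tendsto_id)

/-- If `V` converges at `+∞` and `V'` is negative, uniformly so where `|d| ≥ ε`, then a Lipschitz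
function `d` tends to `0`. -/
theorem tendsto_zero_of_dissipation {V V' d d' : ℝ → ℝ} {v K : ℝ}
    (hV : ∀ᶠ t in atTop, HasDerivAt V (V' t) t) (hVv : Tendsto V atTop (𝓝 v))
    (hd : ∀ᶠ t in atTop, HasDerivAt d (d' t) t) (hK : ∀ᶠ t in atTop, |d' t| ≤ K)
    (hdiss : ∀ ε > 0, ∃ η > 0, ∀ᶠ t in atTop, ε ≤ |d t| → V' t ≤ -η) :
    Tendsto d atTop (𝓝 0) := by
  rw [Metric.tendsto_nhds]
  intro ε hε
  obtain ⟨η, hη, hdis⟩ := hdiss (ε / 2) (by linarith)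
  set K' := max K 1
  have hK' : 0 < K' := lt_of_lt_of_le one_pos (le_max_right _ _)
  -- If `|d t| ≥ ε`, the Lipschitz bound keeps `|d| ≥ ε / 2` on a window of length `δ`. There `V`
  -- drops by at least `η δ`, which the convergence of `V` forbids for large `t`.
  set δ := ε / (2 * K') with hδ
  have hδ0 : 0 < δ := by positivity
  have hcauchy : ∀ᶠ t in atTop, V t - V (t + δ) < η * δ := by
    have h1 : Tendsto (fun t => V t - V (t + δ)) atTop (𝓝 (v - v)) :=
      hVv.sub (hVv.comp (tendsto_atTop_add_const_right _ δ tendsto_id))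
    rw [sub_self] at h1
    exact h1.eventually (eventually_lt_nhds (by positivity))
  obtain ⟨T, -, hT⟩ := eventually_atTop_gt
    (hV.and (hd.and (hK.and (hdis.and hcauchy)))) 0
  filter_upwards [eventually_gt_atTop T] with t ht
  rw [Real.dist_eq, sub_zero]
  by_contra! hcon
  have hlarge : ∀ s ∈ Icc t (t + δ), ε / 2 ≤ |d s| := by
    intro s hs
    have hlip : ‖d s - d t‖ ≤ K' * ‖s - t‖ := by
      refine (convex_Icc t (t + δ)).norm_image_sub_le_of_norm_hasDerivWithin_le
        (f' := d') (fun x hx => ((hT x (lt_of_lt_of_le ht hx.1)).2.1).hasDerivWithinAt)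
        (fun x hx => ?_) (by simp [hδ0.le]) hs
      exact ((hT x (lt_of_lt_of_le ht hx.1)).2.2.1).trans (le_max_left _ _)
    rw [Real.norm_eq_abs, Real.norm_eq_abs, abs_of_nonneg (by linarith [hs.1] : 0 ≤ s - t)] at hlip
    have h2 : K' * (s - t) ≤ ε / 2 := by
      calc K' * (s - t) ≤ K' * δ := by gcongr; linarith [hs.2]
        _ = ε / 2 := by rw [hδ]; field_simp
    have h3 : |d t| - |d s| ≤ |d s - d t| := by
      rw [abs_sub_comm]; exact abs_sub_abs_le_abs_sub _ _
    linarith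
  have hdrop : V (t + δ) - V t ≤ -η * (t + δ - t) := by
    refine (convex_Icc t (t + δ)).image_sub_le_mul_sub_of_deriv_le
      (fun x hx => (hT x (lt_of_lt_of_le ht hx.1)).1.continuousAt.continuousWithinAt)
      (fun x hx => ?_) (fun x hx => ?_) t (by simp [hδ0.le]) (t + δ) (by simp [hδ0.le])
      (by linarith)
    · have hx' := interior_subset hx
      exact (hT x (lt_of_lt_of_le ht hx'.1)).1.differentiableAt.differentiableWithinAt
    · have hx' := interior_subset hx
      have h4 := hT x (lt_of_lt_of_le ht hx'.1)
      rw [h4.1.deriv]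
      exact h4.2.2.2.1 (hlarge x hx')
  have := (hT t ht).2.2.2.2
  nlinarith

theorem exists_tendsto_of_antitoneOn_Ioi {f : ℝ → ℝ} {T b : ℝ} (hf : AntitoneOn f (Ioi T))
    (hb : ∀ t, T < t → b ≤ f t) :
    ∃ c, b ≤ c ∧ (∀ t, T < t → c ≤ f t) ∧ Tendsto f atTop (𝓝 c) := by
  set g : ℝ → ℝ := fun t => f (max t (T + 1)) with hg
  have hT : ∀ t : ℝ, T < max t (T + 1) := fun t =>
    lt_of_lt_of_le (by linarith : T < T + 1) (le_max_right _ _)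
  have hganti : Antitone g := fun s t hst => hf (hT s) (hT t) (max_le_max_right _ hst)
  have hgb : BddBelow (range g) := ⟨b, by rintro _ ⟨t, rfl⟩; exact hb _ (hT t)⟩
  have hlim := tendsto_atTop_ciInf hganti hgb
  have hfg : g =ᶠ[atTop] f := by
    filter_upwards [eventually_ge_atTop (T + 1)] with t ht
    simp [hg, max_eq_left ht]
  have hlimf : Tendsto f atTop (𝓝 (⨅ i, g i)) := hlim.congr' hfg
  refine ⟨_, le_ciInf fun t => hb _ (hT t), fun t ht => ?_, hlimf⟩
  refine le_of_tendsto hlimf ?_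
  filter_upwards [eventually_ge_atTop t] with s hs
  exact hf ht (lt_of_lt_of_le ht hs) hs

/-! ### The Emden-Fowler system: slopes and a priori bounds -/

/-- The system `F' = w^{1/m} e^{βt}`, `w' = -e^{-θt} F^q` satisfied near `+∞` by a positive radial
solution `F(t) = u(e^{-t})` and its flux. -/
structure EmdenFowler (m β θ q T : ℝ) (F w : ℝ → ℝ) : Prop where
  m_pos : 0 < m
  β_pos : 0 < β
  lt_q : m < q
  lt_θ : β * m < θ
  F_pos : ∀ t, T < t → 0 < F t
  w_pos : ∀ t, T < t → 0 < w t
  F_deriv : ∀ t, T < t → HasDerivAt F (w t ^ (1 / m) * Real.exp (β * t)) t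
  w_deriv : ∀ t, T < t → HasDerivAt w (-(Real.exp (-(θ * t)) * F t ^ q)) t

/-- The logarithmic slope `F' / F` of an Emden-Fowler system. -/
noncomputable def efSlope (m β : ℝ) (F w : ℝ → ℝ) (t : ℝ) : ℝ := w t ^ (1 / m) * Real.exp (β * t) / F t

/-- The logarithmic slope `-w' / w` of the flux. -/
noncomputable def efFluxSlope (θ q : ℝ) (F w : ℝ → ℝ) (t : ℝ) : ℝ := Real.exp (-(θ * t)) * F t ^ q / w t

/-- The scale invariant power `(e^{-γt} F)^{q-m}`, where `γ = (θ - βm) / (q - m)`. -/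
noncomputable def efPower (m β θ q : ℝ) (F : ℝ → ℝ) (t : ℝ) : ℝ :=
  F t ^ (q - m) * Real.exp (-((θ - β * m) * t))

namespace EmdenFowler

variable {m β θ q T : ℝ} {F w : ℝ → ℝ}

theorem θ_pos (h : EmdenFowler m β θ q T F w) : 0 < θ :=
  (mul_pos h.β_pos h.m_pos).trans h.lt_θ

theorem q_pos (h : EmdenFowler m β θ q T F w) : 0 < q := h.m_pos.trans h.lt_q

theorem slope_pos (h : EmdenFowler m β θ q T F w) {t : ℝ} (ht : T < t) :
    0 < efSlope m β F w t := by
  have := h.F_pos t ht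
  have := h.w_pos t ht
  unfold efSlope; positivity

theorem fluxSlope_pos (h : EmdenFowler m β θ q T F w) {t : ℝ} (ht : T < t) :
    0 < efFluxSlope θ q F w t := by
  have := h.F_pos t ht
  have := h.w_pos t ht
  unfold efFluxSlope; positivity

theorem power_pos (h : EmdenFowler m β θ q T F w) {t : ℝ} (ht : T < t) :
    0 < efPower m β θ q F t := by
  have := h.F_pos t ht
  unfold efPower; positivity

theorem w_root_pow (h : EmdenFowler m β θ q T F w) {t : ℝ} (ht : T < t) :
    (w t ^ (1 / m)) ^ m = w t := by
  rw [← Real.rpow_mul (h.w_pos t ht).le, one_div_mul_cancel h.m_pos.ne', Real.rpow_one]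

/-- The flux cancels in `X^m Y`. This identity turns smallness of the scale invariant power into
smallness of `Y` wherever `X` is bounded below. -/
theorem slope_pow_mul_fluxSlope (h : EmdenFowler m β θ q T F w) {t : ℝ} (ht : T < t) :
    efSlope m β F w t ^ m * efFluxSlope θ q F w t = efPower m β θ q F t := by
  have hF := h.F_pos t ht
  have hw := h.w_pos t ht
  unfold efSlope efFluxSlope efPower
  rw [Real.div_rpow (by positivity) hF.le, Real.mul_rpow (by positivity) (by positivity),
    h.w_root_pow ht, Real.rpow_sub hF, ← Real.exp_mul,
    show -((θ - β * m) * t) = β * t * m + -(θ * t) by ring, Real.exp_add]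
  have : 0 < F t ^ m := by positivity
  field_simp

/-- The logarithmic derivative of `w^{1/m} e^{βt} / F` is `-Y/m + β - X`. The value `X = β` is the
slope of the fundamental solution. -/
theorem hasDerivAt_slope (h : EmdenFowler m β θ q T F w) {t : ℝ} (ht : T < t) :
    HasDerivAt (efSlope m β F w)
      (efSlope m β F w t * (β - efSlope m β F w t - efFluxSlope θ q F w t / m)) t := by
  have hF := h.F_pos t ht
  have hw := h.w_pos t ht
  have hm := h.m_pos
  have h1 := (h.w_deriv t ht).rpow_const (p := 1 / m) (Or.inl hw.ne')
  have h2 : HasDerivAt (fun t => Real.exp (β * t)) (Real.exp (β * t) * (β * 1)) t :=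
    ((hasDerivAt_id t).const_mul β).exp
  refine ((h1.mul h2).div (h.F_deriv t ht) hF.ne').congr_deriv ?_
  simp only [efSlope, efFluxSlope, Pi.mul_apply, Real.rpow_sub_one hw.ne']
  field_simp
  ring

theorem hasDerivAt_power (h : EmdenFowler m β θ q T F w) {t : ℝ} (ht : T < t) :
    HasDerivAt (efPower m β θ q F)
      (efPower m β θ q F t * ((q - m) * efSlope m β F w t - (θ - β * m))) t := by
  have hF := h.F_pos t ht
  have hw := h.w_pos t ht
  have h1 := (h.F_deriv t ht).rpow_const (p := q - m) (Or.inl hF.ne')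
  have h2 : HasDerivAt (fun t => Real.exp (-((θ - β * m) * t)))
      (Real.exp (-((θ - β * m) * t)) * -((θ - β * m) * 1)) t :=
    ((hasDerivAt_id t).const_mul (θ - β * m)).neg.exp
  refine (h1.mul h2).congr_deriv ?_
  simp only [efSlope, efPower, Real.rpow_sub_one hF.ne']
  field_simp
  ring

theorem monotoneOn_F (h : EmdenFowler m β θ q T F w) : MonotoneOn F (Ioi T) :=
  monotoneOn_Ioi_of_hasDerivAt_nonneg h.F_deriv fun t ht => by
    have := h.w_pos t ht
    positivity

theorem antitoneOn_w (h : EmdenFowler m β θ q T F w) : AntitoneOn w (Ioi T) :=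
  antitoneOn_Ioi_of_hasDerivAt_nonpos h.w_deriv fun t ht => by
    have := h.F_pos t ht
    rw [neg_nonpos]
    positivity

theorem exists_tendsto_w (h : EmdenFowler m β θ q T F w) :
    ∃ c, 0 ≤ c ∧ (∀ t, T < t → c ≤ w t) ∧ Tendsto w atTop (𝓝 c) :=
  exists_tendsto_of_antitoneOn_Ioi h.antitoneOn_w fun t ht => (h.w_pos t ht).le

theorem tendsto_exp_β (h : EmdenFowler m β θ q T F w) :
    Tendsto (fun t => Real.exp (β * t)) atTop atTop :=
  Real.tendsto_exp_atTop.comp (tendsto_id.const_mul_atTop h.β_pos)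

/-- `u / |x|^{-β}` has a limit at the origin. -/
theorem tendsto_F_div_exp (h : EmdenFowler m β θ q T F w) {c : ℝ} (hc : Tendsto w atTop (𝓝 c)) :
    Tendsto (fun t => F t / Real.exp (β * t)) atTop (𝓝 (c ^ (1 / m) / β)) := by
  have hβ := h.β_pos
  refine tendsto_div_of_tendsto_deriv_div (g' := fun t => Real.exp (β * t) * (β * 1))
    ((eventually_gt_atTop T).mono h.F_deriv)
    (Eventually.of_forall fun t => ((hasDerivAt_id t).const_mul β).exp)
    (Eventually.of_forall fun t => by positivity) h.tendsto_exp_β ?_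
  have h1 : Tendsto (fun t => w t ^ (1 / m) / β) atTop (𝓝 (c ^ (1 / m) / β)) :=
    (hc.rpow_const (Or.inr (by have := h.m_pos; positivity))).div_const β
  refine h1.congr fun t => ?_
  have := Real.exp_pos (β * t)
  field_simp

/-- Since `w` decreases, integrating `F'` from `S` to `t` gives `F(t) ≥ w(t)^{1/m} (e^{βt} - e^{βS})
/ β`. As `t - S → ∞` this yields `limsup X ≤ β`. -/
theorem slope_mul_le (h : EmdenFowler m β θ q T F w) {S t : ℝ} (hS : T < S) (ht : S ≤ t) :
    efSlope m β F w t * (1 - Real.exp (-(β * (t - S)))) ≤ β := by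
  have hβ := h.β_pos
  have hF := h.F_pos t (lt_of_lt_of_le hS ht)
  have hw := h.w_pos t (lt_of_lt_of_le hS ht)
  have hmono : MonotoneOn (fun s => F s - w t ^ (1 / m) * Real.exp (β * s) / β) (Icc S t) := by
    have hd : ∀ s ∈ Icc S t, HasDerivAt (fun s => F s - w t ^ (1 / m) * Real.exp (β * s) / β)
        (w s ^ (1 / m) * Real.exp (β * s) -
          w t ^ (1 / m) * (Real.exp (β * s) * (β * 1)) / β) s := fun s hs =>
      (h.F_deriv s (lt_of_lt_of_le hS hs.1)).sub
        (((((hasDerivAt_id s).const_mul β).exp).const_mul _).div_const β)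
    refine monotoneOn_of_hasDerivWithinAt_nonneg (convex_Icc S t)
      (fun s hs => (hd s hs).continuousAt.continuousWithinAt)
      (fun s hs => (hd s (interior_subset hs)).hasDerivWithinAt) fun s hs => ?_
    have hs' := interior_subset hs
    have h1 : w t ≤ w s := h.antitoneOn_w (lt_of_lt_of_le hS hs'.1) (lt_of_lt_of_le hS ht) hs'.2
    have h2 : w t ^ (1 / m) ≤ w s ^ (1 / m) :=
      Real.rpow_le_rpow hw.le h1 (by have := h.m_pos; positivity)
    have h3 : w t ^ (1 / m) * (Real.exp (β * s) * (β * 1)) / β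
        = w t ^ (1 / m) * Real.exp (β * s) := by field_simp
    rw [h3, ← sub_mul]
    exact mul_nonneg (sub_nonneg.2 h2) (Real.exp_pos _).le
  have h4 := hmono ⟨le_rfl, ht⟩ ⟨ht, le_rfl⟩ ht
  simp only at h4
  have hFS := h.F_pos S hS
  unfold efSlope
  rw [div_mul_eq_mul_div, div_le_iff₀ hF, mul_sub, mul_one, mul_assoc, ← Real.exp_add,
    show β * t + -(β * (t - S)) = β * S by ring]
  have h5 : w t ^ (1 / m) * Real.exp (β * t) / β - w t ^ (1 / m) * Real.exp (β * S) / β ≤ F t := by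
    linarith
  rw [← sub_div, div_le_iff₀ hβ] at h5
  linarith

theorem eventually_slope_lt (h : EmdenFowler m β θ q T F w) {b : ℝ} (hb : β < b) :
    ∀ᶠ t in atTop, efSlope m β F w t < b := by
  have hβ := h.β_pos
  have h1 : Tendsto (fun t => Real.exp (-(β * (t - (T + 1))))) atTop (𝓝 0) := by
    refine Real.tendsto_exp_atBot.comp (tendsto_neg_atTop_atBot.comp ?_)
    exact (tendsto_atTop_add_const_right _ (-(T + 1)) tendsto_id).const_mul_atTop hβ
  have h2 : Tendsto (fun t => b * (1 - Real.exp (-(β * (t - (T + 1)))))) atTop (𝓝 (b * (1 - 0))) :=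
    (h1.const_sub 1).const_mul b
  filter_upwards [h2.eventually (eventually_gt_nhds (by linarith : β < b * (1 - 0))),
    eventually_gt_atTop (T + 1)] with t ht1 ht2
  have h3 := h.slope_mul_le (by linarith : T < T + 1) ht2.le
  by_contra! hcon
  have h4 : 0 ≤ 1 - Real.exp (-(β * (t - (T + 1)))) := by
    rw [sub_nonneg, Real.exp_le_one_iff]
    have : 0 ≤ β * (t - (T + 1)) := mul_nonneg hβ.le (by linarith)
    linarith
  have := mul_le_mul_of_nonneg_right hcon h4
  linarith

/-- Since `F` increases and `w` stays positive, `w(t) ≥ ∫_t^∞ e^{-θs} F(s)^q ds ≥ F(t)^q e^{-θt} /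
θ`. The integral is replaced by the monotone quantity `w - F(t)^q e^{-θs} / θ`. -/
theorem fluxSlope_le (h : EmdenFowler m β θ q T F w) {t : ℝ} (ht : T < t) :
    efFluxSlope θ q F w t ≤ θ := by
  have hθ := h.θ_pos
  have hF := h.F_pos t ht
  have hw := h.w_pos t ht
  have hanti : AntitoneOn (fun s => w s - F t ^ q * Real.exp (-(θ * s)) / θ) (Ici t) := by
    have hd : ∀ s ∈ Ici t, HasDerivAt (fun s => w s - F t ^ q * Real.exp (-(θ * s)) / θ)
        (-(Real.exp (-(θ * s)) * F s ^ q) -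
          F t ^ q * (Real.exp (-(θ * s)) * -(θ * 1)) / θ) s := fun s hs =>
      (h.w_deriv s (lt_of_lt_of_le ht hs)).sub
        (((((hasDerivAt_id s).const_mul θ).neg.exp).const_mul _).div_const θ)
    refine antitoneOn_of_hasDerivWithinAt_nonpos (convex_Ici t)
      (fun s hs => (hd s hs).continuousAt.continuousWithinAt)
      (fun s hs => (hd s (interior_subset hs)).hasDerivWithinAt) fun s hs => ?_
    have hs' : t ≤ s := interior_subset hs
    have h1 : F t ≤ F s := h.monotoneOn_F ht (lt_of_lt_of_le ht hs') hs'
    have h2 : F t ^ q ≤ F s ^ q := Real.rpow_le_rpow hF.le h1 h.q_pos.le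
    have h3 : F t ^ q * (Real.exp (-(θ * s)) * -(θ * 1)) / θ
        = -(Real.exp (-(θ * s)) * F t ^ q) := by field_simp
    rw [h3]
    have := mul_le_mul_of_nonneg_left h2 (Real.exp_pos (-(θ * s))).le
    linarith
  have hlim : Tendsto (fun s => -(F t ^ q * Real.exp (-(θ * s)) / θ)) atTop
      (𝓝 (-(F t ^ q * 0 / θ))) := by
    have h1 : Tendsto (fun s => Real.exp (-(θ * s))) atTop (𝓝 0) :=
      Real.tendsto_exp_atBot.comp (tendsto_neg_atTop_atBot.comp (tendsto_id.const_mul_atTop hθ))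
    exact ((h1.const_mul _).div_const _).neg
  simp only [mul_zero, zero_div, neg_zero] at hlim
  have h5 : 0 ≤ w t - F t ^ q * Real.exp (-(θ * t)) / θ := by
    refine le_of_tendsto hlim ?_
    filter_upwards [eventually_ge_atTop t] with s hs
    have h6 := hanti (self_mem_Ici) hs hs
    have h7 := h.w_pos s (lt_of_lt_of_le ht hs)
    simp only at h6
    linarith
  unfold efFluxSlope
  rw [div_le_iff₀ hw]
  rw [sub_nonneg, div_le_iff₀ hθ] at h5
  linarith

/-- In the critical and supercritical ranges the flux vanishes at the origin. -/
theorem flux_limit_eq_zero (h : EmdenFowler m β θ q T F w) {c : ℝ} (hc0 : 0 ≤ c)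
    (hcw : ∀ t, T < t → c ≤ w t) (hq : θ ≤ q * β) : c = 0 := by
  by_contra hne
  have hc : 0 < c := lt_of_le_of_ne hc0 (Ne.symm hne)
  have hβ := h.β_pos
  -- A positive limit `c` forces `F ≥ const * e^{βt}`, because `X < 2β` eventually. Then `e^{-θt}
  -- F^q ≥ const` when `qβ ≥ θ`, and `w` decreases linearly.
  have hbot : Tendsto w atTop atBot := by
    refine tendsto_atBot_of_hasDerivAt_le (k := (c ^ (1 / m) / (2 * β)) ^ q) (by positivity)
      ((eventually_gt_atTop T).mono h.w_deriv) ?_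
    filter_upwards [eventually_gt_atTop T, eventually_ge_atTop 0,
      h.eventually_slope_lt (by linarith : β < 2 * β)] with t ht ht0 hX
    have hF := h.F_pos t ht
    have hw := h.w_pos t ht
    unfold efSlope at hX
    rw [div_lt_iff₀ hF] at hX
    have h1 : c ^ (1 / m) ≤ w t ^ (1 / m) :=
      Real.rpow_le_rpow hc.le (hcw t ht) (by have := h.m_pos; positivity)
    have h2 : c ^ (1 / m) / (2 * β) * Real.exp (β * t) ≤ F t := by
      rw [div_mul_eq_mul_div, div_le_iff₀ (by positivity)]
      have := mul_le_mul_of_nonneg_right h1 (Real.exp_pos (β * t)).le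
      linarith
    have h3 : (c ^ (1 / m) / (2 * β)) ^ q * Real.exp (β * t) ^ q ≤ F t ^ q := by
      rw [← Real.mul_rpow (by positivity) (by positivity)]
      exact Real.rpow_le_rpow (by positivity) h2 h.q_pos.le
    have h4 : 1 ≤ Real.exp (-(θ * t)) * Real.exp (β * t) ^ q := by
      rw [← Real.exp_mul, ← Real.exp_add, Real.one_le_exp_iff]
      nlinarith
    rw [neg_le_neg_iff]
    calc (c ^ (1 / m) / (2 * β)) ^ q
        ≤ (c ^ (1 / m) / (2 * β)) ^ q * (Real.exp (-(θ * t)) * Real.exp (β * t) ^ q) :=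
          le_mul_of_one_le_right (by positivity) h4
      _ = Real.exp (-(θ * t)) * ((c ^ (1 / m) / (2 * β)) ^ q * Real.exp (β * t) ^ q) := by ring
      _ ≤ _ := by gcongr
  obtain ⟨t, ht, ht2⟩ := ((hbot.eventually (eventually_lt_atBot 0)).and
    (eventually_gt_atTop T)).exists
  linarith [h.w_pos t ht2]

end EmdenFowler

/-! ### Zero flux: boundedness, or the slope of the fundamental solution -/

namespace EmdenFowler

variable {m β θ q T : ℝ} {F w : ℝ → ℝ}

theorem fluxSlope_le_of_le_slope (h : EmdenFowler m β θ q T F w) {t δ : ℝ} (ht : T < t)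
    (hδ : 0 < δ) (hX : δ ≤ efSlope m β F w t) :
    efFluxSlope θ q F w t ≤ efPower m β θ q F t / δ ^ m := by
  rw [le_div_iff₀ (by positivity), ← h.slope_pow_mul_fluxSlope ht, mul_comm]
  exact mul_le_mul_of_nonneg_right (Real.rpow_le_rpow hδ.le hX h.m_pos.le) (h.fluxSlope_pos ht).le

/-- Once `P` is small, the level `δ` can be crossed only upwards: at `X = δ` one has `Y ≤ P / δ^m <
m (β - δ)`, so `X' > 0`. -/
theorem slope_dichotomy (h : EmdenFowler m β θ q T F w)
    (hP : Tendsto (efPower m β θ q F) atTop (𝓝 0)) {δ : ℝ} (hδ : 0 < δ) (hδβ : δ < β) :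
    (∀ᶠ t in atTop, efSlope m β F w t < δ) ∨ ∀ᶠ t in atTop, δ ≤ efSlope m β F w t := by
  have hm := h.m_pos
  have hβδ : 0 < β - δ := sub_pos.2 hδβ
  have hev : ∀ᶠ t in atTop, efPower m β θ q F t < δ ^ m * (m * (β - δ)) :=
    hP.eventually (eventually_lt_nhds (by positivity))
  obtain ⟨S, hTS, hS⟩ := eventually_atTop_gt hev T
  by_cases hex : ∃ t₁, S < t₁ ∧ δ ≤ efSlope m β F w t₁
  · obtain ⟨t₁, ht₁, hX₁⟩ := hex
    right
    filter_upwards [eventually_ge_atTop t₁] with t ht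
    have hT : ∀ s, t₁ ≤ s → T < s := fun s hs => by linarith
    refine image_le_of_deriv_right_lt_deriv_boundary' (a := t₁) (b := t) (f := fun _ => δ)
      (f' := fun _ => 0) continuousOn_const (fun x _ => hasDerivWithinAt_const _ _ _) hX₁
      (fun x hx => (h.hasDerivAt_slope (hT x hx.1)).continuousAt.continuousWithinAt)
      (fun x hx => (h.hasDerivAt_slope (hT x hx.1)).hasDerivWithinAt) (fun x hx hxe => ?_)
      ⟨ht, le_rfl⟩
    rw [← hxe]
    refine mul_pos hδ ?_
    have h1 := h.fluxSlope_le_of_le_slope (hT x hx.1) hδ hxe.le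
    have h2 := hS x (lt_of_lt_of_le ht₁ hx.1)
    have h3 : efFluxSlope θ q F w x < m * (β - δ) := by
      refine h1.trans_lt ?_
      rw [div_lt_iff₀ (by positivity)]
      linarith
    have h4 : efFluxSlope θ q F w x / m < β - δ := by
      rw [div_lt_iff₀ hm]; linarith
    linarith
  · left
    push Not at hex
    filter_upwards [eventually_gt_atTop S] with t ht using hex t ht

/-- Only `liminf X ≥ β` is in question. If `X` stayed in `[δ, g)` with `g < β`, then `Y → 0` would
give `X' ≥ δ (β - g) / 2`, and `X` would be unbounded. -/
theorem tendsto_slope (h : EmdenFowler m β θ q T F w)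
    (hP : Tendsto (efPower m β θ q F) atTop (𝓝 0)) {δ : ℝ} (hδ : 0 < δ)
    (hX : ∀ᶠ t in atTop, δ ≤ efSlope m β F w t) :
    Tendsto (efSlope m β F w) atTop (𝓝 β) := by
  have hm := h.m_pos
  refine tendsto_order.2 ⟨fun b hb => ?_, fun b hb => h.eventually_slope_lt hb⟩
  obtain ⟨g, hg1, hgβ⟩ := exists_between (max_lt hb h.β_pos)
  have hg0 : 0 < g := (le_max_right _ _).trans_lt hg1
  rcases h.slope_dichotomy hP hg0 hgβ with hlt | hge
  · exfalso
    have hβg : 0 < β - g := sub_pos.2 hgβ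
    have hev : ∀ᶠ t in atTop, efPower m β θ q F t < δ ^ m * (m * ((β - g) / 2)) :=
      hP.eventually (eventually_lt_nhds (by positivity))
    have htop : Tendsto (efSlope m β F w) atTop atTop := by
      refine tendsto_atTop_of_hasDerivAt_ge (k := δ * ((β - g) / 2)) (by positivity)
        ((eventually_gt_atTop T).mono fun t ht => h.hasDerivAt_slope ht) ?_
      filter_upwards [eventually_gt_atTop T, hX, hlt, hev] with t ht h1 h2 h3
      have h4 : efFluxSlope θ q F w t / m ≤ (β - g) / 2 := by
        have := h.fluxSlope_le_of_le_slope ht hδ h1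
        rw [le_div_iff₀ (by positivity)] at this
        rw [div_le_iff₀ hm]
        have hpos : 0 < δ ^ m := by positivity
        by_contra! hcon
        nlinarith
      exact mul_le_mul h1 (by linarith) (by positivity) (hδ.le.trans h1)
    obtain ⟨t, ht1, ht2⟩ := (hlt.and (htop.eventually_gt_atTop g)).exists
    linarith
  · filter_upwards [hge] with t ht
    exact ((le_max_left _ _).trans_lt hg1).trans_le ht

/-- A bootstrap in three integrations: `X < δ` gives `F ≤ C e^{δt}`; integrating `w'` from infinity,
where `w` vanishes, gives `w ≤ D e^{-κt}` with `κ = θ - qδ > βm`; then `F' ≤ D^{1/m} e^{-(κ/m -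
β)t}` is integrable. -/
theorem bounded_of_slope_lt (h : EmdenFowler m β θ q T F w) (hw0 : Tendsto w atTop (𝓝 0))
    {δ : ℝ} (hqδ : q * δ < θ - β * m) (hX : ∀ᶠ t in atTop, efSlope m β F w t < δ) :
    ∃ B, ∀ᶠ t in atTop, F t ≤ B := by
  have hm := h.m_pos
  obtain ⟨S, hTS, hS⟩ := eventually_atTop_gt hX T
  have hT : ∀ t, S < t → T < t := fun t ht => by linarith
  have hS1 : S + 1 ∈ Ioi S := by simp
  have hanti : AntitoneOn (fun t => F t * Real.exp (-(δ * t))) (Ioi S) := by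
    refine antitoneOn_Ioi_of_hasDerivAt_nonpos (f' := fun t => w t ^ (1 / m) * Real.exp (β * t) *
      Real.exp (-(δ * t)) + F t * (Real.exp (-(δ * t)) * -(δ * 1)))
      (fun t ht => (h.F_deriv t (hT t ht)).mul ((hasDerivAt_id t).const_mul δ).neg.exp)
      fun t ht => ?_
    have h1 := hS t ht
    unfold efSlope at h1
    rw [div_lt_iff₀ (h.F_pos t (hT t ht))] at h1
    have := mul_lt_mul_of_pos_right h1 (Real.exp_pos (-(δ * t)))
    linarith
  set C := F (S + 1) * Real.exp (-(δ * (S + 1))) with hC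
  have hFS := h.F_pos (S + 1) (hT _ hS1)
  have hC0 : 0 < C := by positivity
  have hFle : ∀ t, S + 1 ≤ t → F t ≤ C * Real.exp (δ * t) := by
    intro t ht
    have h1 : F t * Real.exp (-(δ * t)) ≤ C := hanti hS1 (lt_of_lt_of_le hS1 ht) ht
    calc F t = F t * Real.exp (-(δ * t)) * Real.exp (δ * t) := by
          rw [mul_assoc, ← Real.exp_add, neg_add_cancel, Real.exp_zero, mul_one]
      _ ≤ _ := mul_le_mul_of_nonneg_right h1 (Real.exp_pos _).le
  set κ := θ - q * δ with hκ
  have hκ0 : β * m < κ := by rw [hκ]; linarith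
  have hκpos : 0 < κ := (mul_pos h.β_pos hm).trans hκ0
  set D := C ^ q / κ with hD
  have hD0 : 0 < D := by positivity
  have hwle : ∀ t, S + 1 < t → w t ≤ D * Real.exp (-(κ * t)) := by
    have hmono : MonotoneOn (fun t => w t - D * Real.exp (-(κ * t))) (Ioi (S + 1)) := by
      refine monotoneOn_Ioi_of_hasDerivAt_nonneg
        (f' := fun t => -(Real.exp (-(θ * t)) * F t ^ q) -
          D * (Real.exp (-(κ * t)) * -(κ * 1)))
        (fun t ht => (h.w_deriv t (by linarith)).sub
          (((hasDerivAt_id t).const_mul κ).neg.exp.const_mul D)) fun t ht => ?_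
      have h1 : F t ^ q ≤ C ^ q * Real.exp (q * δ * t) := by
        have := Real.rpow_le_rpow (h.F_pos t (by linarith)).le (hFle t ht.le) h.q_pos.le
        rw [Real.mul_rpow hC0.le (Real.exp_pos _).le, ← Real.exp_mul] at this
        rwa [show q * δ * t = δ * t * q by ring]
      have h2 : D * (Real.exp (-(κ * t)) * -(κ * 1))
          = -(Real.exp (-(θ * t)) * (C ^ q * Real.exp (q * δ * t))) := by
        rw [show -(κ * t) = -(θ * t) + q * δ * t by rw [hκ]; ring, Real.exp_add, hD]
        field_simp
      rw [h2]
      have := mul_le_mul_of_nonneg_left h1 (Real.exp_pos (-(θ * t))).le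
      linarith
    have hlim : Tendsto (fun t => w t - D * Real.exp (-(κ * t))) atTop (𝓝 (0 - D * 0)) :=
      hw0.sub ((Real.tendsto_exp_atBot.comp
        (tendsto_neg_atTop_atBot.comp (tendsto_id.const_mul_atTop hκpos))).const_mul D)
    intro t ht
    have : w t - D * Real.exp (-(κ * t)) ≤ 0 - D * 0 := by
      refine ge_of_tendsto hlim ?_
      filter_upwards [eventually_ge_atTop t] with s hs
      exact hmono ht (lt_of_lt_of_le ht hs) hs
    linarith
  set κ₂ := κ / m - β with hκ₂
  have hκ₂0 : 0 < κ₂ := by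
    rw [hκ₂, sub_pos, lt_div_iff₀ hm]; exact hκ0
  set A := D ^ (1 / m) / κ₂ with hA
  have hA0 : 0 < A := by positivity
  have hanti2 : AntitoneOn (fun t => F t + A * Real.exp (-(κ₂ * t))) (Ioi (S + 1)) := by
    refine antitoneOn_Ioi_of_hasDerivAt_nonpos
      (f' := fun t => w t ^ (1 / m) * Real.exp (β * t) + A * (Real.exp (-(κ₂ * t)) * -(κ₂ * 1)))
      (fun t ht => (h.F_deriv t (by linarith)).add
        (((hasDerivAt_id t).const_mul κ₂).neg.exp.const_mul A)) fun t ht => ?_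
    have h1 : w t ^ (1 / m) ≤ D ^ (1 / m) * Real.exp (-(κ / m * t)) := by
      have := Real.rpow_le_rpow (h.w_pos t (by linarith)).le (hwle t ht)
        (by positivity : 0 ≤ 1 / m)
      rw [Real.mul_rpow hD0.le (Real.exp_pos _).le, ← Real.exp_mul] at this
      rwa [show -(κ / m * t) = -(κ * t) * (1 / m) by ring]
    have h2 : A * (Real.exp (-(κ₂ * t)) * -(κ₂ * 1))
        = -(D ^ (1 / m) * Real.exp (-(κ / m * t)) * Real.exp (β * t)) := by
      rw [show -(κ₂ * t) = -(κ / m * t) + β * t by rw [hκ₂]; ring, Real.exp_add, hA]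
      field_simp
    rw [h2]
    have := mul_le_mul_of_nonneg_right h1 (Real.exp_pos (β * t)).le
    linarith
  refine ⟨F (S + 2) + A * Real.exp (-(κ₂ * (S + 2))), ?_⟩
  filter_upwards [eventually_ge_atTop (S + 2)] with t ht
  have h1 := hanti2 (by simp only [mem_Ioi]; linarith : S + 2 ∈ Ioi (S + 1))
    (by simp only [mem_Ioi]; linarith) ht
  simp only at h1
  have : 0 < A * Real.exp (-(κ₂ * t)) := by positivity
  linarith

/-- If the scale invariant power of `u` vanishes at the origin and so does the flux, either `u` is
bounded or it behaves like the fundamental solution. -/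
theorem bounded_or_tendsto_slope (h : EmdenFowler m β θ q T F w) (hw0 : Tendsto w atTop (𝓝 0))
    (hP : Tendsto (efPower m β θ q F) atTop (𝓝 0)) :
    (∃ B, ∀ᶠ t in atTop, F t ≤ B) ∨ Tendsto (efSlope m β F w) atTop (𝓝 β) := by
  have hq := h.q_pos
  have h1 : 0 < (θ - β * m) / q := div_pos (sub_pos.2 h.lt_θ) hq
  -- The level must lie below `β` for the dichotomy and below `(θ - βm)/q` for the bootstrap.
  obtain ⟨δ, hδ0, hδ⟩ := exists_between (lt_min h.β_pos h1)
  have h2 : q * δ < θ - β * m := by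
    have := hδ.trans_le (min_le_right _ _)
    rw [lt_div_iff₀ hq] at this
    linarith
  rcases h.slope_dichotomy hP hδ0 (hδ.trans_le (min_le_left _ _)) with hlt | hge
  · exact Or.inl (h.bounded_of_slope_lt hw0 h2 hlt)
  · exact Or.inr (h.tendsto_slope hP hδ0 hge)

/-- For `qβ ≤ θ` and `t ≥ 0`, `P` is at most `(F e^{-βt})^{q - m}`, which vanishes at infinity
because the flux does. -/
theorem tendsto_power_zero (h : EmdenFowler m β θ q T F w) (hw0 : Tendsto w atTop (𝓝 0))
    (hq : q * β ≤ θ) : Tendsto (efPower m β θ q F) atTop (𝓝 0) := by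
  have hqm : 0 < q - m := sub_pos.2 h.lt_q
  have h1 := h.tendsto_F_div_exp hw0
  rw [Real.zero_rpow (by have := h.m_pos; positivity), zero_div] at h1
  have h2 : Tendsto (fun t => (F t / Real.exp (β * t)) ^ (q - m)) atTop (𝓝 0) := by
    have := h1.rpow_const (p := q - m) (Or.inr hqm.le)
    rwa [Real.zero_rpow hqm.ne'] at this
  refine squeeze_zero' ?_ ?_ h2
  · filter_upwards [eventually_gt_atTop T] with t ht using (h.power_pos ht).le
  · filter_upwards [eventually_gt_atTop T, eventually_ge_atTop 0] with t ht ht0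
    have hF := h.F_pos t ht
    rw [Real.div_rpow hF.le (Real.exp_pos _).le, ← Real.exp_mul, div_eq_mul_inv, ← Real.exp_neg]
    unfold efPower
    refine mul_le_mul_of_nonneg_left (Real.exp_le_exp.2 ?_) (by positivity)
    nlinarith [mul_nonneg (sub_nonneg.2 hq) ht0]

/-- If `X → β`, then `P` decays exponentially, because `(q - m) β < θ - βm`. Hence `Y = -(log w)'`
is integrable and `w` stays away from `0`, a contradiction. -/
theorem bounded_of_subcritical (h : EmdenFowler m β θ q T F w) (hw0 : Tendsto w atTop (𝓝 0))
    (hq : q * β < θ) : ∃ B, ∀ᶠ t in atTop, F t ≤ B := by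
  have hP := h.tendsto_power_zero hw0 hq.le
  rcases h.bounded_or_tendsto_slope hw0 hP with hb | hX
  · exact hb
  exfalso
  have hβ := h.β_pos
  set κ := (θ - q * β) / 2 with hκ
  have hκ0 : 0 < κ := by rw [hκ]; linarith
  have hev1 : ∀ᶠ t in atTop, (q - m) * efSlope m β F w t - (θ - β * m) < -κ := by
    have : Tendsto (fun t => (q - m) * efSlope m β F w t - (θ - β * m)) atTop
        (𝓝 ((q - m) * β - (θ - β * m))) := (hX.const_mul _).sub_const _
    refine this.eventually (eventually_lt_nhds ?_)
    rw [hκ]; linarith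
  have hev2 : ∀ᶠ t in atTop, β / 2 ≤ efSlope m β F w t :=
    hX.eventually (eventually_ge_nhds (by linarith))
  obtain ⟨S, hTS, hS⟩ := eventually_atTop_gt (hev1.and hev2) T
  -- From `P' ≤ -κ P` and `Y ≤ P / (β/2)^m`, this is the constant for which `log w - k P` is
  -- nondecreasing.
  set k := 1 / (κ * (β / 2) ^ m) with hk
  have hk0 : 0 < k := by positivity
  have hmono : MonotoneOn (fun t => Real.log (w t) - k * efPower m β θ q F t) (Ioi S) := by
    refine monotoneOn_Ioi_of_hasDerivAt_nonneg
      (f' := fun t => -(Real.exp (-(θ * t)) * F t ^ q) / w t -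
        k * (efPower m β θ q F t * ((q - m) * efSlope m β F w t - (θ - β * m))))
      (fun t ht => ((h.w_deriv t (by linarith)).log (h.w_pos t (by linarith)).ne').sub
        ((h.hasDerivAt_power (by linarith)).const_mul k)) fun t ht => ?_
    have hPt := h.power_pos (hTS.trans_lt ht)
    have h1 := h.fluxSlope_le_of_le_slope (hTS.trans_lt ht) (half_pos hβ) (hS t ht).2
    have h2 : efPower m β θ q F t / (β / 2) ^ m = k * (efPower m β θ q F t * κ) := by
      rw [hk]; field_simp
    have h3 : efPower m β θ q F t * ((q - m) * efSlope m β F w t - (θ - β * m))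
        ≤ efPower m β θ q F t * -κ := mul_le_mul_of_nonneg_left (hS t ht).1.le hPt.le
    have h4 := mul_le_mul_of_nonneg_left h3 hk0.le
    unfold efFluxSlope at h1
    rw [neg_div]
    linarith
  set L := Real.log (w (S + 1)) - k * efPower m β θ q F (S + 1)
  have hlow : ∀ᶠ t in atTop, Real.exp L ≤ w t := by
    filter_upwards [eventually_ge_atTop (S + 1)] with t ht
    have h1 : L ≤ Real.log (w t) - k * efPower m β θ q F t :=
      hmono (by simp : S + 1 ∈ Ioi S) (by simp; linarith) ht
    have h2 := mul_pos hk0 (h.power_pos (by linarith : T < t))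
    rw [← Real.le_log_iff_exp_le (h.w_pos t (by linarith))]
    linarith
  exact absurd (ge_of_tendsto hw0 hlow) (not_le.2 (Real.exp_pos L))

/-- If `X → β`, then `(q - m) X` eventually exceeds `θ - βm`, so the positive quantity `P` increases
and cannot tend to `0`. -/
theorem bounded_of_supercritical (h : EmdenFowler m β θ q T F w) (hw0 : Tendsto w atTop (𝓝 0))
    (hP : Tendsto (efPower m β θ q F) atTop (𝓝 0)) (hq : θ < q * β) :
    ∃ B, ∀ᶠ t in atTop, F t ≤ B := by
  rcases h.bounded_or_tendsto_slope hw0 hP with hb | hX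
  · exact hb
  exfalso
  have hev1 : ∀ᶠ t in atTop, 0 < (q - m) * efSlope m β F w t - (θ - β * m) := by
    have : Tendsto (fun t => (q - m) * efSlope m β F w t - (θ - β * m)) atTop
        (𝓝 ((q - m) * β - (θ - β * m))) := (hX.const_mul _).sub_const _
    refine this.eventually (eventually_gt_nhds ?_)
    linarith
  obtain ⟨S, hTS, hS⟩ := eventually_atTop_gt hev1 T
  have hmono : MonotoneOn (efPower m β θ q F) (Ioi S) :=
    monotoneOn_Ioi_of_hasDerivAt_nonneg (fun t ht => h.hasDerivAt_power (hTS.trans_lt ht))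
      fun t ht => mul_nonneg (h.power_pos (hTS.trans_lt ht)).le (hS t ht).le
  have hlow : ∀ᶠ t in atTop, efPower m β θ q F (S + 1) ≤ efPower m β θ q F t := by
    filter_upwards [eventually_ge_atTop (S + 1)] with t ht
    exact hmono (by simp) (by simp; linarith) ht
  exact absurd (ge_of_tendsto hP hlow) (not_le.2 (h.power_pos (by linarith)))

/-- When `qβ = θ`, the derivative of `w^{-(q-m)/m}` is `((q - m)/m) X^{-q}`. If `X → β` this
derivative converges, so `w^{-(q-m)/m}` grows linearly in `t`, and `F e^{-βt} = w^{1/m} / X`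
transfers the rate to `F`. -/
theorem bounded_or_tendsto_of_critical (h : EmdenFowler m β θ q T F w)
    (hw0 : Tendsto w atTop (𝓝 0)) (hq : q * β = θ) :
    (∃ B, ∀ᶠ t in atTop, F t ≤ B) ∨
      Tendsto (fun t => F t / Real.exp (β * t) * t ^ (1 / (q - m))) atTop
        (𝓝 ((m / (q - m) * β ^ m) ^ (1 / (q - m)))) := by
  refine (h.bounded_or_tendsto_slope hw0 (h.tendsto_power_zero hw0 hq.le)).imp_right fun hX => ?_
  have hβ := h.β_pos
  have hm := h.m_pos
  have hqm : 0 < q - m := sub_pos.2 h.lt_q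
  set e := -((q - m) / m) with he
  have hK : Tendsto (fun t => w t ^ e / t) atTop (𝓝 ((q - m) / m * β ^ (-q))) := by
    refine tendsto_div_self_of_tendsto_deriv
      (f' := fun t => -(Real.exp (-(θ * t)) * F t ^ q) * e * w t ^ (e - 1))
      ((eventually_gt_atTop T).mono fun t ht =>
        (h.w_deriv t ht).rpow_const (Or.inl (h.w_pos t ht).ne')) ?_
    have h1 : Tendsto (fun t => (q - m) / m * efSlope m β F w t ^ (-q)) atTop
        (𝓝 ((q - m) / m * β ^ (-q))) :=
      (hX.rpow_const (Or.inl hβ.ne')).const_mul _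
    refine h1.congr' ?_
    filter_upwards [eventually_gt_atTop T] with t ht
    have hF := h.F_pos t ht
    have hw := h.w_pos t ht
    unfold efSlope
    rw [Real.rpow_neg (by positivity), Real.div_rpow (by positivity) hF.le,
      Real.mul_rpow (by positivity) (by positivity), ← Real.rpow_mul hw.le, ← Real.exp_mul,
      show e - 1 = -(1 / m * q) by rw [he]; field_simp; ring, Real.rpow_neg hw.le, Real.exp_neg,
      show β * t * q = θ * t by rw [← hq]; ring, he]
    field_simp
  have h2 : Tendsto (fun t => (w t ^ e / t) ^ (-(1 / (q - m))) / efSlope m β F w t) atTop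
      (𝓝 (((q - m) / m * β ^ (-q)) ^ (-(1 / (q - m))) / β)) :=
    (hK.rpow_const (Or.inl (by positivity))).div hX hβ.ne'
  have h3 : ((q - m) / m * β ^ (-q)) ^ (-(1 / (q - m))) / β
      = (m / (q - m) * β ^ m) ^ (1 / (q - m)) := by
    rw [Real.rpow_neg (by positivity), ← Real.inv_rpow (by positivity), div_eq_iff hβ.ne']
    have h4 : (β ^ (q - m)) ^ (1 / (q - m)) = β := by
      rw [← Real.rpow_mul hβ.le, mul_one_div_cancel hqm.ne', Real.rpow_one]
    -- Splitting `β^q` as `β^m β^{q-m}` lets the second factor, raised to `1/(q - m)`, cancel the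
    -- division by the limit `β` of `X`.
    have h5 : ((q - m) / m * β ^ (-q))⁻¹ = m / (q - m) * β ^ m * β ^ (q - m) := by
      rw [mul_assoc, ← Real.rpow_add hβ, add_sub_cancel, Real.rpow_neg hβ.le]
      field_simp
    rw [h5, Real.mul_rpow (by positivity) (by positivity), h4]
  rw [← h3]
  refine h2.congr' ?_
  filter_upwards [eventually_gt_atTop T, eventually_gt_atTop 0] with t ht ht0
  have hF := h.F_pos t ht
  have hw := h.w_pos t ht
  have h5 : (w t ^ e) ^ (-(1 / (q - m))) = w t ^ (1 / m) := by
    rw [← Real.rpow_mul hw.le]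
    congr 1
    rw [he]; field_simp
  rw [Real.div_rpow (by positivity) ht0.le, h5, Real.rpow_neg ht0.le]
  unfold efSlope
  field_simp

end EmdenFowler

/-! ### The supercritical case: an energy argument -/

/-- The product is continuous and, by strict monotonicity of the power, positive off the diagonal;
it attains a positive minimum on the compact set `|a - b| ≥ ε`. This is the uniform dissipation
needed by `tendsto_zero_of_dissipation`. -/
theorem exists_pos_le_rpow_sub_mul_sub {m : ℝ} (hm : 0 < m) (A : ℝ) {ε : ℝ} (hε : 0 < ε) :
    ∃ η > 0, ∀ a ∈ Icc 0 A, ∀ b ∈ Icc 0 A, ε ≤ |a - b| → η ≤ (a ^ m - b ^ m) * (a - b) := by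
  set C : Set (ℝ × ℝ) := (Icc 0 A ×ˢ Icc 0 A) ∩ {x | ε ≤ |x.1 - x.2|} with hC
  have hCc : IsCompact C := (isCompact_Icc.prod isCompact_Icc).inter_right
    (isClosed_le continuous_const (continuous_fst.sub continuous_snd).abs)
  have hcont : ContinuousOn (fun x : ℝ × ℝ => (x.1 ^ m - x.2 ^ m) * (x.1 - x.2)) C := by
    refine Continuous.continuousOn ?_
    exact ((continuous_fst.rpow_const fun _ => Or.inr hm.le).sub
      (continuous_snd.rpow_const fun _ => Or.inr hm.le)).mul (continuous_fst.sub continuous_snd)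
  have hpos : ∀ x ∈ C, 0 < (x.1 ^ m - x.2 ^ m) * (x.1 - x.2) := by
    rintro ⟨a, b⟩ ⟨⟨ha, hb⟩, hab⟩
    simp only [mem_ofPred_eq] at hab ha hb ⊢
    rcases lt_trichotomy a b with h | h | h
    · have := Real.rpow_lt_rpow ha.1 h hm
      exact mul_pos_of_neg_of_neg (by linarith) (by linarith)
    · rw [h, sub_self, abs_zero] at hab
      linarith
    · have := Real.rpow_lt_rpow hb.1 h hm
      exact mul_pos (by linarith) (by linarith)
  rcases C.eq_empty_or_nonempty with hemp | hne
  · refine ⟨1, one_pos, fun a ha b hb hab => ?_⟩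
    have : (a, b) ∈ C := ⟨⟨ha, hb⟩, hab⟩
    rw [hemp] at this
    exact this.elim
  · obtain ⟨x, hx, hmin⟩ := hCc.exists_isMinOn hne hcont
    exact ⟨_, hpos x hx, fun a ha b hb hab => hmin (⟨⟨ha, hb⟩, hab⟩ : (a, b) ∈ C)⟩

theorem tendsto_comp_sub_comp_of_bounded {φ a b : ℝ → ℝ} {l : Filter ℝ} {A : ℝ} (hφ : Continuous φ)
    (ha : ∀ᶠ t in l, a t ∈ Icc 0 A) (hb : ∀ᶠ t in l, b t ∈ Icc 0 A)
    (hab : Tendsto (fun t => a t - b t) l (𝓝 0)) :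
    Tendsto (fun t => φ (a t) - φ (b t)) l (𝓝 0) := by
  have hu := isCompact_Icc.uniformContinuousOn_of_continuous (hφ.continuousOn (s := Icc 0 A))
  rw [Metric.uniformContinuousOn_iff] at hu
  rw [Metric.tendsto_nhds] at hab ⊢
  intro ε hε
  obtain ⟨δ, hδ, hu⟩ := hu ε hε
  filter_upwards [ha, hb, hab δ hδ] with t h1 h2 h3
  rw [Real.dist_eq, sub_zero] at h3 ⊢
  exact hu _ h1 _ h2 h3

theorem frequently_eq_of_frequently_lt {y : ℝ → ℝ} {T a b ξ : ℝ} (hy : ContinuousOn y (Ioi T))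
    (ha : ∃ᶠ t in atTop, y t < a) (hb : ∃ᶠ t in atTop, b < y t) (hξ : ξ ∈ Icc a b) :
    ∃ᶠ t in atTop, y t = ξ := by
  rw [frequently_atTop] at ha hb ⊢
  intro S
  obtain ⟨t₁, ht₁, h₁⟩ := ha (max S (T + 1))
  obtain ⟨t₂, ht₂, h₂⟩ := hb t₁
  have hsub : Icc t₁ t₂ ⊆ Ioi T := fun t ht =>
    lt_of_lt_of_le (by linarith : T < T + 1) ((le_max_right _ _).trans (ht₁.trans ht.1))
  obtain ⟨t, ht, hyt⟩ := intermediate_value_Icc ht₂ (hy.mono hsub)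
    (⟨h₁.le.trans hξ.1, hξ.2.trans h₂.le⟩ : ξ ∈ Icc (y t₁) (y t₂))
  exact ⟨t, (le_max_left _ _).trans (ht₁.trans ht.1), hyt⟩

namespace EmdenFowler

variable {m β θ q T : ℝ} {F w : ℝ → ℝ}

/-- In the supercritical, Sobolev-subcritical range `u` is bounded or `u ~ λ |x|^{-γ}`. -/
theorem bounded_or_tendsto_of_supercritical (h : EmdenFowler m β θ q T F w)
    (hw0 : Tendsto w atTop (𝓝 0)) (hq : θ < q * β) {γ : ℝ} (hγ : γ = (θ - β * m) / (q - m))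
    (hS : m * (β - γ) < γ) :
    (∃ B, ∀ᶠ t in atTop, F t ≤ B) ∨
      Tendsto (fun t => F t * Real.exp (-(γ * t))) atTop
        (𝓝 ((γ ^ m * (m * (β - γ))) ^ (1 / (q - m)))) := by
  have hβ := h.β_pos
  have hm := h.m_pos
  have hθ := h.θ_pos
  have hq0 := h.q_pos
  have hqm : 0 < q - m := sub_pos.2 h.lt_q
  have hγ0 : 0 < γ := by rw [hγ]; exact div_pos (sub_pos.2 h.lt_θ) hqm
  have hγβ : γ < β := by rw [hγ, div_lt_iff₀ hqm]; linarith
  have hγq : γ * (q - m) = θ - β * m := by rw [hγ]; field_simp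
  -- In the rescaled variables the system is autonomous: `y' = z - γ y` and `(z^m)' = k z^m - y^q`.
  -- Its positive equilibrium is `z = γ y`, `y^{q-m} = k γ^m`.
  set k := m * (β - γ) with hk
  have hk0 : 0 < k := mul_pos hm (sub_pos.2 hγβ)
  set y : ℝ → ℝ := fun t => F t * Real.exp (-(γ * t)) with hy
  set z : ℝ → ℝ := fun t => w t ^ (1 / m) * Real.exp ((β - γ) * t) with hz
  set Y := efFluxSlope θ q F w with hY
  have hy0 : ∀ t, T < t → 0 < y t := fun t ht => mul_pos (h.F_pos t ht) (Real.exp_pos _)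
  have hz0 : ∀ t, T < t → 0 < z t := fun t ht =>
    mul_pos (Real.rpow_pos_of_pos (h.w_pos t ht) _) (Real.exp_pos _)
  have hyd : ∀ t, T < t → HasDerivAt y (z t - γ * y t) t := by
    intro t ht
    refine ((h.F_deriv t ht).mul ((hasDerivAt_id t).const_mul γ).neg.exp).congr_deriv ?_
    simp only [hz, hy, id, Pi.neg_apply]
    rw [show (β - γ) * t = β * t + -(γ * t) by ring, Real.exp_add]
    ring
  have hzd : ∀ t, T < t → HasDerivAt z (z t * (k - Y t) / m) t := by
    intro t ht
    have hw := h.w_pos t ht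
    refine (((h.w_deriv t ht).rpow_const (p := 1 / m) (Or.inl hw.ne')).mul
      ((hasDerivAt_id t).const_mul (β - γ)).exp).congr_deriv ?_
    simp only [hz, hY, efFluxSlope, id, hk, Real.rpow_sub_one hw.ne']
    field_simp
    ring
  have hYz : ∀ t, T < t → Y t * z t ^ m = y t ^ q := by
    intro t ht
    have hw := h.w_pos t ht
    have hF := h.F_pos t ht
    simp only [hz, hY, hy, efFluxSlope]
    rw [Real.mul_rpow (by positivity) (by positivity), h.w_root_pow ht,
      Real.mul_rpow hF.le (by positivity), ← Real.exp_mul, ← Real.exp_mul,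
      show -(γ * t) * q = -(θ * t) + (β - γ) * t * m by
        have : γ * q = θ - β * m + γ * m := by linarith
        linear_combination (-t) * this, Real.exp_add]
    field_simp
  have hyP : ∀ t, T < t → y t ^ (q - m) = efPower m β θ q F t := by
    intro t ht
    simp only [hy, efPower]
    rw [Real.mul_rpow (h.F_pos t ht).le (by positivity), ← Real.exp_mul, ← hγq]
    ring_nf
  have hzX : ∀ t, T < t → z t = efSlope m β F w t * y t := by
    intro t ht
    have hF := h.F_pos t ht
    simp only [hz, hy, efSlope]
    rw [show (β - γ) * t = β * t + -(γ * t) by ring, Real.exp_add]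
    field_simp
  -- From `y^{q-m} = P = X^m Y` with the a priori bounds `X < 2β` and `Y ≤ θ`.
  set M := ((2 * β) ^ m * θ) ^ (1 / (q - m)) with hM
  have hM0 : 0 < M := by positivity
  have hev : ∀ᶠ t in atTop, y t ≤ M ∧ z t ≤ 2 * β * M := by
    filter_upwards [eventually_gt_atTop T, h.eventually_slope_lt (by linarith : β < 2 * β)]
      with t ht hX
    have h1 : y t ^ (q - m) ≤ (2 * β) ^ m * θ := by
      rw [hyP t ht, ← h.slope_pow_mul_fluxSlope ht]
      exact mul_le_mul (Real.rpow_le_rpow (h.slope_pos ht).le hX.le hm.le) (h.fluxSlope_le ht)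
        (h.fluxSlope_pos ht).le (by positivity)
    have h2 : y t ≤ M := by
      have := Real.rpow_le_rpow (by have := hy0 t ht; positivity) h1
        (by positivity : 0 ≤ 1 / (q - m))
      rwa [← Real.rpow_mul (hy0 t ht).le, mul_one_div_cancel hqm.ne', Real.rpow_one] at this
    refine ⟨h2, ?_⟩
    rw [hzX t ht]
    exact mul_le_mul hX.le h2 (hy0 t ht).le (by positivity)
  obtain ⟨S, hTS, hbd⟩ := eventually_atTop_gt hev T
  have hT : ∀ t, S < t → T < t := fun t ht => hTS.trans_lt ht
  -- The last term is chosen so that the derivative factors as `-(γ - k) (z^m - (γy)^m) (z - γy)`.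
  -- It is nonpositive because `k < γ`, the Sobolev-subcritical condition, and because powers are
  -- increasing.
  set V : ℝ → ℝ := fun t => y t ^ (q + 1) / (q + 1) + m / (m + 1) * z t ^ (m + 1)
    - γ * (y t * z t ^ m) + (γ - k) * γ ^ m / (m + 1) * y t ^ (m + 1) with hV
  have hVd : ∀ t, T < t →
      HasDerivAt V (-((γ - k) * ((z t ^ m - (γ * y t) ^ m) * (z t - γ * y t)))) t := by
    intro t ht
    have hy' := hy0 t ht
    have hz' := hz0 t ht
    have hd1 := ((hyd t ht).rpow_const (p := q + 1) (Or.inl hy'.ne')).div_const (q + 1)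
    have hd2 := ((hzd t ht).rpow_const (p := m + 1) (Or.inl hz'.ne')).const_mul (m / (m + 1))
    have hd3 := ((hyd t ht).mul ((hzd t ht).rpow_const (p := m) (Or.inl hz'.ne'))).const_mul γ
    have hd4 := ((hyd t ht).rpow_const (p := m + 1) (Or.inl hy'.ne')).const_mul
      ((γ - k) * γ ^ m / (m + 1))
    refine (((hd1.add hd2).sub hd3).add hd4).congr_deriv ?_
    have hYz' := hYz t ht
    rw [add_sub_cancel_right, add_sub_cancel_right, Real.rpow_sub_one hz'.ne',
      Real.mul_rpow hγ0.le hy'.le, ← hYz']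
    field_simp
    ring
  have hVanti : AntitoneOn V (Ioi S) := by
    refine antitoneOn_Ioi_of_hasDerivAt_nonpos (fun t ht => hVd t (hT t ht)) fun t ht => ?_
    have hy' := hy0 t (hT t ht)
    have hz' := hz0 t (hT t ht)
    rw [neg_nonpos]
    refine mul_nonneg (by linarith) ?_
    rcases le_total (γ * y t) (z t) with hle | hle
    · exact mul_nonneg (sub_nonneg.2 (Real.rpow_le_rpow (by positivity) hle hm.le))
        (sub_nonneg.2 hle)
    · exact mul_nonneg_of_nonpos_of_nonpos
        (sub_nonpos.2 (Real.rpow_le_rpow hz'.le hle hm.le)) (sub_nonpos.2 hle)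
  have hVlow : ∀ t, S < t → -(γ * (M * (2 * β * M) ^ m)) ≤ V t := by
    intro t ht
    have hy' := hy0 t (hT t ht)
    have hz' := hz0 t (hT t ht)
    have hγk : 0 < γ - k := by linarith
    have h1 : y t * z t ^ m ≤ M * (2 * β * M) ^ m :=
      mul_le_mul (hbd t ht).1 (Real.rpow_le_rpow hz'.le (hbd t ht).2 hm.le) (by positivity)
        hM0.le
    have h2 := mul_le_mul_of_nonneg_left h1 hγ0.le
    have h3 : 0 ≤ y t ^ (q + 1) / (q + 1) := by positivity
    have h4 : 0 ≤ m / (m + 1) * z t ^ (m + 1) := by positivity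
    have h5 : 0 ≤ (γ - k) * γ ^ m / (m + 1) * y t ^ (m + 1) := by positivity
    simp only [hV]
    linarith
  obtain ⟨v, -, -, hv⟩ := exists_tendsto_of_antitoneOn_Ioi hVanti hVlow
  set A := max (2 * β * M) (γ * M) with hA
  have hzA : ∀ᶠ t in atTop, z t ∈ Icc 0 A := by
    filter_upwards [eventually_gt_atTop S] with t ht
    exact ⟨(hz0 t (hT t ht)).le, (hbd t ht).2.trans (le_max_left _ _)⟩
  have hyA : ∀ᶠ t in atTop, γ * y t ∈ Icc 0 A := by
    filter_upwards [eventually_gt_atTop S] with t ht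
    exact ⟨mul_nonneg hγ0.le (hy0 t (hT t ht)).le,
      (mul_le_mul_of_nonneg_left (hbd t ht).1 hγ0.le).trans (le_max_right _ _)⟩
  have hd0 : Tendsto (fun t => z t - γ * y t) atTop (𝓝 0) := by
    refine tendsto_zero_of_dissipation (K := 2 * β * M * (k + θ) / m + γ * (2 * β * M + γ * M))
      ((eventually_gt_atTop T).mono fun t ht => hVd t ht) hv
      ((eventually_gt_atTop T).mono fun t ht => (hzd t ht).sub ((hyd t ht).const_mul γ)) ?_ ?_
    · filter_upwards [eventually_gt_atTop S] with t ht
      have hy' := hy0 t (hT t ht)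
      have hz' := hz0 t (hT t ht)
      obtain ⟨h1, h2⟩ := hbd t ht
      have hY1 := h.fluxSlope_le (hT t ht)
      have hY0 := h.fluxSlope_pos (hT t ht)
      refine (abs_sub _ _).trans (add_le_add ?_ ?_)
      · rw [abs_div, abs_mul, abs_of_pos hz', abs_of_pos hm]
        gcongr
        rw [abs_le]
        constructor <;> linarith
      · rw [abs_mul, abs_of_pos hγ0]
        gcongr
        refine (abs_sub _ _).trans ?_
        rw [abs_of_pos hz', abs_of_pos (by positivity)]
        gcongr
    · intro ε hε
      obtain ⟨η, hη, hη'⟩ := exists_pos_le_rpow_sub_mul_sub hm A hε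
      refine ⟨(γ - k) * η, mul_pos (by linarith) hη, ?_⟩
      filter_upwards [hzA, hyA] with t h1 h2 h3
      have := mul_le_mul_of_nonneg_left (hη' _ h1 _ h2 h3) (by linarith : 0 ≤ γ - k)
      linarith
  -- This is `V` on the curve `z = γ y`, to which the trajectory is attracted.
  set Φ : ℝ → ℝ := fun x => x ^ (q + 1) / (q + 1) - k * γ ^ m / (m + 1) * x ^ (m + 1) with hΦ
  have hΦv : Tendsto (fun t => Φ (y t)) atTop (𝓝 v) := by
    have h1 : Tendsto (fun t => z t ^ (m + 1) - (γ * y t) ^ (m + 1)) atTop (𝓝 0) :=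
      tendsto_comp_sub_comp_of_bounded (φ := fun x => x ^ (m + 1))
        (Real.continuous_rpow_const (by positivity)) hzA hyA hd0
    have h2 : Tendsto (fun t => (z t - γ * y t) * z t ^ m) atTop (𝓝 0) := by
      refine squeeze_zero_norm' (a := fun t => ‖z t - γ * y t‖ * A ^ m) ?_ ?_
      · filter_upwards [hzA] with t ht
        rw [norm_mul, Real.norm_of_nonneg (Real.rpow_nonneg ht.1 m)]
        exact mul_le_mul_of_nonneg_left (Real.rpow_le_rpow ht.1 ht.2 hm.le) (norm_nonneg _)
      · simpa using hd0.norm.mul_const (A ^ m)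
    have h3 : Tendsto (fun t => V t + (z t ^ (m + 1) - (γ * y t) ^ (m + 1)) / (m + 1)
        - (z t - γ * y t) * z t ^ m) atTop (𝓝 (v + 0 / (m + 1) - 0)) :=
      (hv.add (h1.div_const (m + 1))).sub h2
    rw [zero_div, add_zero, sub_zero] at h3
    refine h3.congr' ?_
    filter_upwards [eventually_gt_atTop T] with t ht
    have hy' := hy0 t ht
    have hz' := hz0 t ht
    simp only [hV, hΦ]
    rw [Real.mul_rpow hγ0.le hy'.le, Real.rpow_add_one hz'.ne', Real.rpow_add_one hγ0.ne']
    field_simp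
    ring
  have hycont : ContinuousOn y (Ioi T) := fun t ht => (hyd t ht).continuousAt.continuousWithinAt
  have hyconv : ∃ l, Tendsto y atTop (𝓝 l) := by
    -- If `y` oscillated across `[a, b]`, it would take each value there infinitely often, so `Φ =
    -- v` on `[a, b]`. But a positive critical point of `Φ` satisfies `ξ^{q-m} = k γ^m`, which has a
    -- single solution.
    refine tendsto_of_no_upcrossings dense_univ ?_ ?_ ?_
    · rintro a - b - hab ⟨hfa, hfb⟩
      have ha0 : 0 < a := by
        obtain ⟨t, h1, h2⟩ := (hfa.and_eventually (eventually_gt_atTop T)).exists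
        exact (hy0 t h2).trans h1
      have hconst : ∀ ξ ∈ Icc a b, Φ ξ = v := by
        intro ξ hξ
        by_contra hne
        obtain ⟨t, h1, h2⟩ := ((frequently_eq_of_frequently_lt hycont hfa hfb hξ).and_eventually
          (hΦv.eventually_ne (Ne.symm hne))).exists
        exact h2 (by rw [h1])
      have hcrit : ∀ ξ ∈ Ioo a b, ξ ^ (q - m) = k * γ ^ m := by
        intro ξ hξ
        have hξ0 : 0 < ξ := ha0.trans hξ.1
        have h1 : HasDerivAt Φ (1 * (q + 1) * ξ ^ (q + 1 - 1) / (q + 1) -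
            k * γ ^ m / (m + 1) * (1 * (m + 1) * ξ ^ (m + 1 - 1))) ξ :=
          (((hasDerivAt_id ξ).rpow_const (Or.inl hξ0.ne')).div_const _).sub
            (((hasDerivAt_id ξ).rpow_const (Or.inl hξ0.ne')).const_mul _)
        have h2 : HasDerivAt Φ 0 ξ := by
          refine (hasDerivAt_const ξ v).congr_of_eventuallyEq ?_
          filter_upwards [Icc_mem_nhds hξ.1 hξ.2] with x hx using hconst x hx
        have h3 := h1.unique h2
        rw [add_sub_cancel_right, add_sub_cancel_right] at h3
        rw [Real.rpow_sub hξ0]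
        field_simp at h3 ⊢
        linarith
      obtain ⟨ξ₁, h1, h2⟩ := exists_between hab
      obtain ⟨ξ₂, h3, h4⟩ := exists_between h2
      have := Real.rpow_lt_rpow (ha0.trans h1).le h3 hqm
      rw [hcrit ξ₁ ⟨h1, h2⟩, hcrit ξ₂ ⟨h1.trans h3, h4⟩] at this
      exact lt_irrefl _ this
    · refine isBoundedUnder_of_eventually_le (a := M) ?_
      filter_upwards [eventually_gt_atTop S] with t ht using (hbd t ht).1
    · refine isBoundedUnder_of_eventually_ge (a := 0) ?_
      filter_upwards [eventually_gt_atTop T] with t ht using (hy0 t ht).le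
  obtain ⟨l, hl⟩ := hyconv
  have hl0 : 0 ≤ l := ge_of_tendsto hl
    ((eventually_gt_atTop T).mono fun t ht => (hy0 t ht).le)
  have hzl : Tendsto z atTop (𝓝 (γ * l)) := by
    have := hd0.add (hl.const_mul γ)
    rw [zero_add] at this
    exact this.congr fun t => by ring
  -- Both `z^m` and its derivative converge, so the limit of the derivative is zero: the limit point
  -- is an equilibrium.
  have hzero : k * (γ * l) ^ m - l ^ q = 0 := by
    refine eq_zero_of_tendsto_of_tendsto_deriv (f := fun t => z t ^ m)
      (f' := fun t => k * z t ^ m - y t ^ q) ?_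
      (((hzl.rpow_const (Or.inr hm.le)).const_mul k).sub (hl.rpow_const (Or.inr hq0.le)))
      (hzl.rpow_const (Or.inr hm.le))
    filter_upwards [eventually_gt_atTop T] with t ht
    have hz' := hz0 t ht
    refine ((hzd t ht).rpow_const (p := m) (Or.inl hz'.ne')).congr_deriv ?_
    rw [← hYz t ht, Real.rpow_sub_one hz'.ne']
    field_simp
  rcases hl0.eq_or_lt with hl0 | hl0
  · left
    refine h.bounded_of_supercritical hw0 ?_ hq
    have := hl.rpow_const (p := q - m) (Or.inr hqm.le)
    rw [← hl0, Real.zero_rpow hqm.ne'] at this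
    refine this.congr' ?_
    filter_upwards [eventually_gt_atTop T] with t ht using hyP t ht
  · right
    have h1 : l ^ (q - m) = γ ^ m * k := by
      rw [Real.mul_rpow hγ0.le hl0.le] at hzero
      rw [Real.rpow_sub hl0]
      have : 0 < l ^ m := by positivity
      field_simp
      linarith
    rw [← h1, ← Real.rpow_mul hl0.le, mul_one_div_cancel hqm.ne', Real.rpow_one]
    exact hl

end EmdenFowler

/-! ### The du Bois-Reymond lemma -/

theorem IsCompact.exists_subset_Ioo {K : Set ℝ} {a b : ℝ} (hK : IsCompact K) (hKab : K ⊆ Ioo a b)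
    (hab : a < b) : ∃ c d, a < c ∧ c < d ∧ d < b ∧ K ⊆ Ioo c d := by
  rcases K.eq_empty_or_nonempty with rfl | hne
  · obtain ⟨c, h1, h2⟩ := exists_between hab
    obtain ⟨d, h3, h4⟩ := exists_between h2
    exact ⟨c, d, h1, h3, h4, empty_subset _⟩
  · obtain ⟨x, hx, hxle⟩ := hK.exists_isLeast hne
    obtain ⟨y, hy, hyge⟩ := hK.exists_isGreatest hne
    obtain ⟨c, h1, h2⟩ := exists_between (hKab hx).1
    obtain ⟨d, h3, h4⟩ := exists_between (hKab hy).2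
    refine ⟨c, d, h1, h2.trans_le ((hxle hy).trans h3.le), h4, fun z hz => ?_⟩
    exact ⟨h2.trans_le (hxle hz), (hyge hz).trans_lt h3⟩

theorem exists_contDiff_primitive {η : ℝ → ℝ} {a b : ℝ} (hab : a < b) (hη : ContDiff ℝ ∞ η)
    (hηc : HasCompactSupport η) (hηs : tsupport η ⊆ Ioo a b) (h0 : ∫ r in a..b, η r = 0) :
    ∃ A : ℝ → ℝ, ContDiff ℝ ∞ A ∧ HasCompactSupport A ∧ tsupport A ⊆ Ioo a b ∧ deriv A = η := by
  obtain ⟨c, d, hac, hcd, hdb, hsub⟩ := IsCompact.exists_subset_Ioo hηc hηs hab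
  have hcont := hη.continuous
  have hder : ∀ r, HasDerivAt (fun r => ∫ s in a..r, η s) (η r) r := fun r =>
    intervalIntegral.integral_hasDerivAt_right (hcont.intervalIntegrable _ _)
      (hcont.stronglyMeasurableAtFilter _ _) hcont.continuousAt
  have hderiv : deriv (fun r => ∫ s in a..r, η s) = η := funext fun r => (hder r).deriv
  have hz : ∀ r, r ∉ Ioo c d → η r = 0 := fun r hr =>
    image_eq_zero_of_notMem_tsupport fun h => hr (hsub h)
  have hsupp : Function.support (fun r => ∫ s in a..r, η s) ⊆ Icc c d := by
    intro r hr
    by_contra hcon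
    refine hr ?_
    rw [mem_Icc, not_and_or, not_le, not_le] at hcon
    rcases hcon with hlt | hgt
    · refine (intervalIntegral.integral_congr (g := fun _ => 0) fun s hs => hz s fun h => ?_).trans
        (by simp)
      have := hs.2.trans (max_le hac.le hlt.le)
      linarith [h.1]
    · have h1 : ∫ s in r..b, η s = 0 := by
        refine (intervalIntegral.integral_congr (g := fun _ => 0) fun s hs => hz s fun h => ?_).trans
          (by simp)
        have := (le_min hgt.le hdb.le).trans hs.1
        linarith [h.2]
      have h2 := intervalIntegral.integral_add_adjacent_intervals
        (hcont.intervalIntegrable (μ := volume) a r) (hcont.intervalIntegrable (μ := volume) r b)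
      simp only
      linarith
  have htsupp : tsupport (fun r => ∫ s in a..r, η s) ⊆ Icc c d :=
    closure_minimal hsupp isClosed_Icc
  refine ⟨_, contDiff_infty_iff_deriv.2 ⟨fun r => (hder r).differentiableAt, by rwa [hderiv]⟩,
    HasCompactSupport.of_support_subset_isCompact isCompact_Icc hsupp, ?_, hderiv⟩
  exact htsupp.trans fun x hx => ⟨hac.trans_le hx.1, hx.2.trans_lt hdb⟩

/-- The boundary condition is imposed on the product so as to cover two uses: a test function
vanishing at `b`, and an `H` of mean zero against an `A` that does not vanish there. -/
theorem integral_primitive_mul_deriv {H A : ℝ → ℝ} {a b : ℝ}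
    (hH : IntervalIntegrable H volume a b) (hA : AbsolutelyContinuousOnInterval A a b)
    (hAb : (∫ s in a..b, H s) * A b = 0) :
    ∫ r in a..b, (∫ s in a..r, H s) * deriv A r = -∫ r in a..b, H r * A r := by
  have hK := hH.absolutelyContinuousOnInterval_intervalIntegral (c := a) left_mem_uIcc
  rw [hK.integral_mul_deriv_eq_deriv_mul hA, hAb]
  simp only [intervalIntegral.integral_same, zero_mul, sub_self, zero_sub]
  congr 1
  refine intervalIntegral.integral_congr_ae ?_
  filter_upwards [hH.ae_hasDerivAt_integral] with r hr hr'
  rw [(hr (uIoc_subset_uIcc hr') a left_mem_uIcc).deriv]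

/-- **du Bois-Reymond lemma**: a function with an integrable weak derivative on an interval is
almost everywhere a constant plus a primitive of this derivative. -/
theorem ae_eq_const_add_integral {Ψ H : ℝ → ℝ} {a b : ℝ} (hab : a < b)
    (hΨ : IntervalIntegrable Ψ volume a b) (hH : IntervalIntegrable H volume a b)
    (h : ∀ A : ℝ → ℝ, ContDiff ℝ ∞ A → HasCompactSupport A → tsupport A ⊆ Ioo a b →
      ∫ r in a..b, Ψ r * deriv A r = -∫ r in a..b, H r * A r) :
    ∃ k, ∀ᵐ r, r ∈ Ioo a b → Ψ r = k + ∫ s in a..r, H s := by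
  have hK := hH.absolutelyContinuousOnInterval_intervalIntegral (c := a) left_mem_uIcc
  have hKc := hK.continuousOn
  set K : ℝ → ℝ := fun r => ∫ s in a..r, H s with hKdef
  have hKi : IntervalIntegrable K volume a b := hKc.intervalIntegrable
  have hD : IntervalIntegrable (fun r => Ψ r - K r) volume a b := hΨ.sub hKi
  have key : ∀ A : ℝ → ℝ, ContDiff ℝ ∞ A → HasCompactSupport A → tsupport A ⊆ Ioo a b →
      ∫ r in a..b, (Ψ r - K r) * deriv A r = 0 := by
    intro A hA hAc hAs
    have hA1 : ContDiff ℝ 1 A := hA.of_le (by exact_mod_cast le_top)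
    have hAb : (∫ s in a..b, H s) * A b = 0 := by
      rw [image_eq_zero_of_notMem_tsupport fun h => (hAs h).2.false, mul_zero]
    have h1 := integral_primitive_mul_deriv hH
      (hA1.contDiffOn.absolutelyContinuousOnInterval) hAb
    have hdc : Continuous (deriv A) := hA1.continuous_deriv le_rfl
    simp only [sub_mul]
    rw [intervalIntegral.integral_sub (hΨ.mul_continuousOn hdc.continuousOn)
      (hKi.mul_continuousOn hdc.continuousOn), h A hA hAc hAs, h1, sub_self]
  obtain ⟨c, hac, hcb⟩ := exists_between hab
  -- A fixed bump of positive integral. Subtracting a multiple of it from a test function leaves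
  -- mean zero, that is, the derivative of a test function.
  obtain ⟨f₀, hf₀s, hf₀c, hf₀d, hf₀r, hf₀1⟩ :=
    exists_contDiff_tsupport_subset (n := ⊤) (Ioo_mem_nhds hac hcb)
  have hf₀0 : 0 < ∫ r in a..b, f₀ r := by
    have hnn : ∀ r, 0 ≤ f₀ r := fun r => (hf₀r (mem_range_self r)).1
    refine intervalIntegral.integral_pos hab hf₀d.continuous.continuousOn
      (fun r _ => hnn r) ⟨c, ⟨hac.le, hcb.le⟩, by rw [hf₀1]; exact one_pos⟩
  set I₀ := ∫ r in a..b, f₀ r with hI₀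
  -- The constant is the average of `Ψ - K` against the normalized bump.
  set k := (∫ r in a..b, (Ψ r - K r) * f₀ r) / I₀ with hk
  refine ⟨k, ?_⟩
  have hloc : LocallyIntegrableOn (fun r => Ψ r - K r - k) (Ioo a b) := by
    refine IntegrableOn.locallyIntegrableOn ?_
    have := (hD.sub (intervalIntegrable_const (c := k))).1
    exact this.mono_set Ioo_subset_Ioc_self
  have hae := isOpen_Ioo.ae_eq_zero_of_integral_contDiff_smul_eq_zero hloc ?_
  · filter_upwards [hae] with r hr hr'
    have := hr hr'
    linarith
  intro ψ hψ hψc hψs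
  set J := ∫ r in a..b, ψ r with hJ
  have hη : ContDiff ℝ ∞ (fun r => ψ r - J / I₀ * f₀ r) := hψ.sub (contDiff_const.mul hf₀d)
  have hη2 : HasCompactSupport (fun r => ψ r - J / I₀ * f₀ r) :=
    hψc.sub (hf₀c.mul_left (f := fun _ => J / I₀))
  have hη3 : tsupport (fun r => ψ r - J / I₀ * f₀ r) ⊆ Ioo a b := by
    refine (tsupport_sub _ _).trans (union_subset hψs ?_)
    exact (tsupport_mul_subset_right (f := fun _ => J / I₀)).trans hf₀s
  obtain ⟨A, hA1, hA2, hA3, hA4⟩ := exists_contDiff_primitive hab hη hη2 hη3 (by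
    rw [intervalIntegral.integral_sub (hψ.continuous.intervalIntegrable _ _)
      ((hf₀d.continuous.intervalIntegrable _ _).const_mul _),
      intervalIntegral.integral_const_mul, ← hJ, ← hI₀]
    field_simp
    simp)
  have h1 := key A hA1 hA2 hA3
  rw [hA4] at h1
  have h2 : IntervalIntegrable (fun r => (Ψ r - K r) * ψ r) volume a b :=
    hD.mul_continuousOn hψ.continuous.continuousOn
  have h3 : IntervalIntegrable (fun r => (Ψ r - K r) * f₀ r) volume a b :=
    hD.mul_continuousOn hf₀d.continuous.continuousOn
  have h4 : ∫ r in a..b, (Ψ r - K r) * ψ r = k * J := by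
    have h5 : ∫ r in a..b, (Ψ r - K r) * (ψ r - J / I₀ * f₀ r)
        = (∫ r in a..b, (Ψ r - K r) * ψ r) - J / I₀ * ∫ r in a..b, (Ψ r - K r) * f₀ r := by
      rw [← intervalIntegral.integral_const_mul, ← intervalIntegral.integral_sub h2
        (h3.const_mul _)]
      congr 1
      ext r
      ring
    rw [h5] at h1
    rw [hk]
    field_simp
    field_simp at h1
    linarith
  have h6 : ∫ r, ψ r • (Ψ r - K r - k) = ∫ r in a..b, ((Ψ r - K r) * ψ r - k * ψ r) := by
    rw [intervalIntegral.integral_of_le hab.le, ← integral_indicator measurableSet_Ioc]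
    congr 1
    ext r
    by_cases hr : r ∈ Ioc a b
    · rw [indicator_of_mem hr, smul_eq_mul]; ring
    · rw [indicator_of_notMem hr, image_eq_zero_of_notMem_tsupport fun h =>
        hr (Ioo_subset_Ioc_self (hψs h)), zero_smul]
  rw [h6, intervalIntegral.integral_sub h2
    ((hψ.continuous.intervalIntegrable _ _).const_mul k),
    intervalIntegral.integral_const_mul, h4, ← hJ, sub_self]

/-! ### Integration over spheres -/

section RadialDensity

variable {E : Type*} [NormedAddCommGroup E] [InnerProductSpace ℝ E] [FiniteDimensional ℝ E]
  [MeasurableSpace E] [BorelSpace E]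

/-- The integral of `f` over the sphere of radius `r`. -/
noncomputable def radialDensity (f : E → ℝ) (r : ℝ) : ℝ :=
  r ^ (Module.finrank ℝ E - 1) *
    ∫ v : Metric.sphere (0 : E) 1, f (r • (v : E)) ∂(volume : Measure E).toSphere

theorem radialDensity_congr {f g : E → ℝ} {r : ℝ} (hr : 0 ≤ r) (h : ∀ x, ‖x‖ = r → f x = g x) :
    radialDensity f r = radialDensity g r := by
  unfold radialDensity
  congr 2
  ext v
  refine h _ ?_
  rw [norm_smul, norm_eq_of_mem_sphere, mul_one, Real.norm_of_nonneg hr]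

theorem radialDensity_eq_zero {f : E → ℝ} {r : ℝ} (hr : 0 ≤ r) (h : ∀ x, ‖x‖ = r → f x = 0) :
    radialDensity f r = 0 := by
  rw [radialDensity_congr (g := fun _ => 0) hr h]
  simp [radialDensity]

theorem radialDensity_norm_mul (a : ℝ → ℝ) (f : E → ℝ) {r : ℝ} (hr : 0 ≤ r) :
    radialDensity (fun x => a ‖x‖ * f x) r = a r * radialDensity f r := by
  rw [radialDensity_congr (g := fun x => a r * f x) hr (fun x hx => by rw [hx])]
  unfold radialDensity
  rw [integral_const_mul]
  ring

/-- Polar coordinates: off the origin, Lebesgue measure is the product of the sphere measure and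
`r^{d-1} dr`, and Fubini applies. -/
theorem integrableOn_radialDensity_and_integral [Nontrivial E] {f : E → ℝ} (hf : Integrable f) :
    IntegrableOn (radialDensity f) (Ioi 0) ∧ ∫ x, f x = ∫ r in Ioi 0, radialDensity f r := by
  set d := Module.finrank ℝ E with hd
  have hmp := (volume : Measure E).measurePreserving_homeomorphUnitSphereProd.symm
    (homeomorphUnitSphereProd E).toMeasurableEquiv
  have hemb : MeasurableEmbedding (homeomorphUnitSphereProd E).toMeasurableEquiv.symm :=
    MeasurableEquiv.measurableEmbedding _
  have hsub : Integrable (fun x : ({0}ᶜ : Set E) => f x.1) (volume.comap Subtype.val) := by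
    have h1 : IntegrableOn f ({0}ᶜ : Set E) := hf.integrableOn
    rwa [integrableOn_iff_comap_subtypeVal (measurableSet_singleton _).compl] at h1
  have hprod : Integrable (fun z : Metric.sphere (0 : E) 1 × Ioi (0 : ℝ) => f (z.2.1 • z.1.1))
      ((volume : Measure E).toSphere.prod (Measure.volumeIoiPow (d - 1))) := by
    have := (hmp.integrable_comp_emb hemb).2 hsub
    exact this
  have hint : ∫ x, f x = ∫ z : Metric.sphere (0 : E) 1 × Ioi (0 : ℝ), f (z.2.1 • z.1.1)
      ∂((volume : Measure E).toSphere.prod (Measure.volumeIoiPow (d - 1))) := by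
    have h1 := hmp.integral_comp hemb (fun x : ({0}ᶜ : Set E) => f x.1)
    rw [integral_subtype_comap (measurableSet_singleton _).compl fun x => f x,
      restrict_compl_singleton] at h1
    exact h1.symm
  have hr : Integrable (fun r : Ioi (0 : ℝ) => ∫ v : Metric.sphere (0 : E) 1, f (r.1 • v.1)
      ∂(volume : Measure E).toSphere) (Measure.volumeIoiPow (d - 1)) := hprod.integral_prod_right
  have hfun : ∀ r : Ioi (0 : ℝ), (Real.toNNReal (r.1 ^ (d - 1))) •
      (∫ v : Metric.sphere (0 : E) 1, f (r.1 • v.1) ∂(volume : Measure E).toSphere)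
      = radialDensity f r.1 := by
    intro r
    rw [NNReal.smul_def, Real.coe_toNNReal _ (pow_nonneg r.2.out.le _), smul_eq_mul]
    rfl
  have hmeas : Measurable fun r : Ioi (0 : ℝ) => Real.toNNReal (r.1 ^ (d - 1)) :=
    (measurable_subtype_coe.pow_const _).real_toNNReal
  constructor
  · rw [integrableOn_iff_comap_subtypeVal measurableSet_Ioi]
    rw [Measure.volumeIoiPow] at hr
    have := (integrable_withDensity_iff_integrable_smul hmeas).1 hr
    exact this.congr (Eventually.of_forall hfun)
  · rw [hint, integral_prod_symm _ hprod, Measure.volumeIoiPow]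
    have h1 := integral_withDensity_eq_integral_smul (μ := Measure.comap Subtype.val volume) hmeas
      (fun r : Ioi (0 : ℝ) => ∫ v : Metric.sphere (0 : E) 1, f (r.1 • v.1)
        ∂(volume : Measure E).toSphere)
    refine h1.trans ?_
    rw [← integral_subtype_comap measurableSet_Ioi (radialDensity f)]
    exact integral_congr_ae (Eventually.of_forall hfun)

theorem integrableOn_radialDensity [Nontrivial E] {f : E → ℝ} (hf : Integrable f) :
    IntegrableOn (radialDensity f) (Ioi 0) :=
  (integrableOn_radialDensity_and_integral hf).1

theorem integral_eq_integral_radialDensity [Nontrivial E] {f : E → ℝ} (hf : Integrable f) :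
    ∫ x, f x = ∫ r in Ioi 0, radialDensity f r :=
  (integrableOn_radialDensity_and_integral hf).2

end RadialDensity

/-! ### Functions of the norm, angular functions and truncated cones -/

section Calculus

variable {E : Type*} [NormedAddCommGroup E] [InnerProductSpace ℝ E]

theorem hasFDerivAt_norm_of_ne_zero {x : E} (hx : x ≠ 0) :
    HasFDerivAt (fun y : E => ‖y‖) (‖x‖⁻¹ • innerSL ℝ x) x := by
  have hx' : 0 < ‖x‖ := norm_pos_iff.2 hx
  have h1 : HasFDerivAt (fun y : E => ‖y‖ ^ 2) (2 • innerSL ℝ x) x :=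
    (hasStrictFDerivAt_norm_sq x).hasFDerivAt
  have h2 := h1.sqrt (by positivity)
  simp only [Real.sqrt_sq (norm_nonneg _)] at h2
  refine h2.congr_fderiv ?_
  ext y
  simp
  field_simp

theorem hasFDerivAt_comp_norm {h : ℝ → ℝ} {h' : ℝ} {x : E} (hx : x ≠ 0)
    (hh : HasDerivAt h h' ‖x‖) :
    HasFDerivAt (fun y : E => h ‖y‖) ((h' / ‖x‖) • innerSL ℝ x) x := by
  refine (hh.comp_hasFDerivAt x (hasFDerivAt_norm_of_ne_zero hx)).congr_fderiv ?_
  rw [smul_smul, div_eq_mul_inv]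

/-- The extension of `B`, given on the unit sphere, to a function homogeneous of degree `0`. -/
noncomputable def angular (B : E → ℝ) (x : E) : ℝ := B (‖x‖⁻¹ • x)

theorem angular_smul (B : E → ℝ) {t : ℝ} (ht : 0 < t) (x : E) :
    angular B (t • x) = angular B x := by
  unfold angular
  rw [norm_smul, Real.norm_of_nonneg ht.le, smul_smul, mul_inv, mul_comm t⁻¹, mul_assoc,
    inv_mul_cancel₀ ht.ne', mul_one]

theorem contDiffAt_angular {B : E → ℝ} (hB : ContDiff ℝ ∞ B) {x : E} (hx : x ≠ 0) :
    ContDiffAt ℝ ∞ (angular B) x :=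
  hB.contDiffAt.comp x
    (((contDiffAt_norm ℝ hx).inv (norm_ne_zero_iff.2 hx)).smul contDiffAt_id)

theorem continuousOn_angular {B : E → ℝ} (hB : ContDiff ℝ ∞ B) :
    ContinuousOn (angular B) {0}ᶜ :=
  fun _ hx => (contDiffAt_angular hB hx).continuousAt.continuousWithinAt

/-- Euler's identity in degree `0`: the function is constant along the ray through `x`. Thus angular
factors do not contribute to radial derivatives. -/
theorem fderiv_angular_self {B : E → ℝ} (hB : ContDiff ℝ ∞ B) {x : E} (hx : x ≠ 0) :
    fderiv ℝ (angular B) x x = 0 := by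
  have h1 : HasFDerivAt (angular B) (fderiv ℝ (angular B) x) ((1 : ℝ) • x) := by
    rw [one_smul]
    exact ((contDiffAt_angular hB hx).differentiableAt (by simp)).hasFDerivAt
  have h2 : HasDerivAt (fun t : ℝ => t • x) ((1 : ℝ) • x) 1 := (hasDerivAt_id (1 : ℝ)).smul_const x
  have h3 := h1.comp_hasDerivAt (1 : ℝ) h2
  have h4 : HasDerivAt (angular B ∘ fun t : ℝ => t • x) 0 1 := by
    refine (hasDerivAt_const (1 : ℝ) (angular B x)).congr_of_eventuallyEq ?_
    filter_upwards [lt_mem_nhds (zero_lt_one (α := ℝ))] with t ht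
    exact angular_smul B ht x
  rw [one_smul] at h3
  exact h3.unique h4

theorem hasFDerivAt_norm_mul_angular {A : ℝ → ℝ} {A' : ℝ} {B : E → ℝ} (hB : ContDiff ℝ ∞ B)
    {x : E} (hx : x ≠ 0) (hA : HasDerivAt A A' ‖x‖) :
    HasFDerivAt (fun y => A ‖y‖ * angular B y)
      (A ‖x‖ • fderiv ℝ (angular B) x + angular B x • ((A' / ‖x‖) • innerSL ℝ x)) x :=
  (hasFDerivAt_comp_norm hx hA).mul
    ((contDiffAt_angular hB hx).differentiableAt (by simp)).hasFDerivAt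

/-- A cone around `v`, truncated to `a ≤ |x| ≤ b`. -/
def truncatedCone (v : E) (δ a b : ℝ) : Set E :=
  {x | a ≤ ‖x‖ ∧ ‖x‖ ≤ b ∧ ‖x - ‖x‖ • v‖ ≤ δ * ‖x‖}

theorem isCompact_truncatedCone [FiniteDimensional ℝ E] (v : E) (δ a b : ℝ) :
    IsCompact (truncatedCone v δ a b) := by
  have : ProperSpace E := FiniteDimensional.proper ℝ E
  refine Metric.isCompact_of_isClosed_isBounded ?_ ?_
  · have h3 : IsClosed {x : E | ‖x - ‖x‖ • v‖ ≤ δ * ‖x‖} :=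
      isClosed_le (by fun_prop) (by fun_prop)
    exact (isClosed_le continuous_const continuous_norm).inter
      ((isClosed_le continuous_norm continuous_const).inter h3)
  · refine (Metric.isBounded_closedBall (x := (0 : E)) (r := b)).subset fun x hx => ?_
    rw [mem_closedBall_zero_iff]
    exact hx.2.1

theorem smul_mem_truncatedCone {v : E} {δ a b r : ℝ} (hv : ‖v‖ = 1) (hδ : 0 ≤ δ) (ha : 0 ≤ a)
    (hr : r ∈ Icc a b) : r • v ∈ truncatedCone v δ a b := by
  have : ‖r • v‖ = r := by
    rw [norm_smul, hv, mul_one, Real.norm_of_nonneg (ha.trans hr.1)]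
  unfold truncatedCone
  simp only [mem_ofPred_eq, this, sub_self, norm_zero]
  exact ⟨hr.1, hr.2, mul_nonneg hδ (ha.trans hr.1)⟩

theorem angular_bump_eq_zero [HasContDiffBump E] {v : E} (B : ContDiffBump v) {a b : ℝ} {x : E}
    (hx : x ≠ 0) (ha : a ≤ ‖x‖) (hb : ‖x‖ ≤ b) (hxc : x ∉ truncatedCone v B.rOut a b) :
    angular B x = 0 := by
  refine B.zero_of_le_dist ?_
  have hx' : 0 < ‖x‖ := norm_pos_iff.2 hx
  by_contra! hlt
  refine hxc ⟨ha, hb, ?_⟩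
  have h1 : x - ‖x‖ • v = ‖x‖ • (‖x‖⁻¹ • x - v) := by
    rw [smul_sub, smul_smul, mul_inv_cancel₀ hx'.ne', one_smul]
  rw [h1, norm_smul, norm_norm, ← dist_eq_norm, mul_comm]
  exact mul_le_mul_of_nonneg_right hlt.le hx'.le

theorem exists_truncatedCone_subset {Ω : Set E} (hΩ : IsOpen Ω) {x₀ : E} (hx₀ : x₀ ∈ Ω)
    (h0 : x₀ ≠ 0) : ∃ a b δ, 0 < a ∧ a < ‖x₀‖ ∧ ‖x₀‖ < b ∧ 0 < δ ∧ δ ≤ 1 / 2 ∧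
      truncatedCone (‖x₀‖⁻¹ • x₀) δ a b ⊆ Ω := by
  obtain ⟨ε, hε, hball⟩ := Metric.isOpen_iff.1 hΩ x₀ hx₀
  have hr : 0 < ‖x₀‖ := norm_pos_iff.2 h0
  -- The radial displacement is at most `ε/4` and the angular one at most `(ε / (4‖x₀‖)) * (3‖x₀‖/2)
  -- = 3ε/8`, in total less than `ε`. The bound `δ ≤ 1/2` keeps directions in the cone at a positive
  -- inner product with the axis.
  set ρ := min (‖x₀‖ / 2) (ε / 4) with hρ
  have hρ0 : 0 < ρ := lt_min (by positivity) (by positivity)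
  have hρ1 : ρ ≤ ‖x₀‖ / 2 := min_le_left _ _
  have hρ2 : ρ ≤ ε / 4 := min_le_right _ _
  set δ := min (1 / 2) (ε / (4 * ‖x₀‖)) with hδ
  have hδ0 : 0 < δ := lt_min (by positivity) (by positivity)
  have hδ1 : δ ≤ ε / (4 * ‖x₀‖) := min_le_right _ _
  refine ⟨‖x₀‖ - ρ, ‖x₀‖ + ρ, δ, by linarith, by linarith, by linarith, hδ0, min_le_left _ _, ?_⟩
  rintro x ⟨h1, h2, h3⟩
  refine hball ?_
  rw [Metric.mem_ball, dist_eq_norm]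
  have h4 : x - x₀ = (x - ‖x‖ • (‖x₀‖⁻¹ • x₀)) + (‖x‖ - ‖x₀‖) • (‖x₀‖⁻¹ • x₀) := by
    rw [sub_smul, smul_smul ‖x₀‖, mul_inv_cancel₀ hr.ne', one_smul]
    abel
  have h5 : ‖(‖x‖ - ‖x₀‖) • (‖x₀‖⁻¹ • x₀)‖ ≤ ρ := by
    rw [norm_smul, norm_smul, norm_inv, norm_norm, inv_mul_cancel₀ hr.ne', mul_one,
      Real.norm_eq_abs, abs_le]
    constructor <;> linarith
  have h6 : δ * ‖x‖ ≤ ε / (4 * ‖x₀‖) * (‖x₀‖ + ‖x₀‖ / 2) :=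
    mul_le_mul hδ1 (by linarith) (norm_nonneg _) (by positivity)
  have h7 : ε / (4 * ‖x₀‖) * (‖x₀‖ + ‖x₀‖ / 2) = 3 / 8 * ε := by field_simp; norm_num
  calc ‖x - x₀‖ ≤ ‖x - ‖x‖ • ‖x₀‖⁻¹ • x₀‖ + ‖(‖x‖ - ‖x₀‖) • ‖x₀‖⁻¹ • x₀‖ := by
        rw [h4]; exact norm_add_le _ _
    _ < ε := by linarith

end Calculus

section Gradient

variable {E : Type*} [NormedAddCommGroup E] [InnerProductSpace ℝ E] [FiniteDimensional ℝ E]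

theorem inner_gradient_eq (φ : E → ℝ) (x e : E) : inner ℝ (gradient φ x) e = fderiv ℝ φ x e := by
  simp [gradient]

theorem inner_gradient_eq' (φ : E → ℝ) (x e : E) : inner ℝ e (gradient φ x) = fderiv ℝ φ x e := by
  rw [real_inner_comm, inner_gradient_eq]

theorem ContDiff.continuous_gradient' {φ : E → ℝ} (hφ : ContDiff ℝ ∞ φ) :
    Continuous (gradient φ) :=
  (InnerProductSpace.toDual ℝ E).symm.continuous.comp (hφ.continuous_fderiv (by simp))

theorem tsupport_gradient_subset (φ : E → ℝ) : tsupport (gradient φ) ⊆ tsupport φ := by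
  refine closure_minimal (fun x hx => support_fderiv_subset ℝ (f := φ) fun h => hx ?_)
    (isClosed_tsupport φ)
  simp [gradient, h]

theorem HasCompactSupport.gradient' {φ : E → ℝ} (hφ : HasCompactSupport φ) :
    HasCompactSupport (gradient φ) :=
  hφ.of_isClosed_subset (isClosed_tsupport _) (tsupport_gradient_subset φ)

end Gradient

/-! ### Integrals over shells and test functions -/

section Shell

variable {E : Type*} [NormedAddCommGroup E] [InnerProductSpace ℝ E] [FiniteDimensional ℝ E]
  [MeasurableSpace E] [BorelSpace E]

/-- The shell `a < |x| ≤ b`. -/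
def shell (E : Type*) [NormedAddCommGroup E] (a b : ℝ) : Set E := {x | ‖x‖ ∈ Ioc a b}

theorem measurableSet_shell {E : Type*} [NormedAddCommGroup E] [MeasurableSpace E]
    [OpensMeasurableSpace E] (a b : ℝ) : MeasurableSet (shell E a b) :=
  measurableSet_Ioc.preimage measurable_norm

theorem shell_integral [Nontrivial E] {f : E → ℝ} {a b : ℝ} (ha : 0 ≤ a) (hab : a ≤ b)
    (hf : IntegrableOn f (shell E a b)) :
    IntervalIntegrable (radialDensity f) volume a b ∧
      ∫ x in shell E a b, f x = ∫ r in a..b, radialDensity f r := by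
  have hind : (shell E a b).indicator f = fun x => (Ioc a b).indicator 1 ‖x‖ * f x := by
    ext x
    by_cases hx : ‖x‖ ∈ Ioc a b
    · rw [indicator_of_mem (s := shell E a b) hx, indicator_of_mem hx, Pi.one_apply, one_mul]
    · rw [indicator_of_notMem (s := shell E a b) hx, indicator_of_notMem hx, zero_mul]
  have hint : Integrable ((shell E a b).indicator f) :=
    (integrable_indicator_iff (measurableSet_shell a b)).2 hf
  have h0 : Ioc a b ∩ Ioi 0 = Ioc a b :=
    inter_eq_left.2 fun r hr => lt_of_le_of_lt ha hr.1
  have hrd : EqOn (radialDensity ((shell E a b).indicator f))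
      ((Ioc a b).indicator (radialDensity f)) (Ioi 0) := by
    intro r hr
    rw [hind, radialDensity_norm_mul _ _ (le_of_lt hr)]
    by_cases hx : r ∈ Ioc a b
    · rw [indicator_of_mem hx, indicator_of_mem hx, Pi.one_apply, one_mul]
    · rw [indicator_of_notMem hx, indicator_of_notMem hx, zero_mul]
  constructor
  · have h1 := (integrableOn_radialDensity hint).congr_fun hrd measurableSet_Ioi
    rw [intervalIntegrable_iff_integrableOn_Ioc_of_le hab, ← h0, inter_comm]
    rw [IntegrableOn, integrable_indicator_iff measurableSet_Ioc, IntegrableOn,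
      Measure.restrict_restrict measurableSet_Ioc, inter_comm] at h1
    exact h1
  · rw [← integral_indicator (measurableSet_shell a b), integral_eq_integral_radialDensity hint,
      setIntegral_congr_fun measurableSet_Ioi hrd, intervalIntegral.integral_of_le hab,
      setIntegral_indicator measurableSet_Ioc, inter_comm, h0]

/-- Here `h` is merely integrable on the interval, since it will be the almost everywhere derivative
of an absolutely continuous profile. -/
theorem integrableOn_shell_norm_smul [Nontrivial E] {F : Type*} [NormedAddCommGroup F]
    [NormedSpace ℝ F] {f : E → F} {h : ℝ → ℝ} {a b : ℝ} (hh : IntervalIntegrable h volume a b)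
    (hf : ContinuousOn f {x | ‖x‖ ∈ Icc a b}) :
    IntegrableOn (fun x => h ‖x‖ • f x) (shell E a b) := by
  have h1 : Integrable (fun x : E => (Ioc a b).indicator h ‖x‖) := by
    rw [integrable_fun_norm_addHaar (volume : Measure E) (f := (Ioc a b).indicator h)]
    have h2 : IntegrableOn (fun y : ℝ => y ^ (Module.finrank ℝ E - 1) * h y) (Ioc a b) :=
      (hh.continuousOn_mul (g := fun y : ℝ => y ^ (Module.finrank ℝ E - 1))
        (continuous_pow _).continuousOn).1
    have h3 : (fun y : ℝ => y ^ (Module.finrank ℝ E - 1) • (Ioc a b).indicator h y)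
        = (Ioc a b).indicator fun y => y ^ (Module.finrank ℝ E - 1) * h y := by
      ext y
      by_cases hy : y ∈ Ioc a b
      · rw [indicator_of_mem hy, indicator_of_mem hy, smul_eq_mul]
      · rw [indicator_of_notMem hy, indicator_of_notMem hy, smul_zero]
    rw [h3]
    exact ((integrable_indicator_iff measurableSet_Ioc).2 h2).integrableOn
  have : ProperSpace E := FiniteDimensional.proper ℝ E
  have hK : IsCompact {x : E | ‖x‖ ∈ Icc a b} := by
    refine Metric.isCompact_of_isClosed_isBounded (isClosed_Icc.preimage continuous_norm) ?_
    refine (Metric.isBounded_closedBall (x := (0 : E)) (r := b)).subset fun x hx => ?_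
    rw [mem_closedBall_zero_iff]
    exact hx.2
  have hsub : shell E a b ⊆ {x : E | ‖x‖ ∈ Icc a b} := fun x hx => ⟨hx.1.le, hx.2⟩
  have h4 : IntegrableOn (fun x : E => (Ioc a b).indicator h ‖x‖ • f x) (shell E a b) :=
    h1.integrableOn.smul_continuousOn_of_subset hf (measurableSet_shell a b) hK hsub
  refine h4.congr_fun (fun x hx => ?_) (measurableSet_shell a b)
  simp only
  rw [indicator_of_mem (show ‖x‖ ∈ Ioc a b from hx)]

theorem integral_shell_norm_mul [Nontrivial E] {f : E → ℝ} {h : ℝ → ℝ} {a b : ℝ} (ha : 0 ≤ a)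
    (hab : a ≤ b) (hf : IntegrableOn (fun x => h ‖x‖ * f x) (shell E a b)) :
    ∫ x in shell E a b, h ‖x‖ * f x = ∫ r in a..b, h r * radialDensity f r := by
  rw [(shell_integral ha hab hf).2]
  refine intervalIntegral.integral_congr fun r hr => ?_
  rw [uIcc_of_le hab] at hr
  exact radialDensity_norm_mul _ _ (ha.trans hr.1)

variable {Ω : Set E} {F : Type*} [NormedAddCommGroup F] [NormedSpace ℝ F]

theorem LocallyIntegrableOn.integrable_compactSupport_smul {f : E → F} {g : E → ℝ}
    (hf : LocallyIntegrableOn f Ω) (hg : Continuous g) (hgc : HasCompactSupport g)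
    (hgΩ : tsupport g ⊆ Ω) : Integrable (fun x => g x • f x) := by
  have h1 : IntegrableOn f (tsupport g) := hf.integrableOn_compact_subset hgΩ hgc
  have h2 : IntegrableOn (fun x => g x • f x) (tsupport g) :=
    h1.continuousOn_smul hg.continuousOn hgc
  refine (integrableOn_iff_integrable_of_support_subset fun x hx => ?_).1 h2
  refine subset_tsupport _ fun h => hx ?_
  simp only [h, zero_smul]

theorem LocallyIntegrableOn.integrable_smul_compactSupport [SecondCountableTopology F]
    {f : E → ℝ} {g : E → F}
    (hf : LocallyIntegrableOn f Ω) (hg : Continuous g) (hgc : HasCompactSupport g)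
    (hgΩ : tsupport g ⊆ Ω) : Integrable (fun x => f x • g x) := by
  have h1 : IntegrableOn f (tsupport g) := hf.integrableOn_compact_subset hgΩ hgc
  have h2 : IntegrableOn (fun x => f x • g x) (tsupport g) :=
    h1.smul_continuousOn hg.continuousOn hgc
  refine (integrableOn_iff_integrable_of_support_subset fun x hx => ?_).1 h2
  refine subset_tsupport _ fun h => hx ?_
  simp only [h, smul_zero]

end Shell

namespace IsTestFunction

variable {N : ℕ} {Ω : Set (EuclideanSpace ℝ (Fin N))} {φ : EuclideanSpace ℝ (Fin N) → ℝ}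

theorem eq_zero_of_notMem (hφ : IsTestFunction Ω φ) {x : EuclideanSpace ℝ (Fin N)} (hx : x ∉ Ω) :
    φ x = 0 :=
  image_eq_zero_of_notMem_tsupport fun h => hx (hφ.support_subset h)

theorem gradient_eq_zero_of_notMem (hφ : IsTestFunction Ω φ) {x : EuclideanSpace ℝ (Fin N)}
    (hx : x ∉ Ω) : gradient φ x = 0 :=
  image_eq_zero_of_notMem_tsupport fun h => hx (hφ.support_subset (tsupport_gradient_subset φ h))

theorem continuous_gradient (hφ : IsTestFunction Ω φ) : Continuous (gradient φ) :=
  hφ.smooth.continuous_gradient'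

theorem integrable_smul {F : Type*} [NormedAddCommGroup F] [NormedSpace ℝ F]
    {f : EuclideanSpace ℝ (Fin N) → F} (hφ : IsTestFunction Ω φ) (hf : LocallyIntegrableOn f Ω) :
    Integrable (fun x => φ x • f x) :=
  LocallyIntegrableOn.integrable_compactSupport_smul hf hφ.smooth.continuous hφ.compactSupport
    hφ.support_subset

theorem integrable_smul_gradient {f : EuclideanSpace ℝ (Fin N) → ℝ} (hφ : IsTestFunction Ω φ)
    (hf : LocallyIntegrableOn f Ω) : Integrable (fun x => f x • gradient φ x) :=
  LocallyIntegrableOn.integrable_smul_compactSupport hf hφ.continuous_gradient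
    hφ.compactSupport.gradient' ((tsupport_gradient_subset φ).trans hφ.support_subset)

theorem mono {Ω' : Set (EuclideanSpace ℝ (Fin N))} (hφ : IsTestFunction Ω φ) (h : Ω ⊆ Ω') :
    IsTestFunction Ω' φ :=
  ⟨hφ.smooth, hφ.compactSupport, hφ.support_subset.trans h⟩

end IsTestFunction

theorem IsWeakGradient.integral_mul_fderiv {N : ℕ} {Ω : Set (EuclideanSpace ℝ (Fin N))}
    {u φ : EuclideanSpace ℝ (Fin N) → ℝ} {G : EuclideanSpace ℝ (Fin N) → EuclideanSpace ℝ (Fin N)}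
    (h : IsWeakGradient Ω u G) (hφ : IsTestFunction Ω φ) (e : EuclideanSpace ℝ (Fin N)) :
    ∫ x, u x * fderiv ℝ φ x e = -∫ x, φ x * inner ℝ e (G x) := by
  have h1 := h.integral_eq φ hφ
  rw [setIntegral_eq_integral_of_forall_compl_eq_zero fun x hx => by
      rw [hφ.gradient_eq_zero_of_notMem hx, smul_zero],
    setIntegral_eq_integral_of_forall_compl_eq_zero fun x hx => by
      rw [hφ.eq_zero_of_notMem hx, zero_smul]] at h1
  have h2 := congrArg (fun y => inner ℝ e y) h1
  simp only [inner_neg_right] at h2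
  rw [← integral_inner (hφ.integrable_smul_gradient h.locallyIntegrable),
    ← integral_inner (hφ.integrable_smul h.locallyIntegrable_grad)] at h2
  simpa only [inner_smul_right, inner_gradient_eq'] using h2

/-! ### Signed powers and angular localization -/

/-- The odd extension `t ↦ |t|^{s-1} t` of the power function. -/
noncomputable def signedRpow (s t : ℝ) : ℝ := |t| ^ (s - 1) * t

theorem abs_signedRpow {s : ℝ} (hs : 0 < s) (t : ℝ) : |signedRpow s t| = |t| ^ s := by
  unfold signedRpow
  rcases eq_or_ne t 0 with rfl | ht
  · simp [Real.zero_rpow hs.ne']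
  · have := abs_pos.2 ht
    rw [abs_mul, abs_of_nonneg (by positivity), ← Real.rpow_add_one this.ne', sub_add_cancel]

theorem signedRpow_signedRpow {s : ℝ} (hs : 0 < s) (t : ℝ) :
    signedRpow (1 / s) (signedRpow s t) = t := by
  rcases eq_or_ne t 0 with rfl | ht
  · simp [signedRpow]
  · have := abs_pos.2 ht
    rw [signedRpow, abs_signedRpow hs, signedRpow, ← mul_assoc, ← Real.rpow_mul this.le,
      ← Real.rpow_add this, show s * (1 / s - 1) + (s - 1) = 0 by field_simp; ring, Real.rpow_zero,
      one_mul]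

theorem continuous_signedRpow {s : ℝ} (hs : 0 < s) : Continuous (signedRpow s) := by
  rw [continuous_iff_continuousAt]
  intro t
  rcases eq_or_ne t 0 with rfl | ht
  · have h0 : signedRpow s 0 = 0 := by simp [signedRpow]
    rw [ContinuousAt, h0, tendsto_zero_iff_abs_tendsto_zero]
    have h1 : Tendsto (fun t : ℝ => |t| ^ s) (𝓝 0) (𝓝 (|0| ^ s)) :=
      (continuous_abs.tendsto 0).rpow_const (Or.inr hs.le)
    rw [abs_zero, Real.zero_rpow hs.ne'] at h1
    exact h1.congr fun t => (abs_signedRpow hs t).symm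
  · exact (continuous_abs.continuousAt.rpow_const (Or.inl (abs_ne_zero.2 ht))).mul continuousAt_id

theorem signedRpow_of_pos {s t : ℝ} (ht : 0 < t) : signedRpow s t = t ^ s := by
  rw [signedRpow, abs_of_pos ht, ← Real.rpow_add_one ht.ne', sub_add_cancel]

theorem signedRpow_neg (s t : ℝ) : signedRpow s (-t) = -signedRpow s t := by
  rw [signedRpow, abs_neg, signedRpow, mul_neg]

theorem AbsolutelyContinuousOnInterval.congr {f g : ℝ → ℝ} {a b : ℝ}
    (hf : AbsolutelyContinuousOnInterval f a b) (hfg : EqOn f g (uIcc a b)) :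
    AbsolutelyContinuousOnInterval g a b := by
  rw [absolutelyContinuousOnInterval_iff] at hf ⊢
  intro ε hε
  obtain ⟨δ, hδ, h⟩ := hf ε hε
  refine ⟨δ, hδ, fun I hI hIδ => ?_⟩
  refine (Finset.sum_congr rfl fun i hi => ?_).trans_lt (h I hI hIδ)
  rw [hfg (hI.1 i hi).1, hfg (hI.1 i hi).2]

theorem angular_of_norm_eq_one {E : Type*} [NormedAddCommGroup E] [InnerProductSpace ℝ E]
    {B : E → ℝ} {x : E} (hx : ‖x‖ = 1) : angular B x = B x := by
  rw [angular, hx, inv_one, one_smul]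

section Angular

variable {E : Type*} [NormedAddCommGroup E] [InnerProductSpace ℝ E] [FiniteDimensional ℝ E]
  [MeasurableSpace E] [BorelSpace E]

theorem ne_zero_of_norm_mem_Icc {E : Type*} [NormedAddCommGroup E] {a b : ℝ} (ha : 0 < a) {x : E}
    (hx : ‖x‖ ∈ Icc a b) : x ≠ 0 :=
  norm_pos_iff.1 (ha.trans_le hx.1)

theorem radialDensity_of_homogeneous {f : E → ℝ} (hf : ∀ t : ℝ, 0 < t → ∀ x, f (t • x) = f x)
    {r : ℝ} (hr : 0 < r) :
    radialDensity f r = r ^ (Module.finrank ℝ E - 1) * radialDensity f 1 := by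
  unfold radialDensity
  simp only [hf r hr, one_smul, one_pow, one_mul]

theorem radialDensity_one_pos {f : E → ℝ} (hf : ContinuousOn f {0}ᶜ)
    (h0 : ∀ x, ‖x‖ = 1 → 0 ≤ f x) {v : E} (hv : ‖v‖ = 1) (hfv : f v ≠ 0) :
    0 < radialDensity f 1 := by
  unfold radialDensity
  simp only [one_smul, one_pow, one_mul]
  have : ProperSpace E := FiniteDimensional.proper ℝ E
  have hc : Continuous fun y : Metric.sphere (0 : E) 1 => f y :=
    hf.comp_continuous continuous_subtype_val fun y =>
      norm_pos_iff.1 (by rw [norm_eq_of_mem_sphere]; exact one_pos)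
  have : CompactSpace (Metric.sphere (0 : E) 1) := isCompact_iff_compactSpace.1 (isCompact_sphere 0 1)
  exact hc.integral_pos_of_hasCompactSupport_nonneg_nonzero (HasCompactSupport.of_compactSpace _)
    (fun y => h0 y (norm_eq_of_mem_sphere y)) (x := ⟨v, by simpa using hv⟩) hfv

/-- Integrability on the cone suffices, because the angular bump vanishes on the rest of the shell.
No information is therefore needed outside `Ω`. -/
theorem integrableOn_shell_angular_mul {v : E} (B : ContDiffBump v) {a b : ℝ} (ha : 0 < a)
    {g : E → ℝ} (hg : IntegrableOn g (truncatedCone v B.rOut a b)) :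
    IntegrableOn (fun x => angular B x * g x) (shell E a b) := by
  have hK := isCompact_truncatedCone v B.rOut a b
  have hB : ContDiff ℝ ∞ B := B.contDiff
  have h1 : IntegrableOn (fun x => angular B x * g x) (truncatedCone v B.rOut a b) :=
    hg.continuousOn_mul ((continuousOn_angular hB).mono fun x hx =>
      ne_zero_of_norm_mem_Icc ha ⟨hx.1, hx.2.1⟩) hK
  refine h1.of_forall_sdiff_eq_zero (measurableSet_shell a b) fun x hx => ?_
  rw [angular_bump_eq_zero B (ne_zero_of_norm_mem_Icc ha ⟨hx.1.1.le, hx.1.2⟩) hx.1.1.le hx.1.2 hx.2,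
    zero_mul]

end Angular

/-! ### Absolute continuity of the radial profile -/

section WeakRadial

variable {N : ℕ} {Ω : Set (EuclideanSpace ℝ (Fin N))} {u : EuclideanSpace ℝ (Fin N) → ℝ}
  {f : ℝ → ℝ} {G : EuclideanSpace ℝ (Fin N) → EuclideanSpace ℝ (Fin N)}
  {v : EuclideanSpace ℝ (Fin N)} {a b : ℝ}

theorem eq_zero_of_notMem_Ioo {A : ℝ → ℝ} (hA : tsupport A ⊆ Ioo a b) {r : ℝ} (hr : r ∉ Ioo a b) :
    A r = 0 := image_eq_zero_of_notMem_tsupport fun h => hr (hA h)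

theorem isTestFunction_norm_mul_angular (B : ContDiffBump v) (ha : 0 < a)
    (hcone : truncatedCone v B.rOut a b ⊆ Ω) {A : ℝ → ℝ} (hA : ContDiff ℝ ∞ A)
    (hAs : tsupport A ⊆ Ioo a b) : IsTestFunction Ω (fun x => A ‖x‖ * angular B x) := by
  have hsupp : Function.support (fun x => A ‖x‖ * angular B x) ⊆ truncatedCone v B.rOut a b := by
    intro x hx
    by_contra hcon
    refine hx ?_
    by_cases hr : ‖x‖ ∈ Ioo a b
    · simp only
      rw [angular_bump_eq_zero B (norm_pos_iff.1 (ha.trans hr.1)) hr.1.le hr.2.le hcon, mul_zero]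
    · simp only
      rw [eq_zero_of_notMem_Ioo hAs hr, zero_mul]
  have hK := isCompact_truncatedCone v B.rOut a b
  refine ⟨?_, HasCompactSupport.of_support_subset_isCompact hK hsupp,
    (closure_minimal hsupp hK.isClosed).trans hcone⟩
  rw [contDiff_iff_contDiffAt]
  intro x
  rcases eq_or_ne x 0 with rfl | hx
  · refine (contDiffAt_const (c := (0 : ℝ))).congr_of_eventuallyEq ?_
    filter_upwards [Metric.ball_mem_nhds (0 : EuclideanSpace ℝ (Fin N)) ha] with y hy
    rw [mem_ball_zero_iff] at hy
    rw [eq_zero_of_notMem_Ioo hAs fun h => (h.1.trans hy).false, zero_mul]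
  · exact (hA.contDiffAt.comp x (contDiffAt_norm ℝ hx)).mul (contDiffAt_angular B.contDiff hx)

theorem continuousOn_radial_profile (hv : ‖v‖ = 1) {δ : ℝ} (hδ : 0 ≤ δ) (ha : 0 ≤ a)
    (hcone : truncatedCone v δ a b ⊆ Ω) (huc : ContinuousOn u Ω) (hrad : ∀ x ∈ Ω, u x = f ‖x‖) :
    ContinuousOn f (Icc a b) := by
  have h1 : ∀ r ∈ Icc a b, r • v ∈ Ω := fun r hr =>
    hcone (smul_mem_truncatedCone hv hδ ha hr)
  have h2 : ContinuousOn (fun r : ℝ => u (r • v)) (Icc a b) :=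
    huc.comp (by fun_prop) h1
  refine h2.congr fun r hr => ?_
  simp only
  rw [hrad _ (h1 r hr), norm_smul, hv, mul_one, Real.norm_of_nonneg (ha.trans hr.1)]

/-- Testing the weak gradient in the axis direction `v` against `A(|x|) B(x/|x|)` and integrating
over spheres shows that `κ r^{N-1} f` has an integrable weak derivative. Here `κ` is the spherical
integral of `⟨x, v⟩ B`, positive because the cone is narrow; dividing by `κ r^{N-1}` preserves
absolute continuity. -/
theorem radial_absolutelyContinuous [NeZero N] (B : ContDiffBump v) (hB : B.rOut ≤ 1 / 2)
    (hv : ‖v‖ = 1) (ha : 0 < a) (hab : a < b) (hcone : truncatedCone v B.rOut a b ⊆ Ω)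
    (huc : ContinuousOn u Ω) (hrad : ∀ x ∈ Ω, u x = f ‖x‖) (hG : IsWeakGradient Ω u G) :
    AbsolutelyContinuousOnInterval f a b := by
  have hBs : ContDiff ℝ ∞ B := B.contDiff
  have hfc : ContinuousOn f (Icc a b) :=
    continuousOn_radial_profile hv B.rOut_pos.le ha.le hcone huc hrad
  have hfi : IntervalIntegrable f volume a b := by
    refine ContinuousOn.intervalIntegrable ?_
    rwa [uIcc_of_le hab.le]
  set n := Module.finrank ℝ (EuclideanSpace ℝ (Fin N)) - 1 with hn
  have hsub0 : {x : EuclideanSpace ℝ (Fin N) | ‖x‖ ∈ Icc a b} ⊆ {0}ᶜ := fun x hx =>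
    ne_zero_of_norm_mem_Icc ha hx
  set F₂ : EuclideanSpace ℝ (Fin N) → ℝ := fun x => ‖x‖⁻¹ * inner ℝ x v * angular B x with hF₂
  set F₃ : EuclideanSpace ℝ (Fin N) → ℝ := fun x => fderiv ℝ (angular B) x v with hF₃
  have hF₂c : ContinuousOn F₂ {0}ᶜ := by
    refine ((continuousOn_id.norm.inv₀ fun x hx => norm_ne_zero_iff.2 hx).mul ?_).mul
      (continuousOn_angular hBs)
    fun_prop
  have hF₃c : ContinuousOn F₃ {0}ᶜ := by
    intro x hx
    have h1 : ContDiffAt ℝ 0 (fderiv ℝ (angular B)) x :=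
      (contDiffAt_angular hBs hx).fderiv_right (m := 0) (by simp)
    exact (h1.continuousAt.clm_apply continuousAt_const).continuousWithinAt
  set κ := radialDensity F₂ 1 with hκ
  have hκ0 : 0 < κ := by
    refine radialDensity_one_pos hF₂c (fun x hx => ?_) hv ?_
    · simp only [hF₂, angular_of_norm_eq_one hx, hx, inv_one, one_mul]
      by_cases hd : dist x v < B.rOut
      · refine mul_nonneg ?_ B.nonneg
        rw [dist_eq_norm] at hd
        -- For unit vectors, `|x - v|² = 2 - 2⟨x, v⟩`; so `|x - v| < 1/2` makes the inner product
        -- positive.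
        have h1 := norm_sub_sq_real x v
        rw [hx, hv] at h1
        nlinarith [norm_nonneg (x - v)]
      · rw [B.zero_of_le_dist (not_lt.1 hd), mul_zero]
    · simp only [hF₂, angular_of_norm_eq_one hv, hv, real_inner_self_eq_norm_sq]
      have := B.pos_of_mem_ball (Metric.mem_ball_self B.rOut_pos)
      simpa using this.ne'
  have hrd₂ : ∀ r, 0 < r → radialDensity F₂ r = r ^ n * κ := by
    intro r hr
    refine radialDensity_of_homogeneous (fun t ht x => ?_) hr
    simp only [hF₂]
    rw [angular_smul _ ht, norm_smul, Real.norm_of_nonneg ht.le, real_inner_smul_left]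
    field_simp
  set H₁ := radialDensity fun x => angular B x * inner ℝ v (G x) with hH₁
  set H₃ := radialDensity F₃ with hH₃
  have hGc : IntegrableOn (fun x => inner ℝ v (G x)) (truncatedCone v B.rOut a b) :=
    (hG.locallyIntegrable_grad.integrableOn_compact_subset hcone
      (isCompact_truncatedCone v B.rOut a b)).const_inner v
  have hH₁i : IntervalIntegrable H₁ volume a b :=
    (shell_integral ha.le hab.le (integrableOn_shell_angular_mul B ha hGc)).1
  have hF₃s : IntegrableOn (fun x => (1 : ℝ) • F₃ x) (shell (EuclideanSpace ℝ (Fin N)) a b) :=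
    integrableOn_shell_norm_smul (h := fun _ => 1) intervalIntegrable_const (hF₃c.mono hsub0)
  simp only [one_smul] at hF₃s
  have hH₃i : IntervalIntegrable H₃ volume a b := (shell_integral ha.le hab.le hF₃s).1
  have hfH₃ : IntervalIntegrable (fun r => f r * H₃ r) volume a b :=
    hH₃i.continuousOn_mul (by rwa [uIcc_of_le hab.le])
  -- The two terms of the density come from the weak gradient and from the derivative of the angular
  -- factor; the term with `A'` carries `κ r^{N-1} f`.
  obtain ⟨k, hk⟩ := ae_eq_const_add_integral (Ψ := fun r => κ * (r ^ n * f r))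
    (H := fun r => H₁ r + f r * H₃ r) hab
    ((hfi.continuousOn_mul (g := fun r => r ^ n) (by fun_prop)).const_mul κ)
    (hH₁i.add hfH₃) (by
      intro A hA hAc hAs
      have hφ := isTestFunction_norm_mul_angular B ha hcone hA hAs
      have hA1 : Continuous (deriv A) := hA.continuous_deriv (by simp)
      have hid := hG.integral_mul_fderiv hφ v
      set φ : EuclideanSpace ℝ (Fin N) → ℝ := fun x => A ‖x‖ * angular B x with hφdef
      have hout : ∀ x, x ∉ shell (EuclideanSpace ℝ (Fin N)) a b → ‖x‖ ∉ Ioo a b :=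
        fun x hx h => hx ⟨h.1, h.2.le⟩
      have hφs : IsTestFunction {x : EuclideanSpace ℝ (Fin N) | ‖x‖ ∈ Ioo a b} φ := by
        refine ⟨hφ.smooth, hφ.compactSupport, ?_⟩
        have h1 : tsupport φ ⊆ (fun x => ‖x‖) ⁻¹' tsupport A := by
          refine closure_minimal (fun x hx => subset_tsupport A fun h => hx ?_)
            ((isClosed_tsupport A).preimage continuous_norm)
          simp only [hφdef, h, zero_mul]
        exact h1.trans (preimage_mono hAs)
      have hzero : ∀ x, x ∉ shell (EuclideanSpace ℝ (Fin N)) a b → u x * fderiv ℝ φ x v = 0 := by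
        intro x hx
        rw [← inner_gradient_eq φ x v, hφs.gradient_eq_zero_of_notMem (hout x hx), inner_zero_left,
          mul_zero]
      have hzero' : ∀ x, x ∉ shell (EuclideanSpace ℝ (Fin N)) a b → φ x * inner ℝ v (G x) = 0 := by
        intro x hx
        rw [hφs.eq_zero_of_notMem (hout x hx), zero_mul]
      rw [← setIntegral_eq_integral_of_forall_compl_eq_zero hzero,
        ← setIntegral_eq_integral_of_forall_compl_eq_zero hzero'] at hid
      have hi2 : IntegrableOn (fun x => (f ‖x‖ * deriv A ‖x‖) * F₂ x)
          (shell (EuclideanSpace ℝ (Fin N)) a b) :=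
        integrableOn_shell_norm_smul (h := fun r => f r * deriv A r)
          (hfi.mul_continuousOn hA1.continuousOn) (hF₂c.mono hsub0)
      have hi3 : IntegrableOn (fun x => (f ‖x‖ * A ‖x‖) * F₃ x)
          (shell (EuclideanSpace ℝ (Fin N)) a b) :=
        integrableOn_shell_norm_smul (h := fun r => f r * A r)
          (hfi.mul_continuousOn hA.continuous.continuousOn) (hF₃c.mono hsub0)
      have hi1 : IntegrableOn (fun x => A ‖x‖ * (angular B x * inner ℝ v (G x)))
          (shell (EuclideanSpace ℝ (Fin N)) a b) := by
        have h1 := ((hφ.integrable_smul hG.locallyIntegrable_grad).const_inner (𝕜 := ℝ) v).integrableOn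
          (s := shell (EuclideanSpace ℝ (Fin N)) a b)
        refine h1.congr_fun (fun x _ => ?_) (measurableSet_shell a b)
        simp only [hφdef, inner_smul_right, mul_assoc]
      have hL : ∫ x in shell (EuclideanSpace ℝ (Fin N)) a b, u x * fderiv ℝ φ x v
          = (∫ r in a..b, (f r * deriv A r) * radialDensity F₂ r)
            + ∫ r in a..b, (f r * A r) * H₃ r := by
        rw [← integral_shell_norm_mul (f := F₂) (h := fun r => f r * deriv A r) ha.le hab.le hi2,
          ← integral_shell_norm_mul (f := F₃) (h := fun r => f r * A r) ha.le hab.le hi3,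
          ← integral_add hi2 hi3]
        refine setIntegral_congr_fun (measurableSet_shell a b) fun x hx => ?_
        have hx0 : x ≠ 0 := ne_zero_of_norm_mem_Icc ha ⟨hx.1.le, hx.2⟩
        have h1 : u x * fderiv ℝ φ x v = f ‖x‖ * fderiv ℝ φ x v := by
          by_cases hxΩ : x ∈ Ω
          · rw [hrad x hxΩ]
          · rw [← inner_gradient_eq φ x v, hφ.gradient_eq_zero_of_notMem hxΩ, inner_zero_left,
              mul_zero, mul_zero]
        rw [h1, (hasFDerivAt_norm_mul_angular hBs hx0
          ((hA.differentiable (by simp)) _).hasDerivAt).fderiv]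
        simp only [hF₂, hF₃, add_apply, smul_apply,
          innerSL_apply_apply, smul_eq_mul]
        ring
      have hR : ∫ x in shell (EuclideanSpace ℝ (Fin N)) a b, φ x * inner ℝ v (G x)
          = ∫ r in a..b, A r * H₁ r := by
        rw [← integral_shell_norm_mul (h := A) ha.le hab.le hi1]
        refine setIntegral_congr_fun (measurableSet_shell a b) fun x _ => ?_
        simp only [hφdef, mul_assoc]
      rw [hL, hR] at hid
      have e1 : ∫ r in a..b, κ * (r ^ n * f r) * deriv A r
          = ∫ r in a..b, (f r * deriv A r) * radialDensity F₂ r := by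
        refine intervalIntegral.integral_congr fun r hr => ?_
        rw [uIcc_of_le hab.le] at hr
        simp only
        rw [hrd₂ r (ha.trans_le hr.1)]
        ring
      have e2 : ∫ r in a..b, (H₁ r + f r * H₃ r) * A r
          = (∫ r in a..b, A r * H₁ r) + ∫ r in a..b, (f r * A r) * H₃ r := by
        rw [← intervalIntegral.integral_add
          (hH₁i.continuousOn_mul hA.continuous.continuousOn)
          ((hfH₃.mul_continuousOn hA.continuous.continuousOn).congr
            (g := fun r => (f r * A r) * H₃ r) fun r _ => by simp only; ring)]
        refine intervalIntegral.integral_congr fun r _ => ?_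
        ring
      rw [e1, e2]
      linarith)
  have hAC : AbsolutelyContinuousOnInterval (fun r => ∫ s in a..r, (H₁ s + f s * H₃ s)) a b :=
    (hH₁i.add hfH₃).absolutelyContinuousOnInterval_intervalIntegral left_mem_uIcc
  have hconst : AbsolutelyContinuousOnInterval (fun _ : ℝ => k) a b :=
    contDiffOn_const.absolutelyContinuousOnInterval
  have hinv : AbsolutelyContinuousOnInterval (fun r : ℝ => (κ * r ^ n)⁻¹) a b := by
    refine ContDiffOn.absolutelyContinuousOnInterval ?_
    rw [uIcc_of_le hab.le]
    refine ContDiffOn.inv (by fun_prop) fun r hr => ?_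
    have := ha.trans_le hr.1
    positivity
  have hsum := hconst.fun_add hAC
  -- The equality holds almost everywhere between continuous functions, hence everywhere on the
  -- closed interval.
  have heq : EqOn (fun r => κ * (r ^ n * f r))
      (fun r => k + ∫ s in a..r, (H₁ s + f s * H₃ s)) (Icc a b) := by
    refine Measure.eqOn_Icc_of_ae_eq volume hab.ne ?_ ?_ ?_
    · rw [← restrict_Ioo_eq_restrict_Icc, EventuallyEq, ae_restrict_iff' measurableSet_Ioo]
      exact hk
    · exact ((continuousOn_pow n).mul hfc).const_smul κ
    · have := hsum.continuousOn
      rwa [uIcc_of_le hab.le] at this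
  refine (hsum.fun_mul hinv).congr fun r hr => ?_
  rw [uIcc_of_le hab.le] at hr
  have hr0 : 0 < r := ha.trans_le hr.1
  have h1 := heq hr
  simp only at h1 ⊢
  rw [← h1]
  field_simp

end WeakRadial

/-! ### The weak gradient of a radial function -/

section RadialGradient

variable {N : ℕ} {Ω : Set (EuclideanSpace ℝ (Fin N))} {u : EuclideanSpace ℝ (Fin N) → ℝ}
  {f : ℝ → ℝ} {G : EuclideanSpace ℝ (Fin N) → EuclideanSpace ℝ (Fin N)}
  {a b : ℝ}

theorem setIntegral_shell_of_eq_zero {f : EuclideanSpace ℝ (Fin N) → ℝ}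
    (hf : ∀ x, ‖x‖ ∉ Ioo a b → f x = 0) :
    ∫ x in shell (EuclideanSpace ℝ (Fin N)) a b, f x = ∫ x, f x :=
  setIntegral_eq_integral_of_forall_compl_eq_zero fun x hx =>
    hf x fun h => hx ⟨h.1, h.2.le⟩

theorem integral_fderiv_eq_zero {φ : EuclideanSpace ℝ (Fin N) → ℝ} (hφ : ContDiff ℝ ∞ φ)
    (hφc : HasCompactSupport φ) (e : EuclideanSpace ℝ (Fin N)) :
    ∫ x, fderiv ℝ φ x e = 0 := by
  have hi : Integrable fun x => fderiv ℝ φ x e :=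
    ((hφ.continuous_fderiv (by simp)).clm_apply continuous_const).integrable_of_hasCompactSupport
      (hφc.fderiv_apply (𝕜 := ℝ) e)
  have h := integral_mul_fderiv_eq_neg_fderiv_mul_of_integrable (μ := volume)
    (f := fun _ : EuclideanSpace ℝ (Fin N) => (1 : ℝ)) (g := φ) (v := e)
    (by simp) (by simpa using hi)
    (by simpa using hφ.continuous.integrable_of_hasCompactSupport hφc)
    (fun x _ => differentiableAt_const _) (fun x _ => hφ.differentiable (by simp) x)
  simpa using h

/-- A reduction to dimension one: the spherical integral of `∂_e φ` is the derivative of the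
spherical integral of `φ ⟨x, e⟩ / |x|`, which is the divergence theorem on balls, here in weak form
through `ae_eq_const_add_integral`. An integration by parts in `r` against the absolutely continuous
`f` concludes. -/
theorem integral_comp_norm_mul_fderiv [NeZero N] (ha : 0 < a) (hab : a < b)
    (hf : AbsolutelyContinuousOnInterval f a b) {φ : EuclideanSpace ℝ (Fin N) → ℝ}
    (hφ : IsTestFunction {x | ‖x‖ ∈ Ioo a b} φ) (e : EuclideanSpace ℝ (Fin N)) :
    ∫ x, f ‖x‖ * fderiv ℝ φ x e = -∫ x, φ x * (deriv f ‖x‖ * (‖x‖⁻¹ * inner ℝ x e)) := by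
  have hsub0 : {x : EuclideanSpace ℝ (Fin N) | ‖x‖ ∈ Icc a b} ⊆ {0}ᶜ := fun x hx =>
    ne_zero_of_norm_mem_Icc ha hx
  have hfi : IntervalIntegrable f volume a b := hf.continuousOn.intervalIntegrable
  set P : EuclideanSpace ℝ (Fin N) → ℝ := fun x => fderiv ℝ φ x e with hP
  set Q : EuclideanSpace ℝ (Fin N) → ℝ := fun x => ‖x‖⁻¹ * inner ℝ x e * φ x with hQ
  have hφC := hφ.smooth.continuous
  have hPc : Continuous P := (hφ.smooth.continuous_fderiv (by simp)).clm_apply continuous_const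
  have hQc : ContinuousOn Q {0}ᶜ := by
    refine ((continuousOn_id.norm.inv₀ fun x hx => norm_ne_zero_iff.2 hx).mul ?_).mul
      hφC.continuousOn
    fun_prop
  have hP0 : ∀ x, ‖x‖ ∉ Ioo a b → P x = 0 := fun x hx => by
    simp only [hP]
    rw [← inner_gradient_eq φ x e, hφ.gradient_eq_zero_of_notMem hx, inner_zero_left]
  have hφ0 : ∀ x, ‖x‖ ∉ Ioo a b → φ x = 0 := fun x hx => hφ.eq_zero_of_notMem hx
  have hQ0 : ∀ x, ‖x‖ ∉ Ioo a b → Q x = 0 := fun x hx => by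
    simp only [hQ, hφ0 x hx, mul_zero]
  have hmulP : ∀ {h : ℝ → ℝ}, IntervalIntegrable h volume a b →
      IntegrableOn (fun x => h ‖x‖ * P x) (shell (EuclideanSpace ℝ (Fin N)) a b) := fun hh =>
    integrableOn_shell_norm_smul hh hPc.continuousOn
  have hmulQ : ∀ {h : ℝ → ℝ}, IntervalIntegrable h volume a b →
      IntegrableOn (fun x => h ‖x‖ * Q x) (shell (EuclideanSpace ℝ (Fin N)) a b) := fun hh =>
    integrableOn_shell_norm_smul hh (hQc.mono hsub0)
  have hone : IntervalIntegrable (fun _ : ℝ => (1 : ℝ)) volume a b := intervalIntegrable_const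
  have hPi := hmulP hone
  have hQi := hmulQ hone
  simp only [one_mul] at hPi hQi
  have hPr := shell_integral ha.le hab.le hPi
  have hQr := shell_integral ha.le hab.le hQi
  obtain ⟨k, hk⟩ := ae_eq_const_add_integral hab hQr.1 hPr.1 (by
    intro A hA hAc hAs
    have hA1 : Continuous (deriv A) := hA.continuous_deriv (by simp)
    have i1 := hmulQ (hA1.intervalIntegrable (μ := volume) a b)
    have i2 := hmulP (hA.continuous.intervalIntegrable (μ := volume) a b)
    have e1 : ∫ r in a..b, radialDensity Q r * deriv A r
        = ∫ x, deriv A ‖x‖ * Q x := by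
      rw [← setIntegral_shell_of_eq_zero (a := a) (b := b)
        (fun x hx => by rw [hQ0 x hx, mul_zero]), integral_shell_norm_mul ha.le hab.le i1]
      exact intervalIntegral.integral_congr fun r _ => mul_comm _ _
    have e2 : ∫ r in a..b, radialDensity P r * A r = ∫ x, A ‖x‖ * P x := by
      rw [← setIntegral_shell_of_eq_zero (a := a) (b := b)
        (fun x hx => by rw [hP0 x hx, mul_zero]), integral_shell_norm_mul ha.le hab.le i2]
      exact intervalIntegral.integral_congr fun r _ => mul_comm _ _
    have hAd : ∀ x : EuclideanSpace ℝ (Fin N), x ≠ 0 →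
        HasFDerivAt (fun x : EuclideanSpace ℝ (Fin N) => A ‖x‖)
          ((deriv A ‖x‖ / ‖x‖) • innerSL ℝ x) x := fun x hx =>
      hasFDerivAt_comp_norm hx ((hA.differentiable (by simp)) _).hasDerivAt
    have hfd : ∀ x : EuclideanSpace ℝ (Fin N),
        fderiv ℝ (fun x : EuclideanSpace ℝ (Fin N) => A ‖x‖) x e * φ x = deriv A ‖x‖ * Q x := by
      intro x
      by_cases hx : ‖x‖ ∈ Ioo a b
      · rw [(hAd x (norm_pos_iff.1 (ha.trans hx.1))).fderiv]
        simp only [hQ, smul_apply, innerSL_apply_apply, smul_eq_mul]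
        ring
      · rw [hQ0 x hx, hφ0 x hx, mul_zero, mul_zero]
    have hon : ∀ {g : EuclideanSpace ℝ (Fin N) → ℝ}, (∀ x, ‖x‖ ∉ Ioo a b → g x = 0) →
        IntegrableOn g (shell (EuclideanSpace ℝ (Fin N)) a b) → Integrable g := by
      intro g hg hgi
      refine (integrableOn_iff_integrable_of_support_subset fun x hx => ?_).1 hgi
      by_contra hcon
      exact hx (hg x fun h => hcon ⟨h.1, h.2.le⟩)
    rw [e1, e2]
    simp_rw [← hfd]
    rw [eq_comm, neg_eq_iff_eq_neg]
    refine integral_mul_fderiv_eq_neg_fderiv_mul_of_integrable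
      (f := fun x : EuclideanSpace ℝ (Fin N) => A ‖x‖) (g := φ) ?_ ?_ ?_ ?_ ?_
    · simp_rw [hfd]
      exact hon (fun x hx => by rw [hQ0 x hx, mul_zero]) i1
    · exact hon (fun x hx => (congrArg (A ‖x‖ * ·) (hP0 x hx)).trans (mul_zero _)) i2
    · refine Continuous.integrable_of_hasCompactSupport ?_ (hφ.compactSupport.mul_left)
      exact (hA.continuous.comp continuous_norm).mul hφC
    · intro x hx
      exact (hAd x (norm_pos_iff.1 (ha.trans (hφ.support_subset hx).1))).differentiableAt
    · intro x _
      exact hφ.smooth.differentiable (by simp) x)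
  have hPint : ∫ s in a..b, radialDensity P s = 0 := by
    rw [← hPr.2, setIntegral_shell_of_eq_zero hP0]
    exact integral_fderiv_eq_zero hφ.smooth hφ.compactSupport e
  obtain ⟨c, d, hac, -, -, hcd⟩ : ∃ c d, a < c ∧ c < d ∧ d < b ∧
      ∀ x, x ∈ tsupport φ → ‖x‖ ∈ Ioo c d := by
    obtain ⟨c, d, h1, h2, h3, h4⟩ := IsCompact.exists_subset_Ioo
      (hφ.compactSupport.isCompact.image continuous_norm)
      (image_subset_iff.2 fun x hx => hφ.support_subset hx) hab
    exact ⟨c, d, h1, h2, h3, fun x hx => h4 (mem_image_of_mem _ hx)⟩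
  -- The support of `φ` stays away from the sphere of radius `a`, so both spherical integrals vanish
  -- for radii near `a`.
  have hk0 : k = 0 := by
    have hc' : a < min b c := lt_min hab hac
    have hne : (volume (Ioo a (min b c))) ≠ 0 := by simp [hab, hac]
    obtain ⟨r, hr, hr'⟩ : ∃ r ∈ Ioo a (min b c), radialDensity Q r
        = k + ∫ s in a..r, radialDensity P s := by
      by_contra! hcon
      refine hne (measure_mono_null (fun r hr => ?_) hk)
      simp only [mem_compl_iff]
      exact fun h => hcon r hr (h ⟨hr.1, hr.2.trans_le (min_le_left _ _)⟩)
    have hz : ∀ s, 0 ≤ s → s ≤ c → (∀ x : EuclideanSpace ℝ (Fin N), ‖x‖ = s → x ∉ tsupport φ) := by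
      intro s _ hs x hx hxt
      have := (hcd x hxt).1
      linarith
    have hrc : r ≤ c := hr.2.le.trans (min_le_right _ _)
    have h1 : radialDensity Q r = 0 := radialDensity_eq_zero (ha.trans hr.1).le fun x hx => by
      simp only [hQ]
      rw [image_eq_zero_of_notMem_tsupport (hz r (ha.trans hr.1).le hrc x hx), mul_zero]
    have h2 : ∫ s in a..r, radialDensity P s = 0 := by
      rw [intervalIntegral.integral_congr (g := fun _ => (0 : ℝ)), intervalIntegral.integral_zero]
      intro s hs
      rw [uIcc_of_le hr.1.le] at hs
      refine radialDensity_eq_zero (ha.le.trans hs.1) fun x hx => ?_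
      simp only [hP]
      rw [← inner_gradient_eq φ x e, image_eq_zero_of_notMem_tsupport fun h =>
        hz s (ha.le.trans hs.1) (hs.2.trans hrc) x hx (tsupport_gradient_subset φ h),
        inner_zero_left]
    rw [h1, h2] at hr'
    linarith
  subst hk0
  have hfd := hf.intervalIntegrable_deriv
  have h1 := integral_primitive_mul_deriv hPr.1 hf (by rw [hPint, zero_mul])
  have h2 : ∫ r in a..b, (∫ s in a..r, radialDensity P s) * deriv f r
      = ∫ r in a..b, deriv f r * radialDensity Q r := by
    rw [intervalIntegral.integral_of_le hab.le, intervalIntegral.integral_of_le hab.le,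
      integral_Ioc_eq_integral_Ioo, integral_Ioc_eq_integral_Ioo]
    refine setIntegral_congr_ae measurableSet_Ioo ?_
    filter_upwards [hk] with r hr hr'
    rw [hr hr', zero_add, mul_comm]
  have h3 : ∫ x, f ‖x‖ * P x = ∫ r in a..b, radialDensity P r * f r := by
    rw [← setIntegral_shell_of_eq_zero (a := a) (b := b)
        (fun x hx => by rw [hP0 x hx, mul_zero]), integral_shell_norm_mul ha.le hab.le (hmulP hfi)]
    exact intervalIntegral.integral_congr fun r _ => mul_comm _ _
  have h4 : ∫ x, φ x * (deriv f ‖x‖ * (‖x‖⁻¹ * inner ℝ x e))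
      = ∫ r in a..b, deriv f r * radialDensity Q r := by
    rw [← integral_shell_norm_mul ha.le hab.le (hmulQ hfd), setIntegral_shell_of_eq_zero
        (a := a) (b := b) (fun x hx => by rw [hQ0 x hx, mul_zero])]
    refine integral_congr_ae (Eventually.of_forall fun x => ?_)
    simp only [hQ]
    ring
  rw [h3, h4, ← h2, h1, neg_neg]

/-- Both fields satisfy the same integration by parts formula for test functions in `Ω ∩ {a < |x| <
b}`, so their difference vanishes almost everywhere there. -/
theorem radialGradient_ae_eq [NeZero N] (hΩ : IsOpen Ω) (ha : 0 < a) (hab : a < b)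
    (hf : AbsolutelyContinuousOnInterval f a b) (hrad : ∀ x ∈ Ω, u x = f ‖x‖)
    (hG : IsWeakGradient Ω u G) :
    ∀ᵐ x, x ∈ Ω → ‖x‖ ∈ Ioo a b → G x = (deriv f ‖x‖ / ‖x‖) • x := by
  set R : EuclideanSpace ℝ (Fin N) → EuclideanSpace ℝ (Fin N) :=
    fun x => deriv f ‖x‖ • (‖x‖⁻¹ • x) with hR
  set V : Set (EuclideanSpace ℝ (Fin N)) := Ω ∩ {x | ‖x‖ ∈ Ioo a b} with hV
  have hVo : IsOpen V := hΩ.inter (isOpen_Ioo.preimage continuous_norm)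
  have hRi : IntegrableOn R (shell (EuclideanSpace ℝ (Fin N)) a b) := by
    refine integrableOn_shell_norm_smul hf.intervalIntegrable_deriv ?_
    refine ContinuousOn.smul (continuousOn_id.norm.inv₀ fun x hx => norm_ne_zero_iff.2 ?_)
      continuousOn_id
    exact ne_zero_of_norm_mem_Icc ha hx
  have hRV : LocallyIntegrableOn R V :=
    (hRi.mono_set fun x hx => ⟨hx.2.1, hx.2.2.le⟩).locallyIntegrableOn
  have hGV : LocallyIntegrableOn G V := hG.locallyIntegrable_grad.mono_set inter_subset_left
  have key := hVo.ae_eq_zero_of_integral_contDiff_smul_eq_zero (μ := volume)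
    (f := fun x => G x - R x) (hGV.sub hRV) (by
      intro φ hφ hφc hφs
      have hφV : IsTestFunction V φ := ⟨hφ, hφc, hφs⟩
      have hφΩ := hφV.mono (inter_subset_left : V ⊆ Ω)
      have hφS := hφV.mono (inter_subset_right : V ⊆ {x | ‖x‖ ∈ Ioo a b})
      have iG := hφV.integrable_smul hGV
      have iR := hφV.integrable_smul hRV
      refine ext_inner_left ℝ fun e => ?_
      have iS : Integrable fun x => φ x • (G x - R x) := hφV.integrable_smul (hGV.sub hRV)
      rw [inner_zero_right, ← integral_inner iS]
      have h1 := hG.integral_mul_fderiv hφΩ e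
      have h2 := integral_comp_norm_mul_fderiv ha hab hf hφS e
      have h3 : ∫ x, u x * fderiv ℝ φ x e = ∫ x, f ‖x‖ * fderiv ℝ φ x e := by
        refine integral_congr_ae (Eventually.of_forall fun x => ?_)
        simp only
        by_cases hx : x ∈ Ω
        · rw [hrad x hx]
        · rw [← inner_gradient_eq φ x e, hφΩ.gradient_eq_zero_of_notMem hx, inner_zero_left,
            mul_zero, mul_zero]
      rw [h3, h2, neg_inj] at h1
      have h4 : ∀ x, inner ℝ e (φ x • (G x - R x))
          = φ x * inner ℝ e (G x) - φ x * (deriv f ‖x‖ * (‖x‖⁻¹ * inner ℝ x e)) := by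
        intro x
        simp only [hR, inner_smul_right, inner_sub_right, real_inner_comm e x, mul_sub]
      simp_rw [h4]
      rw [integral_sub, h1, sub_self]
      · simpa only [inner_smul_right] using iG.const_inner (𝕜 := ℝ) e
      · simpa only [hR, inner_smul_right, real_inner_comm e] using iR.const_inner (𝕜 := ℝ) e)
  filter_upwards [key] with x hx hxΩ hxr
  rw [sub_eq_zero.1 (hx ⟨hxΩ, hxr⟩)]
  simp only [hR, smul_smul, div_eq_mul_inv]

end RadialGradient

/-! ### Radial weak solutions are classical away from the origin -/

section RadialSolution

variable {N : ℕ} {Ω : Set (EuclideanSpace ℝ (Fin N))} {u : EuclideanSpace ℝ (Fin N) → ℝ}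
  {f : ℝ → ℝ} {G : EuclideanSpace ℝ (Fin N) → EuclideanSpace ℝ (Fin N)} {p α q : ℝ}
  {v : EuclideanSpace ℝ (Fin N)} {a b : ℝ}

theorem norm_pFlux (hp : 1 < p) (ξ : EuclideanSpace ℝ (Fin N)) :
    ‖pFlux p ξ‖ = ‖ξ‖ ^ (p - 1) := by
  rw [pFlux, norm_smul, Real.norm_of_nonneg (by positivity)]
  rcases eq_or_ne ‖ξ‖ 0 with h | h
  · rw [h, mul_zero, Real.zero_rpow (by linarith)]
  · rw [← Real.rpow_add_one h]
    congr 1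
    ring

theorem norm_pFlux_le (hp : 1 < p) (ξ : EuclideanSpace ℝ (Fin N)) :
    ‖pFlux p ξ‖ ≤ 1 + ‖ξ‖ ^ p := by
  rw [norm_pFlux hp]
  rcases le_total ‖ξ‖ 1 with h | h
  · have h1 := Real.rpow_le_one (norm_nonneg ξ) h (by linarith : 0 ≤ p - 1)
    have h2 := Real.rpow_nonneg (norm_nonneg ξ) p
    linarith
  · have := Real.rpow_le_rpow_of_exponent_le h (by linarith : p - 1 ≤ p)
    linarith

theorem measurable_pFlux (p : ℝ) :
    Measurable (pFlux p : EuclideanSpace ℝ (Fin N) → EuclideanSpace ℝ (Fin N)) := by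
  unfold pFlux
  exact (measurable_norm.pow_const _).smul measurable_id

theorem pFlux_smul_self {r t : ℝ} (hr : 0 < r) {x : EuclideanSpace ℝ (Fin N)} (hx : ‖x‖ = r) :
    pFlux p ((t / r) • x) = (signedRpow (p - 1) t / r) • x := by
  rw [pFlux, norm_smul, hx, Real.norm_eq_abs, abs_div, abs_of_pos hr, div_mul_cancel₀ _ hr.ne',
    smul_smul, signedRpow]
  congr 1
  rw [mul_div_assoc]
  congr 2
  ring

theorem integrableOn_pFlux (hp : 1 < p) {K : Set (EuclideanSpace ℝ (Fin N))} (hK : IsCompact K)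
    (hG : MemLp G (ENNReal.ofReal p) (volume.restrict K)) :
    IntegrableOn (fun x => pFlux p (G x)) K := by
  have h1 : IntegrableOn (fun x => 1 + ‖G x‖ ^ p) K := by
    refine (integrableOn_const hK.measure_lt_top.ne).add ?_
    have := hG.integrable_norm_rpow (by simp; linarith) ENNReal.ofReal_ne_top
    rwa [ENNReal.toReal_ofReal (by linarith)] at this
  refine h1.mono' ((measurable_pFlux p).comp_aemeasurable hG.1.aemeasurable).aestronglyMeasurable ?_
  exact Eventually.of_forall fun x => norm_pFlux_le hp _

theorem locallyIntegrableOn_pFlux (hΩ : IsOpen Ω) (hp : 1 < p)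
    (hG : ∀ K ⊆ Ω, IsCompact K → MemLp G (ENNReal.ofReal p) (volume.restrict K)) :
    LocallyIntegrableOn (fun x => pFlux p (G x)) Ω :=
  (locallyIntegrableOn_iff hΩ.isLocallyClosed).2 fun K hK hKc => integrableOn_pFlux hp hKc (hG K hK hKc)

/-- The du Bois-Reymond form of the equation on a truncated cone. -/
theorem radial_flux_ae_eq [NeZero N] (hp : 1 < p) (B : ContDiffBump v)
    (hv : ‖v‖ = 1) (ha : 0 < a) (hab : a < b) (hcone : truncatedCone v B.rOut a b ⊆ Ω)
    (hrad : ∀ x ∈ Ω, u x = f ‖x‖) (hfc : ContinuousOn f (Icc a b))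
    (hfpos : ∀ r ∈ Icc a b, 0 < f r)
    (hGp : ∀ K ⊆ Ω, IsCompact K → MemLp G (ENNReal.ofReal p) (volume.restrict K))
    (hGr : ∀ᵐ x, x ∈ Ω → ‖x‖ ∈ Ioo a b → G x = (deriv f ‖x‖ / ‖x‖) • x)
    (heq : ∀ φ, IsTestFunction Ω φ →
      ∫ x in Ω, inner ℝ (pFlux p (G x)) (gradient φ x) = ∫ x in Ω, henonSource α q u x * φ x) :
    ∃ k, ∀ᵐ r, r ∈ Ioo a b → r ^ (N - 1) * signedRpow (p - 1) (deriv f r)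
      = k + ∫ s in a..r, -(s ^ (N - 1) * (s ^ α * f s ^ q)) := by
  have hBs : ContDiff ℝ ∞ B := B.contDiff
  set s : ℝ → ℝ := fun r => signedRpow (p - 1) (deriv f r) with hs
  set β : EuclideanSpace ℝ (Fin N) → ℝ := angular B with hβ
  have hβc : ContinuousOn β {0}ᶜ := continuousOn_angular hBs
  have hsub0 : {x : EuclideanSpace ℝ (Fin N) | ‖x‖ ∈ Icc a b} ⊆ {0}ᶜ := fun x hx =>
    ne_zero_of_norm_mem_Icc ha hx
  set κ := radialDensity β 1 with hκ
  have hκ0 : 0 < κ := by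
    refine radialDensity_one_pos hβc (fun x _ => B.nonneg) hv ?_
    rw [hβ, angular_of_norm_eq_one hv]
    exact (B.pos_of_mem_ball (Metric.mem_ball_self B.rOut_pos)).ne'
  have hrdβ : ∀ r, 0 < r → radialDensity β r = r ^ (N - 1) * κ := by
    intro r hr
    rw [radialDensity_of_homogeneous (fun t ht x => angular_smul _ ht x) hr,
      finrank_euclideanSpace_fin]
  have hK := isCompact_truncatedCone v B.rOut a b
  -- The formula for the gradient is known for `|x| < b`, while the shell contains the sphere `|x| =
  -- b`, which is null.
  have hbdry : ∀ᵐ x : EuclideanSpace ℝ (Fin N), ‖x‖ ≠ b := by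
    have := Measure.addHaar_sphere (volume : Measure (EuclideanSpace ℝ (Fin N))) 0 b
    refine measure_mono_null (fun x hx => ?_) this
    simpa using hx
  have hflux : ∀ᵐ x, x ∈ shell (EuclideanSpace ℝ (Fin N)) a b → x ∈ Ω →
      pFlux p (G x) = (s ‖x‖ / ‖x‖) • x := by
    filter_upwards [hGr, hbdry] with x h1 h2 h3 h4
    have hr : ‖x‖ ∈ Ioo a b := ⟨h3.1, lt_of_le_of_ne h3.2 h2⟩
    rw [h1 h4 hr, pFlux_smul_self (ha.trans hr.1) rfl]
  have hβ0 : ∀ x ∈ shell (EuclideanSpace ℝ (Fin N)) a b, x ∉ Ω → β x = 0 := fun x hx hxΩ =>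
    angular_bump_eq_zero B (ne_zero_of_norm_mem_Icc ha ⟨hx.1.le, hx.2⟩) hx.1.le hx.2
      fun h => hxΩ (hcone h)
  -- On the cone `|s(|x|)|` is the norm of the flux, integrable because the gradient is in `L^p` on
  -- compact sets.
  have hsi : IntegrableOn (fun x => s ‖x‖ * β x) (shell (EuclideanSpace ℝ (Fin N)) a b) := by
    have h1 : IntegrableOn (fun x => ‖pFlux p (G x)‖) (truncatedCone v B.rOut a b) :=
      (integrableOn_pFlux hp hK (hGp _ hcone hK)).norm
    have h2 := integrableOn_shell_angular_mul B ha h1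
    have hm : AEStronglyMeasurable (fun x => s ‖x‖ * β x)
        (volume.restrict (shell (EuclideanSpace ℝ (Fin N)) a b)) := by
      refine AEStronglyMeasurable.mul ?_ ?_
      · exact (((continuous_signedRpow (by linarith)).measurable.comp
          (measurable_deriv f)).comp measurable_norm).aestronglyMeasurable
      · exact (hβc.mono fun x hx => hsub0 ⟨hx.1.le, hx.2⟩).aestronglyMeasurable
          (measurableSet_shell a b)
    refine Integrable.mono h2 hm ?_
    rw [ae_restrict_iff' (measurableSet_shell a b)]
    filter_upwards [hflux] with x hx hxs
    by_cases hxΩ : x ∈ Ω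
    · have h0 : 0 < ‖x‖ := ha.trans hxs.1
      rw [hx hxs hxΩ, norm_mul, norm_mul, norm_norm, norm_smul, norm_div, norm_norm,
        div_mul_cancel₀ _ h0.ne', mul_comm]
    · rw [hβ0 x hxs hxΩ, mul_zero, norm_zero]
      exact norm_nonneg _
  have hsr := (shell_integral ha.le hab.le hsi).1
  set Hs : ℝ → ℝ := fun r => r ^ (N - 1) * (r ^ α * f r ^ q) with hHs
  have hHsc : ContinuousOn (fun r => r ^ α * f r ^ q) (uIcc a b) := by
    rw [uIcc_of_le hab.le]
    refine ContinuousOn.mul (continuousOn_id.rpow_const fun r hr => Or.inl (ha.trans_le hr.1).ne') ?_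
    exact hfc.rpow_const fun r hr => Or.inl (hfpos r hr).ne'
  have hHsi : IntervalIntegrable (fun r => r ^ α * f r ^ q) volume a b := hHsc.intervalIntegrable
  have hpc : Continuous fun r : ℝ => r ^ (N - 1) := by fun_prop
  have hsmul : IntervalIntegrable (fun r => r ^ (N - 1) * s r) volume a b := by
    refine (hsr.const_mul κ⁻¹).congr fun r hr => ?_
    rw [uIoc_of_le hab.le] at hr
    simp only
    rw [radialDensity_norm_mul s β (ha.trans hr.1).le, hrdβ r (ha.trans hr.1)]
    field_simp
  refine ae_eq_const_add_integral hab hsmul (hHsi.continuousOn_mul hpc.continuousOn).neg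
    fun A hA hAc hAs => ?_
  have hφ := isTestFunction_norm_mul_angular B ha hcone hA hAs
  have hA1 : Continuous (deriv A) := hA.continuous_deriv (by simp)
  set φ : EuclideanSpace ℝ (Fin N) → ℝ := fun x => A ‖x‖ * β x with hφdef
  have hid := heq φ hφ
  have hφs : IsTestFunction {x : EuclideanSpace ℝ (Fin N) | ‖x‖ ∈ Ioo a b} φ := by
    refine ⟨hφ.smooth, hφ.compactSupport, ?_⟩
    have h1 : tsupport φ ⊆ (fun x => ‖x‖) ⁻¹' tsupport A := by
      refine closure_minimal (fun x hx => subset_tsupport A fun h => hx ?_)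
        ((isClosed_tsupport A).preimage continuous_norm)
      simp only [hφdef, h, zero_mul]
    exact h1.trans (preimage_mono hAs)
  rw [setIntegral_eq_integral_of_forall_compl_eq_zero fun x hx => by
      rw [hφ.gradient_eq_zero_of_notMem hx, inner_zero_right],
    setIntegral_eq_integral_of_forall_compl_eq_zero fun x hx => by
      rw [hφ.eq_zero_of_notMem hx, mul_zero],
    ← setIntegral_shell_of_eq_zero (a := a) (b := b) fun x hx => by
      rw [hφs.gradient_eq_zero_of_notMem hx, inner_zero_right],
    ← setIntegral_shell_of_eq_zero (a := a) (b := b) fun x hx => by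
      rw [hφs.eq_zero_of_notMem hx, mul_zero]] at hid
  -- The flux is parallel to `x`, so only this radial derivative enters the equation, and the
  -- angular factor remains undifferentiated.
  have hgrad : ∀ x : EuclideanSpace ℝ (Fin N), x ≠ 0 → fderiv ℝ φ x x = ‖x‖ * (deriv A ‖x‖ * β x) := by
    intro x hx
    rw [(hasFDerivAt_norm_mul_angular hBs hx ((hA.differentiable (by simp)) _).hasDerivAt).fderiv]
    simp only [add_apply, smul_apply, innerSL_apply_apply, smul_eq_mul, fderiv_angular_self hBs hx,
      real_inner_self_eq_norm_sq]
    have := norm_ne_zero_iff.2 hx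
    field_simp
    ring
  have hL : ∫ x in shell (EuclideanSpace ℝ (Fin N)) a b, inner ℝ (pFlux p (G x)) (gradient φ x)
      = ∫ x in shell (EuclideanSpace ℝ (Fin N)) a b, (deriv A ‖x‖) * (s ‖x‖ * β x) := by
    refine setIntegral_congr_ae (measurableSet_shell a b) ?_
    filter_upwards [hflux] with x hx hxs
    have hr : 0 < ‖x‖ := ha.trans hxs.1
    by_cases hxΩ : x ∈ Ω
    · rw [hx hxs hxΩ, inner_smul_left, inner_gradient_eq', hgrad x (norm_pos_iff.1 hr)]
      simp only [conj_trivial]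
      field_simp
    · rw [hφ.gradient_eq_zero_of_notMem hxΩ, inner_zero_right, hβ0 x hxs hxΩ, mul_zero, mul_zero]
  have hR : ∫ x in shell (EuclideanSpace ℝ (Fin N)) a b, henonSource α q u x * φ x
      = ∫ x in shell (EuclideanSpace ℝ (Fin N)) a b, ((‖x‖ ^ α * f ‖x‖ ^ q) * A ‖x‖) * β x := by
    refine setIntegral_congr_fun (measurableSet_shell a b) fun x hxs => ?_
    simp only [henonSource, hφdef]
    by_cases hxΩ : x ∈ Ω
    · rw [hrad x hxΩ]
      ring
    · rw [hβ0 x hxs hxΩ]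
      ring
  have i1 : IntegrableOn (fun x => (deriv A ‖x‖ * s ‖x‖) * β x)
      (shell (EuclideanSpace ℝ (Fin N)) a b) := by
    have hbd : ∃ C, ∀ r, ‖deriv A r‖ ≤ C :=
      hA1.bounded_above_of_compact_support hAc.deriv
    obtain ⟨C, hC⟩ := hbd
    have : IntegrableOn (fun x => (deriv A ‖x‖) * (s ‖x‖ * β x))
        (shell (EuclideanSpace ℝ (Fin N)) a b) :=
      hsi.bdd_mul (hA1.comp continuous_norm).aestronglyMeasurable
        (Eventually.of_forall fun x => hC _)
    simpa only [mul_assoc] using this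
  have i2 : IntegrableOn (fun x => ((‖x‖ ^ α * f ‖x‖ ^ q) * A ‖x‖) * β x)
      (shell (EuclideanSpace ℝ (Fin N)) a b) :=
    integrableOn_shell_norm_smul (h := fun r => (r ^ α * f r ^ q) * A r)
      (hHsi.mul_continuousOn hA.continuous.continuousOn) (hβc.mono hsub0)
  simp only [← mul_assoc (deriv A _)] at hL
  rw [hL, hR, integral_shell_norm_mul (h := fun r => deriv A r * s r) ha.le hab.le i1,
    integral_shell_norm_mul (h := fun r => (r ^ α * f r ^ q) * A r) ha.le hab.le i2] at hid
  have e1 : ∫ r in a..b, deriv A r * s r * radialDensity β r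
      = κ * ∫ r in a..b, r ^ (N - 1) * s r * deriv A r := by
    rw [← intervalIntegral.integral_const_mul]
    refine intervalIntegral.integral_congr fun r hr => ?_
    rw [uIcc_of_le hab.le] at hr
    simp only
    rw [hrdβ r (ha.trans_le hr.1)]
    ring
  have e2 : ∫ r in a..b, r ^ α * f r ^ q * A r * radialDensity β r
      = κ * ∫ r in a..b, Hs r * A r := by
    rw [← intervalIntegral.integral_const_mul]
    refine intervalIntegral.integral_congr fun r hr => ?_
    rw [uIcc_of_le hab.le] at hr
    simp only [hHs]
    rw [hrdβ r (ha.trans_le hr.1)]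
    ring
  rw [e1, e2] at hid
  rw [mul_left_cancel₀ hκ0.ne' hid]
  simp only [hHs, neg_mul, intervalIntegral.integral_neg, neg_neg]

/-- Inverting the signed power shows that `f'` agrees almost everywhere with a continuous `g`.
Absolute continuity makes `f` the primitive of `g`, so the identity holds at every point and can be
differentiated. -/
theorem classical_of_radial_flux_ae_eq (hp : 1 < p) (ha : 0 < a) (hab : a < b)
    (hf : AbsolutelyContinuousOnInterval f a b) {H : ℝ → ℝ} (hH : ContinuousOn H (Icc a b)) {k : ℝ}
    (hk : ∀ᵐ r, r ∈ Ioo a b → r ^ (N - 1) * signedRpow (p - 1) (deriv f r)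
      = k + ∫ s in a..r, H s) :
    ContinuousOn (deriv f) (Ioo a b) ∧ ∀ r ∈ Ioo a b, DifferentiableAt ℝ f r ∧
      HasDerivAt (fun s => s ^ (N - 1) * signedRpow (p - 1) (deriv f s)) (H r) r := by
  have hm : 0 < p - 1 := by linarith
  set M : ℝ → ℝ := fun r => k + ∫ s in a..r, H s with hM
  have hHi : IntervalIntegrable H volume a b := by
    refine ContinuousOn.intervalIntegrable ?_
    rwa [uIcc_of_le hab.le]
  have hHcat : ∀ r ∈ Ioo a b, ContinuousAt H r := fun r hr =>
    hH.continuousAt (Icc_mem_nhds hr.1 hr.2)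
  have hMd : ∀ r ∈ Ioo a b, HasDerivAt M (H r) r := by
    intro r hr
    refine (intervalIntegral.integral_hasDerivAt_right (hHi.mono_set ?_) ?_ (hHcat r hr)).const_add k
    · rw [uIcc_of_le hr.1.le, uIcc_of_le hab.le]
      exact Icc_subset_Icc le_rfl hr.2.le
    · exact ContinuousOn.stronglyMeasurableAtFilter isOpen_Ioo
        (hH.mono Ioo_subset_Icc_self) r hr
  set g : ℝ → ℝ := fun r => signedRpow (1 / (p - 1)) (M r / r ^ (N - 1)) with hg
  have hMc : ContinuousOn M (Icc a b) := by
    have := intervalIntegral.continuousOn_primitive_interval' hHi left_mem_uIcc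
    rw [uIcc_of_le hab.le] at this
    exact continuousOn_const.add this
  have hgc : ContinuousOn g (Icc a b) :=
    (continuous_signedRpow (by positivity)).comp_continuousOn
      (hMc.div (by fun_prop) fun r hr => (pow_pos (ha.trans_le hr.1) _).ne')
  have hgi : IntervalIntegrable g volume a b := by
    refine ContinuousOn.intervalIntegrable ?_
    rwa [uIcc_of_le hab.le]
  have hfg : ∀ᵐ r, r ∈ Ioo a b → deriv f r = g r := by
    filter_upwards [hk] with r hr hr'
    have h0 : 0 < r ^ (N - 1) := pow_pos (ha.trans hr'.1) _
    simp only [hg, hM]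
    rw [← hr hr', mul_div_cancel_left₀ _ h0.ne', signedRpow_signedRpow hm]
  have hfi : ∀ r ∈ Ioo a b, f r = f a + ∫ s in a..r, g s := by
    intro r hr
    have hsub : uIcc a r ⊆ uIcc a b := by
      rw [uIcc_of_le hr.1.le, uIcc_of_le hab.le]
      exact Icc_subset_Icc le_rfl hr.2.le
    have h1 := (hf.mono hsub).integral_deriv_eq_sub
    rw [← intervalIntegral.integral_congr_ae (f := deriv f), h1]
    · ring
    · filter_upwards [hfg] with s hs hs'
      rw [uIoc_of_le hr.1.le] at hs'
      exact hs ⟨hs'.1, hs'.2.trans_lt hr.2⟩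
  have hfd : ∀ r ∈ Ioo a b, HasDerivAt f (g r) r := by
    intro r hr
    have h1 : HasDerivAt (fun r => f a + ∫ s in a..r, g s) (g r) r := by
      refine (intervalIntegral.integral_hasDerivAt_right (hgi.mono_set ?_) ?_
        (hgc.continuousAt (Icc_mem_nhds hr.1 hr.2))).const_add (f a)
      · rw [uIcc_of_le hr.1.le, uIcc_of_le hab.le]
        exact Icc_subset_Icc le_rfl hr.2.le
      · exact ContinuousOn.stronglyMeasurableAtFilter isOpen_Ioo
          (hgc.mono Ioo_subset_Icc_self) r hr
    refine h1.congr_of_eventuallyEq ?_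
    filter_upwards [isOpen_Ioo.mem_nhds hr] with s hs using hfi s hs
  have hder : ∀ r ∈ Ioo a b, deriv f r = g r := fun r hr => (hfd r hr).deriv
  refine ⟨(hgc.mono Ioo_subset_Icc_self).congr hder, fun r hr =>
    ⟨(hfd r hr).differentiableAt, (hMd r hr).congr_of_eventuallyEq ?_⟩⟩
  filter_upwards [isOpen_Ioo.mem_nhds hr] with s hs
  have h0 : 0 < s ^ (N - 1) := pow_pos (ha.trans hs.1) _
  have h1 := signedRpow_signedRpow (s := 1 / (p - 1)) (by positivity) (M s / s ^ (N - 1))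
  rw [one_div_one_div] at h1
  rw [hder s hs]
  simp only [hg]
  rw [h1, mul_div_cancel₀ _ h0.ne']

/-- Local regularity: a positive radial weak solution is classical in the radial variable. -/
theorem exists_radial_regularity [NeZero N] (hp : 1 < p) (hΩ : IsOpen Ω)
    (hpos : ∀ x ∈ Ω, 0 < u x) (hrad : ∀ x ∈ Ω, u x = f ‖x‖) (huc : ContinuousOn u Ω)
    (hG : IsWeakGradient Ω u G)
    (hGp : ∀ K ⊆ Ω, IsCompact K → MemLp G (ENNReal.ofReal p) (volume.restrict K))
    (heq : ∀ φ, IsTestFunction Ω φ →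
      ∫ x in Ω, inner ℝ (pFlux p (G x)) (gradient φ x) = ∫ x in Ω, henonSource α q u x * φ x)
    {x₀ : EuclideanSpace ℝ (Fin N)} (hx₀ : x₀ ∈ Ω) (h0 : x₀ ≠ 0) :
    ∃ a b, 0 < a ∧ a < ‖x₀‖ ∧ ‖x₀‖ < b ∧ ContinuousOn (deriv f) (Ioo a b) ∧
      (∀ r ∈ Ioo a b, DifferentiableAt ℝ f r ∧
        HasDerivAt (fun s => s ^ (N - 1) * signedRpow (p - 1) (deriv f s))
          (-(r ^ (N - 1) * (r ^ α * f r ^ q))) r) ∧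
      ∀ᵐ x, x ∈ Ω → ‖x‖ ∈ Ioo a b → G x = (deriv f ‖x‖ / ‖x‖) • x := by
  obtain ⟨a, b, δ, ha, hax, hxb, hδ, hδ2, hcone⟩ := exists_truncatedCone_subset hΩ hx₀ h0
  have hab := hax.trans hxb
  set v := ‖x₀‖⁻¹ • x₀ with hv
  have hv1 : ‖v‖ = 1 := norm_smul_inv_norm (𝕜 := ℝ) h0
  -- Only the outer radius matters: it must be the opening `δ` of the cone contained in `Ω`.
  let B : ContDiffBump v := ⟨δ / 2, δ, by positivity, by linarith⟩
  have hcone' : truncatedCone v B.rOut a b ⊆ Ω := hcone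
  have hfc := continuousOn_radial_profile hv1 hδ.le ha.le hcone huc hrad
  have hfpos : ∀ r ∈ Icc a b, 0 < f r := by
    intro r hr
    have h1 := hcone (smul_mem_truncatedCone hv1 hδ.le ha.le hr)
    have h2 := hpos _ h1
    rwa [hrad _ h1, norm_smul, hv1, mul_one, Real.norm_of_nonneg (ha.le.trans hr.1)] at h2
  have hAC := radial_absolutelyContinuous B hδ2 hv1 ha hab hcone' huc hrad hG
  have hGr := radialGradient_ae_eq hΩ ha hab hAC hrad hG
  obtain ⟨k, hk⟩ := radial_flux_ae_eq hp B hv1 ha hab hcone' hrad hfc hfpos hGp hGr heq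
  have hH : ContinuousOn (fun s => -(s ^ (N - 1) * (s ^ α * f s ^ q))) (Icc a b) := by
    refine ((continuousOn_pow _).mul ((continuousOn_id.rpow_const fun r hr =>
      Or.inl (ha.trans_le hr.1).ne').mul (hfc.rpow_const fun r hr => Or.inl (hfpos r hr).ne'))).neg
  obtain ⟨h1, h2⟩ := classical_of_radial_flux_ae_eq hp ha hab hAC hH hk
  exact ⟨a, b, ha, hax, hxb, h1, h2, hGr⟩

/-- A positive radial weak solution in an open set away from the origin has gradient
`f'(|x|) x / |x|`. -/
theorem radialGradient_ae_eq_of_solution [NeZero N] (hp : 1 < p) (hΩ : IsOpen Ω)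
    (h0 : ∀ x ∈ Ω, x ≠ 0)
    (hpos : ∀ x ∈ Ω, 0 < u x) (hrad : ∀ x ∈ Ω, u x = f ‖x‖) (huc : ContinuousOn u Ω)
    (hG : IsWeakGradient Ω u G)
    (hGp : ∀ K ⊆ Ω, IsCompact K → MemLp G (ENNReal.ofReal p) (volume.restrict K))
    (heq : ∀ φ, IsTestFunction Ω φ →
      ∫ x in Ω, inner ℝ (pFlux p (G x)) (gradient φ x) = ∫ x in Ω, henonSource α q u x * φ x) :
    ∀ᵐ x, x ∈ Ω → G x = (deriv f ‖x‖ / ‖x‖) • x := by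
  have key : volume {x | x ∈ Ω ∧ G x ≠ (deriv f ‖x‖ / ‖x‖) • x} = 0 := by
    -- The regularity is local around each point, and a set which is null near each of its points is
    -- null.
    refine measure_null_of_locally_null _ fun x hx => ?_
    obtain ⟨a, b, _, hax, hxb, -, -, hae⟩ :=
      exists_radial_regularity hp hΩ hpos hrad huc hG hGp heq hx.1 (h0 x hx.1)
    refine ⟨{y | ‖y‖ ∈ Ioo a b} ∩ {x | x ∈ Ω ∧ G x ≠ (deriv f ‖x‖ / ‖x‖) • x},
      inter_comm _ _ ▸ inter_mem_nhdsWithin _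
        ((isOpen_Ioo.preimage continuous_norm).mem_nhds ⟨hax, hxb⟩), ?_⟩
    refine measure_mono_null (fun y hy => ?_) hae
    simp only [mem_compl_iff]
    exact fun h => hy.2.2 (h hy.2.1 hy.1)
  refine measure_mono_null (fun x hx => ?_) key
  simpa using hx

end RadialSolution

/-! ### The radial profile near the origin and its flux -/

/-- The flux `-r^{N-1} |f'|^{p-2} f'` of a radial function through the sphere of radius `r`, up to
the factor `ω_{N-1}`. -/
noncomputable def radialFlux (N : ℕ) (p : ℝ) (f : ℝ → ℝ) (r : ℝ) : ℝ :=
  -(r ^ (N - 1) * signedRpow (p - 1) (deriv f r))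

/-- `f` is a positive classical solution of the radial equation on `(0, R)`. -/
structure IsRadialProfile (N : ℕ) (p α q R : ℝ) (f : ℝ → ℝ) : Prop where
  pos : ∀ r ∈ Ioo 0 R, 0 < f r
  differentiableAt : ∀ r ∈ Ioo 0 R, DifferentiableAt ℝ f r
  flux_deriv : ∀ r ∈ Ioo 0 R, HasDerivAt (radialFlux N p f) (r ^ (N - 1) * (r ^ α * f r ^ q)) r

/-- The functions `g ∓ (C/l) e^{-lt}` are monotone in opposite directions, and both tend to `ℓ`. -/
theorem abs_sub_le_of_exp_decay {g g' : ℝ → ℝ} {T l C ℓ : ℝ} (hl : 0 < l)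
    (hg : ∀ t, T < t → HasDerivAt g (g' t) t) (hC : ∀ t, T < t → |g' t| ≤ C * Real.exp (-(l * t)))
    (hℓ : Tendsto g atTop (𝓝 ℓ)) {t : ℝ} (ht : T < t) :
    |g t - ℓ| ≤ C / l * Real.exp (-(l * t)) := by
  have he : Tendsto (fun t => C / l * Real.exp (-(l * t))) atTop (𝓝 0) := by
    have h1 : Tendsto (fun t => Real.exp (-(l * t))) atTop (𝓝 0) :=
      Real.tendsto_exp_atBot.comp (tendsto_neg_atTop_atBot.comp (tendsto_id.const_mul_atTop hl))
    simpa using h1.const_mul (C / l)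
  have hed : ∀ t, HasDerivAt (fun t => C / l * Real.exp (-(l * t))) (-(C * Real.exp (-(l * t)))) t := by
    intro t
    refine ((((hasDerivAt_id t).const_mul l).neg.exp).const_mul (C / l)).congr_deriv ?_
    simp only [id, Pi.neg_apply, mul_one]
    field_simp
  have hmono : MonotoneOn (fun t => g t - C / l * Real.exp (-(l * t))) (Ioi T) :=
    monotoneOn_Ioi_of_hasDerivAt_nonneg (fun t ht => (hg t ht).sub (hed t)) fun t ht => by
      have := neg_le_of_abs_le (hC t ht)
      linarith
  have hanti : AntitoneOn (fun t => g t + C / l * Real.exp (-(l * t))) (Ioi T) :=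
    antitoneOn_Ioi_of_hasDerivAt_nonpos (fun t ht => (hg t ht).add (hed t)) fun t ht => by
      have := le_of_abs_le (hC t ht)
      linarith
  have h1 : g t - C / l * Real.exp (-(l * t)) ≤ ℓ - 0 := by
    refine ge_of_tendsto (hℓ.sub he) ?_
    filter_upwards [eventually_ge_atTop t] with s hs using hmono ht (ht.trans_le hs) hs
  have h2 : ℓ + 0 ≤ g t + C / l * Real.exp (-(l * t)) := by
    refine le_of_tendsto (hℓ.add he) ?_
    filter_upwards [eventually_ge_atTop t] with s hs using hanti ht (ht.trans_le hs) hs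
  rw [abs_le]
  constructor <;> linarith

theorem hasDerivAt_comp_exp_neg {g : ℝ → ℝ} {g' t : ℝ} (h : HasDerivAt g g' (Real.exp (-t))) :
    HasDerivAt (fun s => g (Real.exp (-s))) (-(Real.exp (-t) * g')) t := by
  have h1 : HasDerivAt (fun s : ℝ => Real.exp (-s)) (-Real.exp (-t)) t := by
    refine ((hasDerivAt_id t).neg.exp).congr_deriv ?_
    simp
  refine (h.comp t h1).congr_deriv ?_
  ring

namespace IsRadialProfile

variable {N : ℕ} {p α q R : ℝ} {f : ℝ → ℝ}

theorem exp_neg_mem (hR : 0 < R) {t : ℝ} (ht : -Real.log R < t) : Real.exp (-t) ∈ Ioo 0 R := by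
  refine ⟨Real.exp_pos _, ?_⟩
  rw [← Real.lt_log_iff_exp_lt hR]
  linarith

theorem tendsto_exp_neg : Tendsto (fun t : ℝ => Real.exp (-t)) atTop (𝓝[>] 0) :=
  tendsto_nhdsWithin_iff.2 ⟨Real.tendsto_exp_neg_atTop_nhds_zero,
    Eventually.of_forall fun _ => Real.exp_pos _⟩

theorem strictMonoOn_flux (h : IsRadialProfile N p α q R f) :
    StrictMonoOn (radialFlux N p f) (Ioo 0 R) := by
  refine strictMonoOn_of_deriv_pos (convex_Ioo 0 R)
    (fun r hr => (h.flux_deriv r hr).continuousAt.continuousWithinAt) fun r hr => ?_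
  rw [interior_Ioo] at hr
  rw [(h.flux_deriv r hr).deriv]
  have := h.pos r hr
  have := hr.1
  positivity

theorem deriv_eq (hp : 1 < p) {r : ℝ} (hr : 0 < r) :
    deriv f r = signedRpow (1 / (p - 1)) (-(radialFlux N p f r / r ^ (N - 1))) := by
  have h0 : 0 < r ^ (N - 1) := pow_pos hr _
  rw [radialFlux, neg_div, neg_neg, mul_div_cancel_left₀ _ h0.ne',
    signedRpow_signedRpow (by linarith)]

theorem pow_rpow_inv (hN : 1 ≤ N) (hp : 1 < p) {r : ℝ} (hr : 0 < r) :
    (r ^ (N - 1)) ^ (1 / (p - 1)) = r ^ ((N - p) / (p - 1)) * r := by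
  have : p - 1 ≠ 0 := by linarith
  rw [← Real.rpow_natCast, ← Real.rpow_mul hr.le, ← Real.rpow_add_one hr.ne', Nat.cast_sub hN,
    Nat.cast_one]
  congr 1
  field_simp
  ring

/-- The flux increases strictly with `r`. If it were nonpositive somewhere, it would be below a
negative constant `-k` near `0`; then `f(e^{-t})` would decrease at least linearly in `t`,
contradicting positivity. -/
theorem radialFlux_pos (h : IsRadialProfile N p α q R f) (hp : 1 < p) (hpN : p < N) {r : ℝ}
    (hr : r ∈ Ioo 0 R) : 0 < radialFlux N p f r := by
  have hm : 0 < p - 1 := by linarith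
  have hN : 1 ≤ N := by
    have : (1 : ℝ) < N := hp.trans hpN
    exact_mod_cast this.le
  have hR : 0 < R := hr.1.trans hr.2
  by_contra! hle
  have hr2 : r / 2 ∈ Ioo 0 R := ⟨by linarith [hr.1], by linarith [hr.1, hr.2]⟩
  have hlt : radialFlux N p f (r / 2) < 0 :=
    (h.strictMonoOn_flux hr2 hr (by linarith [hr.1])).trans_le hle
  set k := -radialFlux N p f (r / 2) with hk
  have hk0 : 0 < k := by linarith
  set β := (N - p) / (p - 1) with hβ
  have hβ0 : 0 < β := div_pos (by linarith) hm
  have hbot : Tendsto (fun t => f (Real.exp (-t))) atTop atBot := by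
    refine tendsto_atBot_of_hasDerivAt_le (k := k ^ (1 / (p - 1))) (by positivity)
      (f' := fun t => -(Real.exp (-t) * deriv f (Real.exp (-t)))) ?_ ?_
    · filter_upwards [eventually_gt_atTop (-Real.log R)] with t ht
      exact hasDerivAt_comp_exp_neg (h.differentiableAt _ (exp_neg_mem hR ht)).hasDerivAt
    · filter_upwards [eventually_gt_atTop (-Real.log (r / 2)), eventually_ge_atTop 0] with t ht ht0
      have hs := exp_neg_mem hr2.1 ht
      set s := Real.exp (-t) with hsdef
      have hs1 : s ≤ 1 := by
        rw [hsdef, Real.exp_le_one_iff]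
        linarith
      have hs0 : 0 < s := hs.1
      have hW : k < -radialFlux N p f s := by
        have := h.strictMonoOn_flux ⟨hs.1, hs.2.trans hr2.2⟩ hr2 hs.2
        linarith
      rw [neg_le_neg_iff, deriv_eq (N := N) hp hs0, ← neg_div,
        signedRpow_of_pos (div_pos (hk0.trans hW) (by positivity)),
        Real.div_rpow (hk0.trans hW).le (by positivity), pow_rpow_inv hN hp hs0]
      have h1 : k ^ (1 / (p - 1)) ≤ (-radialFlux N p f s) ^ (1 / (p - 1)) :=
        Real.rpow_le_rpow hk0.le hW.le (by positivity)
      have h2 : s ^ β ≤ 1 := Real.rpow_le_one hs0.le hs1 hβ0.le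
      have h3 : 0 < s ^ β := by positivity
      have h4 : s * ((-radialFlux N p f s) ^ (1 / (p - 1)) / (s ^ β * s))
          = (-radialFlux N p f s) ^ (1 / (p - 1)) / s ^ β := by
        field_simp
      rw [h4]
      exact h1.trans (le_div_self ((Real.rpow_nonneg hk0.le _).trans h1) h3 h2)
  obtain ⟨t, h1, h2⟩ := ((hbot.eventually (eventually_lt_atBot 0)).and
    (eventually_gt_atTop (-Real.log R))).exists
  exact (h.pos _ (exp_neg_mem hR h2)).not_gt h1

theorem deriv_eq_neg (h : IsRadialProfile N p α q R f) (hp : 1 < p) (hpN : p < N) {r : ℝ}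
    (hr : r ∈ Ioo 0 R) :
    deriv f r = -(radialFlux N p f r ^ (1 / (p - 1)) / (r ^ ((N - p) / (p - 1)) * r)) := by
  have hN : 1 ≤ N := by
    have : (1 : ℝ) < N := hp.trans hpN
    exact_mod_cast this.le
  have hW := h.radialFlux_pos hp hpN hr
  have h0 : 0 < r ^ (N - 1) := pow_pos hr.1 _
  rw [deriv_eq (N := N) hp hr.1, signedRpow_neg, signedRpow_of_pos (div_pos hW h0),
    Real.div_rpow hW.le h0.le, pow_rpow_inv hN hp hr.1]

/-- The Jacobian of `r = e^{-t}` raises `r^{N-1+α}` to `r^{N+α}`, and `(r^{N-1})^{1/(p-1)} = r^β r`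
leaves the factor `e^{βt}` in `F'`. The condition `βm < θ` is `-p < α`. -/
theorem emdenFowler (h : IsRadialProfile N p α q R f) (hp : 1 < p) (hpN : p < N) (hR : 0 < R)
    (hq : p - 1 < q) (hα : -p < α) :
    EmdenFowler (p - 1) ((N - p) / (p - 1)) (N + α) q (-Real.log R)
      (fun t => f (Real.exp (-t))) (fun t => radialFlux N p f (Real.exp (-t))) := by
  have hm : 0 < p - 1 := by linarith
  have hN : 1 ≤ N := by
    have : (1 : ℝ) < N := hp.trans hpN
    exact_mod_cast this.le
  refine ⟨hm, div_pos (by linarith) hm, hq, ?_, fun t ht => h.pos _ (exp_neg_mem hR ht),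
    fun t ht => h.radialFlux_pos hp hpN (exp_neg_mem hR ht), fun t ht => ?_, fun t ht => ?_⟩
  · rw [div_mul_cancel₀ _ hm.ne']
    linarith
  · have hr := exp_neg_mem hR ht
    refine (hasDerivAt_comp_exp_neg (h.differentiableAt _ hr).hasDerivAt).congr_deriv ?_
    rw [h.deriv_eq_neg hp hpN hr]
    have h1 : Real.exp (-t) ^ (((N : ℝ) - p) / (p - 1))
        = (Real.exp (((N : ℝ) - p) / (p - 1) * t))⁻¹ := by
      rw [← Real.exp_mul, ← Real.exp_neg]
      congr 1
      ring
    rw [h1]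
    have := Real.exp_pos (-t)
    have := Real.exp_pos (((N : ℝ) - p) / (p - 1) * t)
    field_simp
  · have hr := exp_neg_mem hR ht
    refine (hasDerivAt_comp_exp_neg (h.flux_deriv _ hr)).congr_deriv ?_
    have h1 : Real.exp (-t) * (Real.exp (-t) ^ (N - 1) * (Real.exp (-t) ^ α * f (Real.exp (-t)) ^ q))
        = (Real.exp (-t) ^ (N - 1) * Real.exp (-t)) * Real.exp (-t) ^ α * f (Real.exp (-t)) ^ q := by
      ring
    rw [h1, ← pow_succ, Nat.sub_add_cancel hN, ← Real.rpow_natCast, ← Real.rpow_add hr.1,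
      ← Real.exp_mul]
    congr 3
    ring

theorem tendsto_nhdsGT_of_tendsto_exp_neg {g : ℝ → ℝ} {l : Filter ℝ}
    (hg : Tendsto (fun t => g (Real.exp (-t))) atTop l) : Tendsto g (𝓝[>] 0) l := by
  have h1 : Tendsto (fun r => -Real.log r) (𝓝[>] 0) atTop :=
    tendsto_neg_atBot_atTop.comp Real.tendsto_log_nhdsGT_zero
  refine (hg.comp h1).congr' ?_
  filter_upwards [self_mem_nhdsWithin] with r hr
  simp only [Function.comp_apply, neg_neg]
  rw [Real.exp_log hr]

theorem exists_lt_of_eventually_atTop {P : ℝ → Prop} (hR : 0 < R)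
    (hP : ∀ᶠ t in atTop, P (Real.exp (-t))) : ∃ ρ, 0 < ρ ∧ ρ < R ∧ ∀ r, 0 < r → r < ρ → P r := by
  obtain ⟨T, h1, h2⟩ := eventually_atTop_gt hP (-Real.log R + 1)
  refine ⟨Real.exp (-T), Real.exp_pos _, (exp_neg_mem hR (by linarith)).2, fun r hr hrT => ?_⟩
  have := h2 (-Real.log r) (by
    rw [← Real.log_lt_iff_lt_exp hr] at hrT
    linarith)
  rwa [neg_neg, Real.exp_log hr] at this

/-- Decay of a bounded profile without flux at the origin. -/
theorem bounded_decay (h : IsRadialProfile N p α q R f) (hp : 1 < p) (hpN : p < N) (hR : 0 < R)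
    (hq : p - 1 < q) (hα : -p < α) (hW : Tendsto (radialFlux N p f) (𝓝[>] 0) (𝓝 0))
    (hB : ∃ B, ∀ᶠ t in atTop, f (Real.exp (-t)) ≤ B) :
    ∃ L C ρ, 0 < L ∧ 0 < C ∧ 0 < ρ ∧ ρ < R ∧ ∀ r, 0 < r → r < ρ →
      f r ≤ L ∧ |deriv f r| ≤ C * r ^ ((α + 1) / (p - 1)) ∧
      |f r - L| ≤ C * r ^ ((α + 1) / (p - 1) + 1) := by
  have hm : 0 < p - 1 := by linarith
  have hE := h.emdenFowler hp hpN hR hq hα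
  have hθ := hE.θ_pos
  have hq0 := hE.q_pos
  set F : ℝ → ℝ := fun t => f (Real.exp (-t)) with hF
  set w : ℝ → ℝ := fun t => radialFlux N p f (Real.exp (-t)) with hw
  set T := -Real.log R with hT
  have hmono := hE.monotoneOn_F
  obtain ⟨B, hB⟩ := hB
  have hFB : ∀ t, T < t → F t ≤ B := by
    intro t ht
    obtain ⟨s, hs1, hs2⟩ := (hB.and (eventually_ge_atTop t)).exists
    exact (hmono ht (ht.trans_le hs2) hs2).trans hs1
  obtain ⟨c, hc1, hc2, hc3⟩ := exists_tendsto_of_antitoneOn_Ioi (f := fun t => -F t) (T := T)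
    (b := -B) (fun s hs t ht hst => neg_le_neg (hmono hs ht hst)) fun t ht => neg_le_neg (hFB t ht)
  have hL : Tendsto F atTop (𝓝 (-c)) := by simpa using hc3.neg
  set L := -c with hLdef
  have hFL : ∀ t, T < t → F t ≤ L := fun t ht => by
    have := hc2 t ht
    linarith
  have hL0 : 0 < L := (hE.F_pos (T + 1) (by linarith)).trans_le (hFL _ (by linarith))
  have hw0 : Tendsto w atTop (𝓝 0) := hW.comp tendsto_exp_neg
  -- Integrate `w'` from infinity, where `w` vanishes, with `F ≤ L`.
  have hwb : ∀ t, T < t → w t ≤ L ^ q / (N + α) * Real.exp (-((N + α) * t)) := by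
    intro t ht
    have := abs_sub_le_of_exp_decay (C := L ^ q) hθ hE.w_deriv (fun s hs => ?_) hw0 ht
    · rw [sub_zero] at this
      exact (le_abs_self _).trans this
    · have hFs := hE.F_pos s hs
      rw [abs_neg, abs_of_pos (by positivity), mul_comm]
      gcongr
      exact hFL s hs
  -- The decay rate of `F'` is `(N + α)/(p - 1) - (N - p)/(p - 1) = γ + 1`. In the variable `r` this
  -- is `|f'| = O(r^γ)`, the factor `r` coming from `dr/dt = -r`.
  set γ := (α + 1) / (p - 1) with hγ
  have hγ1 : 0 < γ + 1 := by
    rw [hγ, div_add_one hm.ne']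
    exact div_pos (by linarith) hm
  set C₀ := (L ^ q / (N + α)) ^ (1 / (p - 1)) with hC₀
  have hC₀0 : 0 < C₀ := by positivity
  have hFd : ∀ t, T < t →
      |w t ^ (1 / (p - 1)) * Real.exp ((N - p) / (p - 1) * t)| ≤ C₀ * Real.exp (-((γ + 1) * t)) := by
    intro t ht
    have hwt := hE.w_pos t ht
    rw [abs_of_pos (by positivity)]
    have h1 : w t ^ (1 / (p - 1))
        ≤ (L ^ q / (N + α) * Real.exp (-((N + α) * t))) ^ (1 / (p - 1)) :=
      Real.rpow_le_rpow hwt.le (hwb t ht) (by positivity)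
    rw [Real.mul_rpow (by positivity) (by positivity), ← Real.exp_mul] at h1
    refine (mul_le_mul_of_nonneg_right h1 (Real.exp_pos _).le).trans_eq ?_
    rw [mul_assoc, ← Real.exp_add]
    congr 2
    rw [hγ]
    field_simp
    ring
  refine ⟨L, max C₀ (C₀ / (γ + 1)), R / 2, hL0, lt_max_of_lt_left hC₀0, by linarith, by linarith,
    fun r hr hrR => ?_⟩
  have ht : T < -Real.log r := neg_lt_neg (Real.log_lt_log hr (by linarith))
  have her : Real.exp (-(-Real.log r)) = r := by rw [neg_neg, Real.exp_log hr]
  have hFr : F (-Real.log r) = f r := by simp only [hF, her]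
  have hpow : Real.exp (-((γ + 1) * -Real.log r)) = r ^ (γ + 1) := by
    rw [Real.rpow_def_of_pos hr]
    congr 1
    ring
  refine ⟨hFr ▸ hFL _ ht, ?_, ?_⟩
  · have h1 := hFd _ ht
    have h2 := (hE.F_deriv _ ht).unique (hasDerivAt_comp_exp_neg
      (h.differentiableAt _ (her.symm ▸ ⟨hr, by linarith⟩)).hasDerivAt)
    rw [h2, her, abs_neg, abs_mul, abs_of_pos hr, hpow, Real.rpow_add_one hr.ne', ← mul_assoc,
      mul_comm r] at h1
    exact (le_of_mul_le_mul_right h1 hr).trans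
      (mul_le_mul_of_nonneg_right (le_max_left _ _) (by positivity))
  · have h1 := abs_sub_le_of_exp_decay hγ1 hE.F_deriv hFd hL ht
    rw [hFr, hpow] at h1
    exact h1.trans (mul_le_mul_of_nonneg_right (le_max_right _ _) (by positivity))

end IsRadialProfile

theorem isRadialProfile_of_solution {N : ℕ} [NeZero N] {Ω : Set (EuclideanSpace ℝ (Fin N))}
    {u : EuclideanSpace ℝ (Fin N) → ℝ} {f : ℝ → ℝ}
    {G : EuclideanSpace ℝ (Fin N) → EuclideanSpace ℝ (Fin N)} {p α q R : ℝ} (hp : 1 < p)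
    (hΩ : IsOpen Ω) (hpos : ∀ x ∈ Ω, 0 < u x) (hrad : ∀ x ∈ Ω, u x = f ‖x‖)
    (huc : ContinuousOn u Ω) (hG : IsWeakGradient Ω u G)
    (hGp : ∀ K ⊆ Ω, IsCompact K → MemLp G (ENNReal.ofReal p) (volume.restrict K))
    (heq : ∀ φ, IsTestFunction Ω φ →
      ∫ x in Ω, inner ℝ (pFlux p (G x)) (gradient φ x) = ∫ x in Ω, henonSource α q u x * φ x)
    (hR : ∀ x, x ≠ 0 → ‖x‖ < R → x ∈ Ω) : IsRadialProfile N p α q R f := by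
  obtain ⟨e, he⟩ := exists_norm_eq (EuclideanSpace ℝ (Fin N)) (zero_le_one' ℝ)
  have hmem : ∀ r ∈ Ioo 0 R, ‖r • e‖ = r ∧ r • e ≠ 0 ∧ r • e ∈ Ω := by
    intro r hr
    have h1 : ‖r • e‖ = r := by rw [norm_smul, he, mul_one, Real.norm_of_nonneg hr.1.le]
    have h2 : r • e ≠ 0 := norm_pos_iff.1 (h1.symm ▸ hr.1)
    exact ⟨h1, h2, hR _ h2 (h1.symm ▸ hr.2)⟩
  have hloc : ∀ r ∈ Ioo 0 R, DifferentiableAt ℝ f r ∧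
      HasDerivAt (fun s => s ^ (N - 1) * signedRpow (p - 1) (deriv f s))
          (-(r ^ (N - 1) * (r ^ α * f r ^ q))) r := by
    intro r hr
    obtain ⟨h1, h2, h3⟩ := hmem r hr
    obtain ⟨a, b, -, har, hrb, -, hd, -⟩ :=
      exists_radial_regularity hp hΩ hpos hrad huc hG hGp heq h3 h2
    rw [h1] at har hrb
    exact hd r ⟨har, hrb⟩
  refine ⟨fun r hr => ?_, fun r hr => (hloc r hr).1, fun r hr => ?_⟩
  · obtain ⟨h1, h2, h3⟩ := hmem r hr
    have := hpos _ h3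
    rwa [hrad _ h3, h1] at this
  · exact (hloc r hr).2.neg.congr_deriv (neg_neg _)

/-! ### Cutoffs at the origin -/

section Cutoff

variable {N : ℕ}

/-- A radial cutoff which vanishes for `|x| ≤ ε` and equals `1` for `|x| ≥ 2ε`. -/
noncomputable def originCutoff (ε : ℝ) (x : EuclideanSpace ℝ (Fin N)) : ℝ :=
  Real.smoothTransition (‖x‖ / ε - 1)

theorem originCutoff_eq_zero {ε : ℝ} (hε : 0 < ε) {x : EuclideanSpace ℝ (Fin N)} (hx : ‖x‖ ≤ ε) :
    originCutoff ε x = 0 :=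
  Real.smoothTransition.zero_of_nonpos (sub_nonpos.2 ((div_le_one hε).2 hx))

theorem originCutoff_eq_one {ε : ℝ} (hε : 0 < ε) {x : EuclideanSpace ℝ (Fin N)}
    (hx : 2 * ε ≤ ‖x‖) : originCutoff ε x = 1 := by
  refine Real.smoothTransition.one_of_one_le ?_
  have := (le_div_iff₀ hε).2 hx
  linarith

theorem norm_originCutoff_le (ε : ℝ) (x : EuclideanSpace ℝ (Fin N)) : ‖originCutoff ε x‖ ≤ 1 := by
  unfold originCutoff
  rw [Real.norm_of_nonneg (Real.smoothTransition.nonneg _)]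
  exact Real.smoothTransition.le_one _

theorem contDiff_originCutoff {ε : ℝ} (hε : 0 < ε) :
    ContDiff ℝ ∞ (originCutoff ε : EuclideanSpace ℝ (Fin N) → ℝ) := by
  rw [contDiff_iff_contDiffAt]
  intro x
  rcases eq_or_ne x 0 with rfl | hx
  · refine (contDiffAt_const (c := (0 : ℝ))).congr_of_eventuallyEq ?_
    filter_upwards [Metric.ball_mem_nhds (0 : EuclideanSpace ℝ (Fin N)) hε] with y hy
    exact originCutoff_eq_zero hε (mem_ball_zero_iff.1 hy).le
  · exact Real.smoothTransition.contDiffAt.comp x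
      (((contDiffAt_norm ℝ hx).div_const ε).sub contDiffAt_const)

theorem hasDerivAt_originCutoff_profile (ε r : ℝ) :
    HasDerivAt (fun r => Real.smoothTransition (r / ε - 1))
      (deriv Real.smoothTransition (r / ε - 1) / ε) r := by
  have h1 : HasDerivAt (fun r : ℝ => r / ε - 1) (1 / ε) r :=
    ((hasDerivAt_id r).div_const ε).sub_const 1
  have h2 : HasDerivAt Real.smoothTransition (deriv Real.smoothTransition (r / ε - 1)) (r / ε - 1) :=
    ((Real.smoothTransition.contDiff (n := 1)).differentiable (by simp) _).hasDerivAt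
  refine (h2.comp r h1).congr_deriv ?_
  ring

theorem fderiv_originCutoff (ε : ℝ) {x : EuclideanSpace ℝ (Fin N)} (hx : x ≠ 0)
    (y : EuclideanSpace ℝ (Fin N)) :
    fderiv ℝ (originCutoff ε) x y
      = deriv Real.smoothTransition (‖x‖ / ε - 1) / ε / ‖x‖ * inner ℝ x y := by
  have := hasFDerivAt_comp_norm hx (hasDerivAt_originCutoff_profile ε ‖x‖)
  rw [show fderiv ℝ (originCutoff ε) x = _ from this.fderiv]
  simp

theorem continuous_deriv_smoothTransition : Continuous (deriv Real.smoothTransition) :=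
  (Real.smoothTransition.contDiff (n := 1)).continuous_deriv (by simp)

theorem deriv_smoothTransition_eq_zero {t : ℝ} (ht : t ∉ Ioo 0 1) :
    deriv Real.smoothTransition t = 0 := by
  have hfd := (Real.smoothTransition.contDiff (n := 1)).differentiable (by simp)
  rcases le_or_gt t 0 with h | h
  · refine IsLocalMin.deriv_eq_zero (Eventually.of_forall fun s => ?_)
    rw [Real.smoothTransition.zero_of_nonpos h]
    exact Real.smoothTransition.nonneg s
  · have h1 : 1 ≤ t := not_lt.1 fun h' => ht ⟨h, h'⟩
    refine IsLocalMax.deriv_eq_zero (Eventually.of_forall fun s => ?_)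
    rw [Real.smoothTransition.one_of_one_le h1]
    exact Real.smoothTransition.le_one s

theorem exists_bound_deriv_smoothTransition : ∃ C, 0 ≤ C ∧ ∀ t, |deriv Real.smoothTransition t| ≤ C := by
  have hc : HasCompactSupport (deriv Real.smoothTransition) :=
    HasCompactSupport.intro (isCompact_Icc (a := (0 : ℝ)) (b := 1)) fun t ht =>
      deriv_smoothTransition_eq_zero fun h => ht ⟨h.1.le, h.2.le⟩
  obtain ⟨C, hC⟩ := continuous_deriv_smoothTransition.bounded_above_of_compact_support hc
  exact ⟨C, (norm_nonneg _).trans (hC 0), hC⟩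

theorem fderiv_originCutoff_eq_zero {ε : ℝ} (hε : 0 < ε) {x : EuclideanSpace ℝ (Fin N)}
    (hx : ‖x‖ ∉ Ioo ε (2 * ε)) : fderiv ℝ (originCutoff ε) x = 0 := by
  rcases eq_or_ne x 0 with rfl | hx0
  · refine IsLocalMin.fderiv_eq_zero (Eventually.of_forall fun y => ?_)
    rw [originCutoff_eq_zero hε (by simpa using hε.le)]
    exact Real.smoothTransition.nonneg _
  · ext y
    rw [fderiv_originCutoff ε hx0, deriv_smoothTransition_eq_zero]
    · simp
    · intro h
      refine hx ⟨?_, ?_⟩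
      · have := h.1
        rwa [sub_pos, one_lt_div hε] at this
      · have := h.2
        rw [sub_lt_iff_lt_add, div_lt_iff₀ hε] at this
        linarith

variable {Ω : Set (EuclideanSpace ℝ (Fin N))} {φ : EuclideanSpace ℝ (Fin N) → ℝ}

theorem IsTestFunction.mul_originCutoff (hφ : IsTestFunction Ω φ) {ε : ℝ} (hε : 0 < ε) :
    IsTestFunction (Ω \ {0}) (fun x => φ x * originCutoff ε x) := by
  refine ⟨hφ.smooth.mul (contDiff_originCutoff hε), hφ.compactSupport.mul_right, ?_⟩
  have h1 : tsupport (fun x => φ x * originCutoff ε x) ⊆ {x | ε ≤ ‖x‖} := by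
    refine closure_minimal (fun x hx => ?_) (isClosed_le continuous_const continuous_norm)
    by_contra hcon
    refine hx ?_
    simp only
    rw [originCutoff_eq_zero hε (not_le.1 hcon).le, mul_zero]
  refine fun x hx => ⟨hφ.support_subset (tsupport_mul_subset_left hx), fun h0 => ?_⟩
  have := h1 hx
  rw [mem_singleton_iff.1 h0, mem_ofPred_eq, norm_zero] at this
  linarith

theorem IsTestFunction.integrable_inner {V : EuclideanSpace ℝ (Fin N) → EuclideanSpace ℝ (Fin N)}
    (hφ : IsTestFunction Ω φ) (hV : LocallyIntegrableOn V Ω) :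
    Integrable fun x => inner ℝ (V x) (gradient φ x) := by
  have hg := hφ.continuous_gradient
  have hgc := hφ.compactSupport.gradient'
  have hVi : IntegrableOn V (tsupport φ) :=
    hV.integrableOn_compact_subset hφ.support_subset hφ.compactSupport
  obtain ⟨C, hC⟩ := hg.bounded_above_of_compact_support hgc
  have h1 : IntegrableOn (fun x => inner ℝ (V x) (gradient φ x)) (tsupport φ) := by
    refine Integrable.mono' (hVi.norm.mul_const C) (hVi.1.inner hg.aestronglyMeasurable) ?_
    exact Eventually.of_forall fun x => (norm_inner_le_norm _ _).trans (by gcongr; exact hC x)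
  refine (integrableOn_iff_integrable_of_support_subset fun x hx => ?_).1 h1
  refine tsupport_gradient_subset φ (subset_tsupport _ fun h => hx ?_)
  simp only [h, inner_zero_right]

/-- The defect of a distributional identity at the origin, computed with cutoffs. -/
theorem tendsto_integral_cutoff [NeZero N]
    {V : EuclideanSpace ℝ (Fin N) → EuclideanSpace ℝ (Fin N)}
    {S : EuclideanSpace ℝ (Fin N) → ℝ} (hV : LocallyIntegrableOn V Ω)
    (hS : LocallyIntegrableOn S Ω)
    (h : ∀ ψ, IsTestFunction (Ω \ {0}) ψ →
      ∫ x, inner ℝ (V x) (gradient ψ x) = ∫ x, S x * ψ x) (hφ : IsTestFunction Ω φ) :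
    Tendsto (fun ε => ∫ x, φ x * fderiv ℝ (originCutoff ε) x (V x)) (𝓝[>] 0)
      (𝓝 ((∫ x, S x * φ x) - ∫ x, inner ℝ (V x) (gradient φ x))) := by
  have i1 : Integrable fun x => S x * φ x := by
    simpa only [smul_eq_mul, mul_comm] using hφ.integrable_smul hS
  have i2 := hφ.integrable_inner hV
  have hcut : ∀ ε, 0 < ε → Continuous (originCutoff ε : EuclideanSpace ℝ (Fin N) → ℝ) := fun ε hε =>
    (contDiff_originCutoff hε).continuous
  have hdct : ∀ g : EuclideanSpace ℝ (Fin N) → ℝ, Integrable g →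
      Tendsto (fun ε => ∫ x, g x * originCutoff ε x) (𝓝[>] 0) (𝓝 (∫ x, g x)) := by
    intro g hg
    refine tendsto_integral_filter_of_dominated_convergence (fun x => ‖g x‖) ?_ ?_ hg.norm ?_
    · filter_upwards [self_mem_nhdsWithin] with ε hε
      exact hg.1.mul (hcut ε hε).aestronglyMeasurable
    · refine Eventually.of_forall fun ε => Eventually.of_forall fun x => ?_
      rw [norm_mul]
      exact mul_le_of_le_one_right (norm_nonneg _) (norm_originCutoff_le ε x)
    · have h0 : ∀ᵐ x : EuclideanSpace ℝ (Fin N), x ≠ 0 := by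
        simp [ae_iff]
      filter_upwards [h0] with x hx
      refine tendsto_const_nhds.congr' ?_
      have hx' := norm_pos_iff.2 hx
      filter_upwards [Ioo_mem_nhdsGT (show (0 : ℝ) < ‖x‖ / 2 by positivity)] with ε hε
      rw [originCutoff_eq_one hε.1 (by linarith [hε.2]), mul_one]
  refine ((hdct _ i1).sub (hdct _ i2)).congr' ?_
  filter_upwards [self_mem_nhdsWithin] with ε hε
  have hψ := hφ.mul_originCutoff (show 0 < ε from hε)
  have h1 := h _ hψ
  have hb : ∀ g : EuclideanSpace ℝ (Fin N) → ℝ, Integrable g →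
      Integrable fun x => g x * originCutoff ε x := fun g hg =>
    hg.mul_bdd (hcut ε hε).aestronglyMeasurable
      (Eventually.of_forall fun x => norm_originCutoff_le ε x)
  -- The product rule writes `φ ∇χ` as `∇(φχ) - χ ∇φ`. The function `φχ` is admissible off the
  -- origin, and the other terms converge by domination.
  have hpt : ∀ x, φ x * fderiv ℝ (originCutoff ε) x (V x)
      = inner ℝ (V x) (gradient (fun x => φ x * originCutoff ε x) x)
        - inner ℝ (V x) (gradient φ x) * originCutoff ε x := by
    intro x
    have hd1 := (hφ.smooth.differentiable (by simp) x).hasFDerivAt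
    have hd2 := ((contDiff_originCutoff (N := N) hε).differentiable (by simp) x).hasFDerivAt
    rw [inner_gradient_eq', inner_gradient_eq',
      show fderiv ℝ (fun x => φ x * originCutoff ε x) x = _ from (hd1.mul hd2).fderiv]
    simp only [add_apply, smul_apply, smul_eq_mul]
    ring
  simp_rw [hpt]
  rw [integral_sub (hψ.integrable_inner (hV.mono_set sdiff_subset)) (hb _ i2), h1]
  simp only [mul_assoc]

/-- The flux of a radial field through small spheres produces a Dirac mass. -/
theorem tendsto_integral_radial_cutoff [NeZero N]
    {V : EuclideanSpace ℝ (Fin N) → EuclideanSpace ℝ (Fin N)} {W : ℝ → ℝ} {R c : ℝ} (hR : 0 < R)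
    (hV : ∀ᵐ x, x ≠ 0 → ‖x‖ < R → V x = -(W ‖x‖ / ‖x‖ ^ N) • x) (hWc : ContinuousOn W (Ioo 0 R))
    (hW : Tendsto W (𝓝[>] 0) (𝓝 c)) (hφ : Continuous φ) :
    Tendsto (fun ε => ∫ x, φ x * fderiv ℝ (originCutoff ε) x (V x)) (𝓝[>] 0)
      (𝓝 (-(c * sphereArea N * φ 0))) := by
  have hN : 1 ≤ N := NeZero.one_le
  set M : ℝ → ℝ := fun r => ∫ v : Metric.sphere (0 : EuclideanSpace ℝ (Fin N)) 1, φ (r • v.1)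
    ∂(volume : Measure (EuclideanSpace ℝ (Fin N))).toSphere with hM
  have hMc : Continuous M := by
    have h1 := continuous_parametric_integral_of_continuous
      (μ := (volume : Measure (EuclideanSpace ℝ (Fin N))).toSphere)
      (f := fun (r : ℝ) (v : Metric.sphere (0 : EuclideanSpace ℝ (Fin N)) 1) => φ (r • v.1))
      (by unfold Function.uncurry; fun_prop) isCompact_univ
    simpa only [Measure.restrict_univ] using h1
  have hM0 : M 0 = sphereArea N * φ 0 := by
    simp only [hM, zero_smul, integral_const, smul_eq_mul]
    rfl
  have hWM : Tendsto (fun r => W r * M r) (𝓝[>] 0) (𝓝 (c * sphereArea N * φ 0)) := by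
    have := hW.mul (hMc.tendsto 0 |>.mono_left nhdsWithin_le_nhds : Tendsto M (𝓝[>] 0) _)
    rwa [hM0, ← mul_assoc] at this
  set L := c * sphereArea N * φ 0 with hL
  rw [Metric.tendsto_nhds]
  intro δ hδ
  have h1 := (Metric.tendsto_nhds.1 hWM) (δ / 2) (by positivity)
  obtain ⟨ρ, hρ, hρs⟩ := mem_nhdsGT_iff_exists_Ioo_subset.1 h1
  have hρ0 : (0 : ℝ) < ρ := hρ
  filter_upwards [Ioo_mem_nhdsGT (show (0 : ℝ) < min ρ R / 2 by
    have := lt_min hρ0 hR; linarith)] with ε hε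
  obtain ⟨hε0, hε1⟩ := hε
  have hερ : 2 * ε < ρ := by linarith [min_le_left ρ R]
  have hεR : 2 * ε < R := by linarith [min_le_right ρ R]
  have hab : ε ≤ 2 * ε := by linarith
  set d : ℝ → ℝ := fun r => deriv Real.smoothTransition (r / ε - 1) / ε with hd
  have hdc : Continuous d :=
    (continuous_deriv_smoothTransition.comp (by fun_prop)).div_const ε
  have hd0 : ∀ r, 0 ≤ d r := fun r => div_nonneg Real.smoothTransition.monotone.deriv_nonneg hε0.le
  -- The derivative of the cutoff profile is a probability density on `[ε, 2ε]`, so the integral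
  -- below is an average of `-W M` over these radii.
  have hdint : ∫ r in ε..2 * ε, d r = 1 := by
    rw [intervalIntegral.integral_eq_sub_of_hasDerivAt
      (fun r _ => hasDerivAt_originCutoff_profile ε r) (hdc.intervalIntegrable _ _)]
    rw [mul_div_cancel_right₀ _ hε0.ne', div_self hε0.ne']
    norm_num
  have hWc' : ContinuousOn W (Icc ε (2 * ε)) :=
    hWc.mono fun r hr => ⟨hε0.trans_le hr.1, hr.2.trans_lt hεR⟩
  set k : ℝ → ℝ := fun r => -(W r / r ^ (N - 1)) * d r with hk
  have hkc : IntervalIntegrable k volume ε (2 * ε) := by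
    refine ContinuousOn.intervalIntegrable ?_
    rw [uIcc_of_le hab]
    exact (hWc'.div (by fun_prop) fun r hr => (pow_pos (hε0.trans_le hr.1) _).ne').neg.mul
      hdc.continuousOn
  have hI : ∫ x, φ x * fderiv ℝ (originCutoff ε) x (V x)
      = ∫ r in ε..2 * ε, k r * radialDensity φ r := by
    rw [← integral_shell_norm_mul hε0.le hab (integrableOn_shell_norm_smul hkc hφ.continuousOn),
      ← setIntegral_shell_of_eq_zero (a := ε) (b := 2 * ε) fun x hx => by
        rw [fderiv_originCutoff_eq_zero hε0 hx, zero_apply, mul_zero]]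
    refine setIntegral_congr_ae (measurableSet_shell _ _) ?_
    filter_upwards [hV] with x hx hxs
    have hr : 0 < ‖x‖ := hε0.trans hxs.1
    have hx0 := norm_pos_iff.1 hr
    rw [hx hx0 (hxs.2.trans_lt hεR), fderiv_originCutoff ε hx0, inner_smul_right,
      real_inner_self_eq_norm_sq]
    simp only [hk, hd]
    obtain ⟨n, rfl⟩ : ∃ n, N = n + 1 := ⟨N - 1, by omega⟩
    rw [Nat.add_sub_cancel]
    field_simp
    ring
  have hI2 : (∫ x, φ x * fderiv ℝ (originCutoff ε) x (V x)) - -L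
      = ∫ r in ε..2 * ε, d r * (L - W r * M r) := by
    rw [hI, sub_neg_eq_add]
    have h3 : ∫ r in ε..2 * ε, k r * radialDensity φ r = ∫ r in ε..2 * ε, -(d r * (W r * M r)) := by
      refine intervalIntegral.integral_congr fun r hr => ?_
      rw [uIcc_of_le hab] at hr
      have : 0 < r ^ (N - 1) := pow_pos (hε0.trans_le hr.1) _
      simp only [hk, radialDensity, finrank_euclideanSpace_fin]
      change -(W r / r ^ (N - 1)) * d r * (r ^ (N - 1) * M r) = _
      field_simp
    have h4 : IntervalIntegrable (fun r => d r * (W r * M r)) volume ε (2 * ε) := by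
      refine ContinuousOn.intervalIntegrable ?_
      rw [uIcc_of_le hab]
      exact hdc.continuousOn.mul (hWc'.mul hMc.continuousOn)
    rw [h3, intervalIntegral.integral_neg]
    simp only [mul_sub]
    rw [intervalIntegral.integral_sub ((hdc.intervalIntegrable _ _).mul_const L) h4,
      intervalIntegral.integral_mul_const, hdint]
    ring
  rw [dist_eq_norm, hI2]
  have h5 := intervalIntegral.norm_integral_le_of_norm_le (μ := volume)
    (f := fun r => d r * (L - W r * M r)) (g := fun r => d r * (δ / 2)) hab
    (Eventually.of_forall fun r hr => by
      rw [norm_mul, Real.norm_of_nonneg (hd0 r)]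
      refine mul_le_mul_of_nonneg_left ?_ (hd0 r)
      have := hρs ⟨hε0.trans hr.1, hr.2.trans_lt hερ⟩
      rw [mem_ofPred_eq, dist_comm, dist_eq_norm] at this
      exact this.le) ((hdc.intervalIntegrable _ _).mul_const _)
  rw [intervalIntegral.integral_mul_const, hdint] at h5
  linarith

/-- The gradient of the cutoff is `O(1/ε)` and is supported in a ball of volume `O(ε^N)`; the
integral is `O(ε^{N-1})`. -/
theorem tendsto_integral_bounded_cutoff (hN : 2 ≤ N)
    {V : EuclideanSpace ℝ (Fin N) → EuclideanSpace ℝ (Fin N)} {B ρ : ℝ} (hρ : 0 < ρ)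
    (hV : ∀ x, x ≠ 0 → ‖x‖ < ρ → ‖V x‖ ≤ B) (hφ : Continuous φ) (hφc : HasCompactSupport φ) :
    Tendsto (fun ε => ∫ x, φ x * fderiv ℝ (originCutoff ε) x (V x)) (𝓝[>] 0) (𝓝 0) := by
  obtain ⟨C, hC0, hC⟩ := exists_bound_deriv_smoothTransition
  obtain ⟨D, hD⟩ := hφ.bounded_above_of_compact_support hφc
  have hD0 : 0 ≤ D := (norm_nonneg _).trans (hD 0)
  have : NeZero N := ⟨by omega⟩
  set ν := volume.real (Metric.ball (0 : EuclideanSpace ℝ (Fin N)) 1) with hν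
  have hbound : ∀ ε ∈ Ioo 0 (ρ / 2), ‖∫ x, φ x * fderiv ℝ (originCutoff ε) x (V x)‖
      ≤ D * (C * max B 0) * 2 ^ N * ν * ε ^ (N - 1) := by
    intro ε hε
    obtain ⟨hε0, hε1⟩ := hε
    have h0 : ∀ x, x ∉ Metric.closedBall (0 : EuclideanSpace ℝ (Fin N)) (2 * ε) →
        φ x * fderiv ℝ (originCutoff ε) x (V x) = 0 := fun x hx => by
      rw [mem_closedBall_zero_iff, not_le] at hx
      rw [fderiv_originCutoff_eq_zero hε0 fun h => (hx.trans h.2).false, zero_apply, mul_zero]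
    rw [← setIntegral_eq_integral_of_forall_compl_eq_zero h0]
    refine (norm_setIntegral_le_of_norm_le_const (C := D * (C / ε * max B 0))
      (isCompact_closedBall _ _).measure_lt_top fun x hx => ?_).trans_eq ?_
    · rw [norm_mul]
      have hBm : 0 ≤ max B 0 := le_max_right _ _
      refine mul_le_mul (hD x) ?_ (norm_nonneg _) hD0
      by_cases hxr : ‖x‖ ∈ Ioo ε (2 * ε)
      · have hr : 0 < ‖x‖ := hε0.trans hxr.1
        have hx0 := norm_pos_iff.1 hr
        have hVx : ‖V x‖ ≤ max B 0 := (hV x hx0 (by linarith [hxr.2])).trans (le_max_left _ _)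
        rw [fderiv_originCutoff ε hx0, norm_mul, norm_div, norm_div, norm_norm,
          Real.norm_of_nonneg hε0.le, Real.norm_eq_abs]
        have hin := norm_inner_le_norm (𝕜 := ℝ) x (V x)
        calc _ ≤ C / ε / ‖x‖ * (‖x‖ * max B 0) := by
              gcongr
              · exact hC _
              · exact hin.trans (by gcongr)
          _ = C / ε * max B 0 := by field_simp
      · rw [fderiv_originCutoff_eq_zero hε0 hxr, zero_apply, norm_zero]
        positivity
    · have hvol : volume.real (Metric.closedBall (0 : EuclideanSpace ℝ (Fin N)) (2 * ε))
          = (2 * ε) ^ N * ν := by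
        rw [Measure.real, Measure.addHaar_closedBall _ _ (by linarith), finrank_euclideanSpace_fin,
          ENNReal.toReal_mul, ENNReal.toReal_ofReal (by positivity)]
        rfl
      rw [hvol]
      obtain ⟨n, rfl⟩ : ∃ n, N = n + 1 := ⟨N - 1, by omega⟩
      rw [Nat.add_sub_cancel]
      field_simp
      ring
  have hlim : Tendsto (fun ε : ℝ => D * (C * max B 0) * 2 ^ N * ν * ε ^ (N - 1)) (𝓝[>] 0) (𝓝 0) := by
    have h1 : Continuous fun ε : ℝ => D * (C * max B 0) * 2 ^ N * ν * ε ^ (N - 1) := by fun_prop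
    have h2 := (h1.tendsto 0).mono_left (nhdsWithin_le_nhds (s := Ioi 0))
    rwa [zero_pow (by omega), mul_zero] at h2
  refine squeeze_zero_norm' ?_ hlim
  filter_upwards [Ioo_mem_nhdsGT (show (0 : ℝ) < ρ / 2 by positivity)] with ε hε
  exact hbound ε hε

end Cutoff

/-! ### The equation across the origin -/

section AcrossOrigin

variable {N : ℕ} {Ω : Set (EuclideanSpace ℝ (Fin N))}

theorem ae_ne_zero [NeZero N] : ∀ᵐ x : EuclideanSpace ℝ (Fin N), x ≠ 0 := by
  simp [ae_iff]

theorem LocallyIntegrableOn.congr_ae {F : Type*} [NormedAddCommGroup F]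
    {g h : EuclideanSpace ℝ (Fin N) → F} (hg : LocallyIntegrableOn g Ω) (hgh : g =ᵐ[volume] h) :
    LocallyIntegrableOn h Ω := fun x hx =>
  let ⟨s, hs, hi⟩ := hg x hx
  ⟨s, hs, hi.congr (ae_restrict_of_ae hgh)⟩

/-- Local integrability across the origin from a power bound. -/
theorem LocallyIntegrableOn.of_norm_le_rpow [NeZero N] {F : Type*} [NormedAddCommGroup F]
    [NormedSpace ℝ F] {g : EuclideanSpace ℝ (Fin N) → F} {C s ρ : ℝ} (hρ : 0 < ρ)
    (hball : ∀ x, ‖x‖ < ρ → x ∈ Ω) (hg : LocallyIntegrableOn g (Ω \ {0})) (hs : -(N : ℝ) < s)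
    (hb : ∀ᵐ x, x ≠ 0 → ‖x‖ < ρ → ‖g x‖ ≤ C * ‖x‖ ^ s) : LocallyIntegrableOn g Ω := by
  intro x hx
  rcases eq_or_ne x 0 with rfl | hx0
  · have hsub : Metric.ball 0 ρ \ {0} ⊆ Ω \ {0} := fun y hy =>
      ⟨hball y (mem_ball_zero_iff.1 hy.1), hy.2⟩
    -- Measurability is only known off the origin; removing a null point does not affect it.
    have hae : (Metric.ball (0 : EuclideanSpace ℝ (Fin N)) ρ \ {0} : Set _)
        =ᵐ[volume] Metric.ball (0 : EuclideanSpace ℝ (Fin N)) ρ := sdiff_null_ae_eq_self (by simp)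
    have hm : AEStronglyMeasurable g (volume.restrict (Metric.ball 0 ρ)) := by
      rw [← Measure.restrict_congr_set hae]
      exact hg.aestronglyMeasurable.mono_measure (Measure.restrict_mono hsub le_rfl)
    have h1 : IntegrableOn ((Metric.ball 0 ρ).indicator g) (Metric.ball 0 ρ) := by
      refine integrableOn_ball_of_norm_le_rpow (C := C) (α := -s) ?_ ?_ ?_
        ((aestronglyMeasurable_indicator_iff measurableSet_ball).2 hm)
      · rw [finrank_euclideanSpace_fin]
        exact NeZero.one_le
      · rw [finrank_euclideanSpace_fin]
        linarith
      · rw [ae_restrict_iff' measurableSet_ball]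
        filter_upwards [hb, ae_ne_zero] with y hy hy0 hyb
        rw [indicator_of_mem hyb, neg_neg]
        exact hy hy0 (mem_ball_zero_iff.1 hyb)
    refine ⟨Metric.ball 0 ρ, mem_nhdsWithin_of_mem_nhds (Metric.ball_mem_nhds _ hρ), ?_⟩
    exact h1.congr_fun (fun y hy => indicator_of_mem hy g) measurableSet_ball
  · have : 𝓝[Ω] x = 𝓝[Ω \ {0}] x := by
      rw [sdiff_eq, nhdsWithin_inter_of_mem']
      exact mem_nhdsWithin_of_mem_nhds (isOpen_ne.mem_nhds hx0)
    rw [this]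
    exact hg x ⟨hx, hx0⟩

theorem IsTestFunction.setIntegral_inner_gradient {φ : EuclideanSpace ℝ (Fin N) → ℝ}
    (hφ : IsTestFunction Ω φ) (V : EuclideanSpace ℝ (Fin N) → EuclideanSpace ℝ (Fin N)) :
    ∫ x in Ω, inner ℝ (V x) (gradient φ x) = ∫ x, inner ℝ (V x) (gradient φ x) :=
  setIntegral_eq_integral_of_forall_compl_eq_zero fun x hx => by
    rw [hφ.gradient_eq_zero_of_notMem hx, inner_zero_right]

theorem IsTestFunction.setIntegral_mul {φ : EuclideanSpace ℝ (Fin N) → ℝ}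
    (hφ : IsTestFunction Ω φ) (S : EuclideanSpace ℝ (Fin N) → ℝ) :
    ∫ x in Ω, S x * φ x = ∫ x, S x * φ x :=
  setIntegral_eq_integral_of_forall_compl_eq_zero fun x hx => by
    rw [hφ.eq_zero_of_notMem hx, mul_zero]

/-- A positive radial solution in `Ω \ {0}` with profile `f` and weak gradient `G`, together with
its regularity. -/
structure IsPuncturedRadialSolution (p α q R : ℝ) (Ω : Set (EuclideanSpace ℝ (Fin N)))
    (u : EuclideanSpace ℝ (Fin N) → ℝ) (f : ℝ → ℝ)
    (G : EuclideanSpace ℝ (Fin N) → EuclideanSpace ℝ (Fin N)) : Prop where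
  isOpen : IsOpen Ω
  R_pos : 0 < R
  mem_of_lt : ∀ x, ‖x‖ < R → x ∈ Ω
  radial : ∀ x ∈ Ω \ {0}, u x = f ‖x‖
  continuousOn : ContinuousOn u (Ω \ {0})
  source_locallyIntegrable : LocallyIntegrableOn (henonSource α q u) (Ω \ {0})
  weakGradient : IsWeakGradient (Ω \ {0}) u G
  memLp : ∀ K ⊆ Ω \ {0}, IsCompact K → MemLp G (ENNReal.ofReal p) (volume.restrict K)
  eq : ∀ φ, IsTestFunction (Ω \ {0}) φ →
    ∫ x in Ω \ {0}, inner ℝ (pFlux p (G x)) (gradient φ x)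
      = ∫ x in Ω \ {0}, henonSource α q u x * φ x
  gradient_eq : ∀ᵐ x, x ∈ Ω \ {0} → G x = (deriv f ‖x‖ / ‖x‖) • x
  profile : IsRadialProfile N p α q R f
  differentiableAt : ∀ x ∈ Ω \ {0}, DifferentiableAt ℝ f ‖x‖
  continuousAt_deriv : ∀ x ∈ Ω \ {0}, ContinuousAt (deriv f) ‖x‖

theorem IsHenonSolution.exists_isPuncturedRadialSolution [NeZero N] {p α q : ℝ} (hp : 1 < p)
    (hΩ : IsOpen Ω) (h0 : (0 : EuclideanSpace ℝ (Fin N)) ∈ Ω)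
    {u : EuclideanSpace ℝ (Fin N) → ℝ} (hpos : ∀ x ∈ Ω \ {0}, 0 < u x)
    (hrad : IsRadialOn (Ω \ {0}) u) (hu : IsHenonSolution p α q (Ω \ {0}) u) :
    ∃ R f G, IsPuncturedRadialSolution p α q R Ω u f G := by
  obtain ⟨R, hR, hball⟩ := Metric.isOpen_iff.1 hΩ 0 h0
  obtain ⟨f, hf⟩ := hrad
  obtain ⟨huc, hS, G, hG, hGp, heq⟩ := hu
  have hΩ' : IsOpen (Ω \ {0}) := hΩ.sdiff isClosed_singleton
  have hmem : ∀ x, ‖x‖ < R → x ∈ Ω := fun x hx => hball (mem_ball_zero_iff.2 hx)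
  have hloc : ∀ x ∈ Ω \ {0}, DifferentiableAt ℝ f ‖x‖ ∧ ContinuousAt (deriv f) ‖x‖ := by
    intro x hx
    obtain ⟨a, b, -, hax, hxb, hc, hd, -⟩ :=
      exists_radial_regularity hp hΩ' hpos hf huc hG hGp heq hx hx.2
    exact ⟨(hd _ ⟨hax, hxb⟩).1, hc.continuousAt (Ioo_mem_nhds hax hxb)⟩
  exact ⟨R, f, G, hΩ, hR, hmem, hf, huc, hS, hG, hGp, heq,
    radialGradient_ae_eq_of_solution hp hΩ' (fun x hx => hx.2) hpos hf huc hG hGp heq,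
    isRadialProfile_of_solution hp hΩ' hpos hf huc hG hGp heq
      fun x hx hxR => ⟨hmem x hxR, hx⟩, fun x hx => (hloc x hx).1, fun x hx => (hloc x hx).2⟩

namespace IsPuncturedRadialSolution

variable {p α q R : ℝ} {u : EuclideanSpace ℝ (Fin N) → ℝ} {f : ℝ → ℝ}
  {G : EuclideanSpace ℝ (Fin N) → EuclideanSpace ℝ (Fin N)}

theorem u_pos (h : IsPuncturedRadialSolution p α q R Ω u f G) {x : EuclideanSpace ℝ (Fin N)}
    (hx : x ≠ 0) (hxR : ‖x‖ < R) : u x = f ‖x‖ ∧ 0 < f ‖x‖ :=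
  ⟨h.radial x ⟨h.mem_of_lt x hxR, hx⟩, h.profile.pos _ ⟨norm_pos_iff.2 hx, hxR⟩⟩

theorem pFlux_eq [NeZero N] (h : IsPuncturedRadialSolution p α q R Ω u f G) :
    ∀ᵐ x, x ≠ 0 → ‖x‖ < R → pFlux p (G x) = -(radialFlux N p f ‖x‖ / ‖x‖ ^ N) • x := by
  filter_upwards [h.gradient_eq] with x hx hx0 hxR
  have hr := norm_pos_iff.2 hx0
  rw [hx ⟨h.mem_of_lt x hxR, hx0⟩, pFlux_smul_self hr rfl, radialFlux]
  congr 1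
  obtain ⟨n, rfl⟩ : ∃ n, N = n + 1 := ⟨N - 1, by have := NeZero.one_le (n := N); omega⟩
  rw [Nat.add_sub_cancel, pow_succ]
  have := pow_pos hr n
  field_simp

/-- The field has norm `|W| / |x|^{N-1}` with `W` bounded near `0`, and `1 - N > -N`. -/
theorem locallyIntegrableOn_flux [NeZero N] (h : IsPuncturedRadialSolution p α q R Ω u f G)
    (hp : 1 < p) {c : ℝ} (hW : Tendsto (radialFlux N p f) (𝓝[>] 0) (𝓝 c)) :
    LocallyIntegrableOn (fun x => pFlux p (G x)) Ω := by
  have h1 : ∀ᶠ r in 𝓝[>] 0, |radialFlux N p f r| < |c| + 1 :=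
    hW.abs.eventually (gt_mem_nhds (by linarith))
  obtain ⟨ρ, hρ, hρs⟩ := mem_nhdsGT_iff_exists_Ioo_subset.1 h1
  have hρ0 : (0 : ℝ) < ρ := hρ
  refine LocallyIntegrableOn.of_norm_le_rpow (C := |c| + 1) (s := 1 - N) (lt_min hρ0 h.R_pos)
    (fun x hx => h.mem_of_lt x (hx.trans_le (min_le_right _ _)))
    (locallyIntegrableOn_pFlux (h.isOpen.sdiff isClosed_singleton) hp h.memLp) (by linarith) ?_
  filter_upwards [h.pFlux_eq] with x hx hx0 hxρ
  have hr := norm_pos_iff.2 hx0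
  have h2 := (hρs ⟨hr, hxρ.trans_le (min_le_left _ _)⟩ : |radialFlux N p f ‖x‖| < |c| + 1)
  rw [hx hx0 (hxρ.trans_le (min_le_right _ _)), norm_smul, norm_neg, norm_div, norm_pow, norm_norm,
    Real.norm_eq_abs, Real.rpow_sub hr, Real.rpow_one, Real.rpow_natCast, div_mul_eq_mul_div,
    mul_div_assoc]
  exact mul_le_mul_of_nonneg_right h2.le (by positivity)

/-- The equation across the origin, with the Dirac mass given by the flux. -/
theorem integral_sub_integral_eq [NeZero N] (h : IsPuncturedRadialSolution p α q R Ω u f G)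
    (hp : 1 < p) (hS : LocallyIntegrableOn (henonSource α q u) Ω) {c : ℝ}
    (hW : Tendsto (radialFlux N p f) (𝓝[>] 0) (𝓝 c)) {φ : EuclideanSpace ℝ (Fin N) → ℝ}
    (hφ : IsTestFunction Ω φ) :
    (∫ x in Ω, inner ℝ (pFlux p (G x)) (gradient φ x)) - (∫ x in Ω, henonSource α q u x * φ x)
      = c * sphereArea N * φ 0 := by
  have hV := h.locallyIntegrableOn_flux hp hW
  -- The same cutoff integral has two limits: the defect of the equation at the origin, and the flux
  -- through vanishing spheres.
  have h1 := tendsto_integral_cutoff hV hS (fun ψ hψ => by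
    have := h.eq ψ hψ
    rwa [hψ.setIntegral_inner_gradient, hψ.setIntegral_mul] at this) hφ
  have h2 := tendsto_integral_radial_cutoff h.R_pos h.pFlux_eq
    (fun r hr => (h.profile.flux_deriv r hr).continuousAt.continuousWithinAt) hW
    hφ.smooth.continuous
  have h3 := tendsto_nhds_unique h1 h2
  rw [hφ.setIntegral_inner_gradient, hφ.setIntegral_mul]
  linarith

/-- The exponent `s` is `0` for a bounded profile and `-β` for a fundamental singularity, where `-N
< α - βq` is the subcritical condition. -/
theorem locallyIntegrableOn_source [NeZero N] (h : IsPuncturedRadialSolution p α q R Ω u f G)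
    (hq : 0 < q) {B s ρ : ℝ} (hρ : 0 < ρ) (hB : 0 ≤ B) (hs : -(N : ℝ) < α + s * q)
    (hf : ∀ r, 0 < r → r < ρ → f r ≤ B * r ^ s) : LocallyIntegrableOn (henonSource α q u) Ω := by
  refine LocallyIntegrableOn.of_norm_le_rpow (C := B ^ q) (lt_min hρ h.R_pos)
    (fun x hx => h.mem_of_lt x (hx.trans_le (min_le_right _ _))) h.source_locallyIntegrable hs ?_
  refine Eventually.of_forall fun x hx0 hxρ => ?_
  have hr := norm_pos_iff.2 hx0
  obtain ⟨h1, h2⟩ := h.u_pos hx0 (hxρ.trans_le (min_le_right _ _))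
  rw [henonSource, h1, Real.norm_of_nonneg (by positivity), Real.rpow_add hr, Real.rpow_mul hr.le,
    mul_left_comm, ← Real.mul_rpow hB (by positivity)]
  gcongr
  exact hf _ hr (hxρ.trans_le (min_le_left _ _))

/-- The fundamental singularity. -/
theorem hasDiracSource [NeZero N] (h : IsPuncturedRadialSolution p α q R Ω u f G)
    (hp : 1 < p) (hS : LocallyIntegrableOn (henonSource α q u) Ω) {c : ℝ}
    (hW : Tendsto (radialFlux N p f) (𝓝[>] 0) (𝓝 c)) :
    HasDiracSource p α q (c * sphereArea N) Ω u :=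
  ⟨G, h.weakGradient, h.locallyIntegrableOn_flux hp hW, hS,
    fun _ hφ => h.integral_sub_integral_eq hp hS hW hφ⟩

theorem norm_gradient_eq [NeZero N] (h : IsPuncturedRadialSolution p α q R Ω u f G) :
    ∀ᵐ x, x ≠ 0 → ‖x‖ < R → ‖G x‖ = |deriv f ‖x‖| := by
  filter_upwards [h.gradient_eq] with x hx hx0 hxR
  have hr := norm_pos_iff.2 hx0
  rw [hx ⟨h.mem_of_lt x hxR, hx0⟩, norm_smul, norm_div, norm_norm, div_mul_cancel₀ _ hr.ne',
    Real.norm_eq_abs]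

theorem memLp_of_deriv_le [NeZero N] (h : IsPuncturedRadialSolution p α q R Ω u f G)
    (hp : 1 < p) {C γ ρ : ℝ} (hC : 0 ≤ C) (hρ : 0 < ρ) (hγ : -1 < γ) (hγp : -(N : ℝ) < γ * p)
    (hf : ∀ r, 0 < r → r < ρ → |deriv f r| ≤ C * r ^ γ) :
    LocallyIntegrableOn G Ω ∧
      ∀ K ⊆ Ω, IsCompact K → MemLp G (ENNReal.ofReal p) (volume.restrict K) := by
  have hp0 : 0 < p := by linarith
  have hball : ∀ x : EuclideanSpace ℝ (Fin N), ‖x‖ < min ρ R → x ∈ Ω := fun x hx =>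
    h.mem_of_lt x (hx.trans_le (min_le_right _ _))
  have hN : (1 : ℝ) ≤ N := by exact_mod_cast NeZero.one_le
  have hG : LocallyIntegrableOn G Ω := by
    refine LocallyIntegrableOn.of_norm_le_rpow (C := C) (lt_min hρ h.R_pos) hball
      h.weakGradient.locallyIntegrable_grad (by linarith : -(N : ℝ) < γ) ?_
    filter_upwards [h.norm_gradient_eq] with x hx hx0 hxρ
    rw [hx hx0 (hxρ.trans_le (min_le_right _ _))]
    exact hf _ (norm_pos_iff.2 hx0) (hxρ.trans_le (min_le_left _ _))
  have hGp : LocallyIntegrableOn (fun x => ‖G x‖ ^ p) Ω := by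
    refine LocallyIntegrableOn.of_norm_le_rpow (C := C ^ p) (lt_min hρ h.R_pos) hball ?_ hγp ?_
    · refine (locallyIntegrableOn_iff (h.isOpen.sdiff isClosed_singleton).isLocallyClosed).2
        fun K hK hKc => ?_
      have := (h.memLp K hK hKc).integrable_norm_rpow (by simpa using hp0) ENNReal.ofReal_ne_top
      rwa [ENNReal.toReal_ofReal hp0.le] at this
    · filter_upwards [h.norm_gradient_eq] with x hx hx0 hxρ
      have hr := norm_pos_iff.2 hx0
      rw [hx hx0 (hxρ.trans_le (min_le_right _ _)), Real.norm_of_nonneg (by positivity),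
        Real.rpow_mul hr.le, ← Real.mul_rpow hC (by positivity)]
      exact Real.rpow_le_rpow (abs_nonneg _) (hf _ hr (hxρ.trans_le (min_le_left _ _))) hp0.le
  refine ⟨hG, fun K hK hKc => ?_⟩
  have h1 : IntegrableOn G K := hG.integrableOn_compact_subset hK hKc
  have h2 : IntegrableOn (fun x => ‖G x‖ ^ p) K := hGp.integrableOn_compact_subset hK hKc
  rw [← integrable_norm_rpow_iff h1.1 (by simpa using hp0) ENNReal.ofReal_ne_top,
    ENNReal.toReal_ofReal hp0.le]
  exact h2

/-- A bounded function with locally integrable gradient has no singular part at the origin. -/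
theorem isWeakGradient_of_le (h : IsPuncturedRadialSolution p α q R Ω u f G) (hN : 2 ≤ N)
    {U : EuclideanSpace ℝ (Fin N) → ℝ} (hU : EqOn U u (Ω \ {0})) (hUi : LocallyIntegrableOn U Ω)
    (hGi : LocallyIntegrableOn G Ω) {B ρ : ℝ} (hρ : 0 < ρ)
    (hf : ∀ r, 0 < r → r < ρ → f r ≤ B) : IsWeakGradient Ω U G := by
  have : NeZero N := ⟨by omega⟩
  refine ⟨hUi, hGi, fun φ hφ => ?_⟩
  have i1 := hφ.integrable_smul_gradient hUi
  have i2 := hφ.integrable_smul hGi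
  rw [setIntegral_eq_integral_of_forall_compl_eq_zero fun x hx => by
      rw [hφ.gradient_eq_zero_of_notMem hx, smul_zero],
    setIntegral_eq_integral_of_forall_compl_eq_zero fun x hx => by
      rw [hφ.eq_zero_of_notMem hx, zero_smul]]
  refine ext_inner_left ℝ fun e => ?_
  rw [inner_neg_right, ← integral_inner i1, ← integral_inner i2]
  have hUe : LocallyIntegrableOn (fun x => U x • e) Ω := fun x hx =>
    let ⟨s, hs, hi⟩ := hUi x hx
    ⟨s, hs, hi.smul_const e⟩
  have hGe : LocallyIntegrableOn (fun x => -inner ℝ e (G x)) Ω := fun x hx =>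
    let ⟨s, hs, hi⟩ := hGi x hx
    ⟨s, hs, (hi.const_inner (𝕜 := ℝ) e).neg⟩
  -- In each direction `e`, the weak gradient identity is a divergence identity for the field `U e`
  -- with source `-⟨e, G⟩`, so the same cutoff argument applies, now with a bounded field.
  have h1 := tendsto_integral_cutoff hUe hGe (fun ψ hψ => by
    have := h.weakGradient.integral_mul_fderiv hψ e
    simp only [inner_smul_left, conj_trivial, inner_gradient_eq', neg_mul, integral_neg]
    simp only [mul_comm (inner ℝ e _)]
    rw [← this]
    refine integral_congr_ae (Eventually.of_forall fun x => ?_)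
    simp only
    by_cases hx : x ∈ Ω \ {0}
    · rw [hU hx]
    · rw [← inner_gradient_eq ψ x e, hψ.gradient_eq_zero_of_notMem hx, inner_zero_left, mul_zero,
        mul_zero]) hφ
  have h2 := tendsto_integral_bounded_cutoff hN (V := fun x => U x • e) (B := B * ‖e‖)
    (lt_min hρ h.R_pos) (fun x hx0 hxρ => by
      obtain ⟨h3, h4⟩ := h.u_pos hx0 (hxρ.trans_le (min_le_right _ _))
      rw [norm_smul, hU ⟨h.mem_of_lt x (hxρ.trans_le (min_le_right _ _)), hx0⟩, h3,
        Real.norm_of_nonneg h4.le]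
      exact mul_le_mul_of_nonneg_right
        (hf _ (norm_pos_iff.2 hx0) (hxρ.trans_le (min_le_left _ _))) (norm_nonneg _))
    hφ.smooth.continuous hφ.compactSupport
  have h3 := sub_eq_zero.1 (tendsto_nhds_unique h1 h2)
  simp only [inner_smul_left, conj_trivial, inner_gradient_eq', neg_mul, integral_neg] at h3
  simp only [inner_smul_right, inner_gradient_eq']
  rw [← h3]
  simp only [mul_comm]

/-- The expansion `f - U(0) = O(r^{γ+1})` makes the derivative at `0` exist and vanish, and `f' =
O(r^γ)` with `γ > 0` makes the derivative continuous there. -/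
theorem contDiffOn_extension [NeZero N] (h : IsPuncturedRadialSolution p α q R Ω u f G)
    {U : EuclideanSpace ℝ (Fin N) → ℝ} (hU : EqOn U u (Ω \ {0})) {C γ ρ : ℝ} (hρ : 0 < ρ)
    (hγ : 0 < γ) (hd : ∀ r, 0 < r → r < ρ → |deriv f r| ≤ C * r ^ γ)
    (hL : ∀ r, 0 < r → r < ρ → |f r - U 0| ≤ C * r ^ (γ + 1)) : ContDiffOn ℝ 1 U Ω := by
  set D : EuclideanSpace ℝ (Fin N) → EuclideanSpace ℝ (Fin N) →L[ℝ] ℝ :=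
    fun x => (deriv f ‖x‖ / ‖x‖) • innerSL ℝ x with hD
  have hD0 : D 0 = 0 := by simp [hD]
  have hΩ' := h.isOpen.sdiff (isClosed_singleton (x := (0 : EuclideanSpace ℝ (Fin N))))
  have h0 : (0 : EuclideanSpace ℝ (Fin N)) ∈ Ω := h.mem_of_lt 0 (by simpa using h.R_pos)
  have hnear : ∀ᶠ x : EuclideanSpace ℝ (Fin N) in 𝓝 0, ‖x‖ < min ρ R := by
    filter_upwards [Metric.ball_mem_nhds (0 : EuclideanSpace ℝ (Fin N)) (lt_min hρ h.R_pos)]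
      with x hx using mem_ball_zero_iff.1 hx
  have hpow : ∀ x : EuclideanSpace ℝ (Fin N), ‖x‖ ^ (γ + 1) = ‖x‖ ^ γ * ‖x‖ := fun x =>
    Real.rpow_add_one' (norm_nonneg x) (by linarith)
  have hlim : Tendsto (fun x : EuclideanSpace ℝ (Fin N) => C * ‖x‖ ^ γ) (𝓝 0) (𝓝 0) := by
    have : Tendsto (fun x : EuclideanSpace ℝ (Fin N) => C * ‖x‖ ^ γ) (𝓝 0) (𝓝 (C * ‖(0 : EuclideanSpace ℝ (Fin N))‖ ^ γ)) :=
      (continuous_norm.rpow_const fun _ => Or.inr hγ.le).const_mul C |>.tendsto 0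
    simpa [Real.zero_rpow hγ.ne'] using this
  have hfd : ∀ x ∈ Ω, HasFDerivAt U (D x) x := by
    intro x hx
    rcases eq_or_ne x 0 with rfl | hx0
    · rw [hD0, hasFDerivAt_iff_isLittleO_nhds_zero]
      rw [Asymptotics.isLittleO_iff]
      intro ε hε
      filter_upwards [hnear, hlim.eventually (gt_mem_nhds hε)] with y hy hyε
      rw [zero_apply, sub_zero, zero_add]
      rcases eq_or_ne y 0 with rfl | hy0
      · simp
      · have hyR := hy.trans_le (min_le_right ρ R)
        rw [hU ⟨h.mem_of_lt y hyR, hy0⟩, (h.u_pos hy0 hyR).1, Real.norm_eq_abs]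
        refine (hL _ (norm_pos_iff.2 hy0) (hy.trans_le (min_le_left _ _))).trans ?_
        rw [hpow, ← mul_assoc]
        exact mul_le_mul_of_nonneg_right hyε.le (norm_nonneg _)
    · refine (hasFDerivAt_comp_norm hx0 (h.differentiableAt x ⟨hx, hx0⟩).hasDerivAt).congr_of_eventuallyEq ?_
      filter_upwards [hΩ'.mem_nhds ⟨hx, hx0⟩] with y hy
      rw [hU hy, h.radial y hy]
  have hDc : ContinuousOn D Ω := by
    intro x hx
    refine ContinuousAt.continuousWithinAt ?_
    rcases eq_or_ne x 0 with rfl | hx0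
    · rw [ContinuousAt, hD0, tendsto_zero_iff_norm_tendsto_zero]
      refine squeeze_zero' (Eventually.of_forall fun y => norm_nonneg _) ?_
        (hlim.congr fun y => rfl)
      filter_upwards [hnear] with y hy
      rcases eq_or_ne y 0 with rfl | hy0
      · rw [hD0, norm_zero, norm_zero, Real.zero_rpow hγ.ne', mul_zero]
      · have hr := norm_pos_iff.2 hy0
        simp only [hD]
        rw [norm_smul, innerSL_apply_norm, norm_div, norm_norm, div_mul_cancel₀ _ hr.ne']
        exact hd _ hr (hy.trans_le (min_le_left _ _))
    · exact (((h.continuousAt_deriv x ⟨hx, hx0⟩).comp continuous_norm.continuousAt).div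
        continuous_norm.continuousAt (norm_ne_zero_iff.2 hx0)).smul (innerSL ℝ).continuous.continuousAt
  rw [show (1 : WithTop ℕ∞) = 0 + 1 from (zero_add 1).symm,
    contDiffOn_succ_iff_fderiv_of_isOpen h.isOpen]
  refine ⟨fun x hx => (hfd x hx).differentiableAt.differentiableWithinAt, by simp, ?_⟩
  rw [contDiffOn_zero]
  exact hDc.congr fun x hx => (hfd x hx).fderiv

/-- A bounded solution without flux at the origin has a removable singularity. -/
theorem extendsAcrossZero [NeZero N] (h : IsPuncturedRadialSolution p α q R Ω u f G)
    (hp : 1 < p) (hpN : p < N) (hq : p - 1 < q) (hα : -p < α)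
    (hW : Tendsto (radialFlux N p f) (𝓝[>] 0) (𝓝 0))
    (hB : ∃ B, ∀ᶠ t in atTop, f (Real.exp (-t)) ≤ B) : ExtendsAcrossZero p α q Ω u := by
  have hm : 0 < p - 1 := by linarith
  have hN : 2 ≤ N := by
    have : (1 : ℝ) < N := hp.trans hpN
    exact_mod_cast this
  obtain ⟨L, C, ρ, hL0, hC0, hρ, hρR, hbd⟩ := h.profile.bounded_decay hp hpN h.R_pos hq hα hW hB
  set γ := (α + 1) / (p - 1) with hγ
  have hγ1 : -1 < γ := by
    rw [hγ, lt_div_iff₀ hm]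
    linarith
  -- The given `u` has an arbitrary value at `0`; the extension takes the limit `L` there.
  set U : EuclideanSpace ℝ (Fin N) → ℝ := Function.update u 0 L with hUdef
  have hU : EqOn U u (Ω \ {0}) := fun x hx => Function.update_of_ne hx.2 _ _
  have hU0 : U 0 = L := Function.update_self _ _ _
  have hUae : u =ᵐ[volume] U := by
    filter_upwards [ae_ne_zero] with x hx using (Function.update_of_ne hx _ _).symm
  have hUc : ContinuousOn U Ω := by
    intro x hx
    refine ContinuousAt.continuousWithinAt ?_
    rcases eq_or_ne x 0 with rfl | hx0
    · rw [ContinuousAt, hU0, tendsto_iff_norm_sub_tendsto_zero]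
      have hlim : Tendsto (fun x : EuclideanSpace ℝ (Fin N) => C * ‖x‖ ^ (γ + 1)) (𝓝 0) (𝓝 0) := by
        have : Tendsto (fun x : EuclideanSpace ℝ (Fin N) => C * ‖x‖ ^ (γ + 1)) (𝓝 0)
            (𝓝 (C * ‖(0 : EuclideanSpace ℝ (Fin N))‖ ^ (γ + 1))) :=
          (continuous_norm.rpow_const fun _ => Or.inr (by linarith)).const_mul C |>.tendsto 0
        simpa [Real.zero_rpow (by linarith : γ + 1 ≠ 0)] using this
      refine squeeze_zero' (Eventually.of_forall fun y => norm_nonneg _) ?_ hlim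
      filter_upwards [Metric.ball_mem_nhds (0 : EuclideanSpace ℝ (Fin N)) hρ] with y hy
      rw [mem_ball_zero_iff] at hy
      rcases eq_or_ne y 0 with rfl | hy0
      · rw [hU0, sub_self, norm_zero]
        positivity
      · have hyR := hy.trans hρR
        rw [hU ⟨h.mem_of_lt y hyR, hy0⟩, (h.u_pos hy0 hyR).1, Real.norm_eq_abs]
        exact (hbd _ (norm_pos_iff.2 hy0) hy).2.2
    · have hΩ' := (h.isOpen.sdiff isClosed_singleton).mem_nhds (show x ∈ Ω \ {0} from ⟨hx, hx0⟩)
      exact (h.continuousOn.continuousAt hΩ').congr (by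
        filter_upwards [hΩ'] with y hy using (hU hy).symm)
  have hSu : LocallyIntegrableOn (henonSource α q u) Ω :=
    h.locallyIntegrableOn_source (by linarith) hρ hL0.le (s := 0) (by linarith) fun r hr hrρ => by
      rw [Real.rpow_zero, mul_one]
      exact (hbd r hr hrρ).1
  have hSae : henonSource α q u =ᵐ[volume] henonSource α q U := by
    filter_upwards [hUae] with x hx
    rw [henonSource, henonSource, hx]
  -- Since `γ > -1` and `p < N`, `γ p > -p > -N`.
  have hγp : -(N : ℝ) < γ * p := by nlinarith
  obtain ⟨hGi, hGp⟩ := h.memLp_of_deriv_le hp hC0.le hρ hγ1 hγp fun r hr hrρ => (hbd r hr hrρ).2.1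
  refine ⟨U, hU, ⟨hUc, LocallyIntegrableOn.congr_ae hSu hSae, G, ?_, hGp, fun φ hφ => ?_⟩, fun hα1 => ?_⟩
  · exact h.isWeakGradient_of_le hN hU
      (hUc.locallyIntegrableOn h.isOpen.measurableSet) hGi hρ fun r hr hrρ => (hbd r hr hrρ).1
  · have h1 := h.integral_sub_integral_eq hp hSu hW hφ
    rw [zero_mul, zero_mul, sub_eq_zero] at h1
    rw [h1]
    refine integral_congr_ae (ae_restrict_of_ae ?_)
    filter_upwards [hSae] with x hx
    rw [hx]
  · exact h.contDiffOn_extension hU hρ (div_pos (by linarith) hm)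
      (fun r hr hrρ => (hbd r hr hrρ).2.1) fun r hr hrρ => hU0.symm ▸ (hbd r hr hrρ).2.2

end IsPuncturedRadialSolution

end AcrossOrigin

/-! ### The three regimes -/

theorem sphereArea_pos (N : ℕ) [NeZero N] : 0 < sphereArea N := by
  have : Nontrivial (EuclideanSpace ℝ (Fin N)) := inferInstance
  rw [sphereArea, Measure.toSphere_apply_univ, ENNReal.toReal_mul, finrank_euclideanSpace_fin]
  have h1 : 0 < volume (Metric.ball (0 : EuclideanSpace ℝ (Fin N)) 1) :=
    Metric.measure_ball_pos _ _ one_pos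
  have h2 : 0 < N := NeZero.pos N
  exact mul_pos (by simpa using h2) (ENNReal.toReal_pos h1.ne' measure_ball_lt_top.ne)

namespace IsPuncturedRadialSolution

variable {N : ℕ} {Ω : Set (EuclideanSpace ℝ (Fin N))} {p α q R : ℝ}
  {u : EuclideanSpace ℝ (Fin N) → ℝ} {f : ℝ → ℝ}
  {G : EuclideanSpace ℝ (Fin N) → EuclideanSpace ℝ (Fin N)}

/-- A limit at `+∞` in the variable `t = -ln |x|` is a limit at the origin. -/
theorem tendsto_nhdsNE_zero (h : IsPuncturedRadialSolution p α q R Ω u f G) {g : ℝ → ℝ → ℝ}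
    {l : Filter ℝ} (hg : Tendsto (fun t => g (Real.exp (-t)) (f (Real.exp (-t)))) atTop l) :
    Tendsto (fun x => g ‖x‖ (u x)) (𝓝[≠] 0) l := by
  have h1 := IsRadialProfile.tendsto_nhdsGT_of_tendsto_exp_neg (g := fun r => g r (f r)) hg
  have h2 := h1.comp (tendsto_norm_nhdsNE_zero (E := EuclideanSpace ℝ (Fin N)))
  refine h2.congr' ?_
  filter_upwards [self_mem_nhdsWithin, mem_nhdsWithin_of_mem_nhds (Metric.ball_mem_nhds
    (0 : EuclideanSpace ℝ (Fin N)) h.R_pos)] with x hx hxR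
  simp only [Function.comp_apply]
  rw [(h.u_pos hx (mem_ball_zero_iff.1 hxR)).1]

theorem emdenFowler (h : IsPuncturedRadialSolution p α q R Ω u f G) (hp : 1 < p) (hpN : p < N)
    (hq : p - 1 < q) (hα : -p < α) :
    EmdenFowler (p - 1) ((N - p) / (p - 1)) (N + α) q (-Real.log R)
      (fun t => f (Real.exp (-t))) (fun t => radialFlux N p f (Real.exp (-t))) :=
  h.profile.emdenFowler hp hpN h.R_pos hq hα

theorem tendsto_flux_zero (h : IsPuncturedRadialSolution p α q R Ω u f G) (hp : 1 < p)
    (hpN : p < N) (hq : p - 1 < q) (hα : -p < α) (hcrit : N + α ≤ q * ((N - p) / (p - 1))) :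
    Tendsto (fun t => radialFlux N p f (Real.exp (-t))) atTop (𝓝 0) := by
  have hE := h.emdenFowler hp hpN hq hα
  obtain ⟨c, hc0, hcw, hc⟩ := hE.exists_tendsto_w
  rwa [hE.flux_limit_eq_zero hc0 hcw hcrit] at hc

theorem extendsAcrossZero_of_tendsto [NeZero N] (h : IsPuncturedRadialSolution p α q R Ω u f G)
    (hp : 1 < p) (hpN : p < N) (hq : p - 1 < q) (hα : -p < α)
    (hw : Tendsto (fun t => radialFlux N p f (Real.exp (-t))) atTop (𝓝 0))
    (hB : ∃ B, ∀ᶠ t in atTop, f (Real.exp (-t)) ≤ B) : ExtendsAcrossZero p α q Ω u :=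
  h.extendsAcrossZero hp hpN hq hα (IsRadialProfile.tendsto_nhdsGT_of_tendsto_exp_neg hw) hB

theorem subcritical [NeZero N] (h : IsPuncturedRadialSolution p α q R Ω u f G) (hp : 1 < p)
    (hpN : p < N) (hq : p - 1 < q) (hα : -p < α) (hsub : q * ((N - p) / (p - 1)) < N + α) :
    ExtendsAcrossZero p α q Ω u ∨ ∃ C > 0, ∃ C' > 0,
      Tendsto (fun x => u x / pFundamental N p x) (𝓝[≠] 0) (𝓝 C) ∧ HasDiracSource p α q C' Ω u := by
  have hm : 0 < p - 1 := by linarith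
  have hE := h.emdenFowler hp hpN hq hα
  have hβ := hE.β_pos
  set β := ((N : ℝ) - p) / (p - 1) with hβdef
  obtain ⟨c, hc0, hcw, hc⟩ := hE.exists_tendsto_w
  -- The limit of the flux decides: zero flux gives a removable singularity, positive flux a Dirac
  -- mass.
  rcases hc0.eq_or_lt with rfl | hc0
  · exact Or.inl (h.extendsAcrossZero_of_tendsto hp hpN hq hα hc (hE.bounded_of_subcritical hc hsub))
  have hω := sphereArea_pos N
  have hlim := hE.tendsto_F_div_exp hc
  -- The first constant equals `(c ω_{N-1})^{1/(p-1)}`, the ratio of the limits of `u` and `μ`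
  -- multiplied by `|x|^β`; the Dirac mass is `c ω_{N-1}`.
  refine Or.inr ⟨c ^ (1 / (p - 1)) / β / (1 / β * sphereArea N ^ (-1 / (p - 1))), by positivity,
    c * sphereArea N, by positivity, ?_, ?_⟩
  · have h1 : Tendsto (fun t => f (Real.exp (-t)) /
        ((p - 1) / (N - p) * sphereArea N ^ (-1 / (p - 1)) * Real.exp (-t) ^ ((p - N) / (p - 1))))
        atTop (𝓝 (c ^ (1 / (p - 1)) / β / (1 / β * sphereArea N ^ (-1 / (p - 1))))) := by
      refine (hlim.div_const _).congr fun t => ?_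
      rw [← Real.exp_mul, show -t * ((p - N) / (p - 1)) = β * t by rw [hβdef]; ring,
        show (p - 1) / (N - p) = 1 / β by rw [hβdef, one_div_div]]
      field_simp
    exact h.tendsto_nhdsNE_zero (g := fun r y => y /
      ((p - 1) / (N - p) * sphereArea N ^ (-1 / (p - 1)) * r ^ ((p - N) / (p - 1)))) h1
  · obtain ⟨ρ, hρ, -, hf⟩ := IsRadialProfile.exists_lt_of_eventually_atTop
      (P := fun r => f r ≤ (c ^ (1 / (p - 1)) / β + 1) * r ^ (-β)) h.R_pos (by
        filter_upwards [hlim.eventually (gt_mem_nhds (lt_add_one _))] with t ht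
        rw [div_lt_iff₀ (Real.exp_pos _)] at ht
        rw [← Real.exp_mul, show -t * -β = β * t by ring]
        exact ht.le)
    refine h.hasDiracSource hp (h.locallyIntegrableOn_source hE.q_pos hρ (by positivity) ?_ hf)
      (IsRadialProfile.tendsto_nhdsGT_of_tendsto_exp_neg hc)
    nlinarith

theorem critical [NeZero N] (h : IsPuncturedRadialSolution p α q R Ω u f G) (hp : 1 < p)
    (hpN : p < N) (hq : p - 1 < q) (hα : -p < α) (hcrit : q * ((N - p) / (p - 1)) = N + α) :
    ExtendsAcrossZero p α q Ω u ∨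
      Tendsto (fun x => ‖x‖ ^ ((N - p) / (p - 1)) *
          Real.log (1 / ‖x‖) ^ ((N - p) / ((p + α) * (p - 1))) * u x) (𝓝[≠] 0)
        (𝓝 (((N - p) / (p + α) * ((N - p) / (p - 1)) ^ (p - 1)) ^
          ((N - p) / ((p + α) * (p - 1))))) := by
  have hm : 0 < p - 1 := by linarith
  have hNp : 0 < N - p := by linarith
  have hpα : 0 < p + α := by linarith
  have hE := h.emdenFowler hp hpN hq hα
  have hw := h.tendsto_flux_zero hp hpN hq hα hcrit.ge
  refine (hE.bounded_or_tendsto_of_critical hw hcrit).imp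
    (h.extendsAcrossZero_of_tendsto hp hpN hq hα hw) fun hlim => ?_
  -- Criticality expresses `q - m` through `p`, `N`, `α`, which turns the exponents of the
  -- Emden-Fowler limit into the stated ones.
  have hqm : q - (p - 1) = (p - 1) * (p + α) / (N - p) := by
    have : q = (N + α) * (p - 1) / (N - p) := by
      rw [← hcrit]
      field_simp
    rw [this]
    field_simp
    ring
  have e1 : 1 / (q - (p - 1)) = (N - p) / ((p + α) * (p - 1)) := by
    rw [hqm]
    field_simp
  have e2 : (p - 1) / (q - (p - 1)) = (N - p) / (p + α) := by
    rw [hqm]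
    field_simp
  rw [e1, e2] at hlim
  refine h.tendsto_nhdsNE_zero (g := fun r y => r ^ (((N : ℝ) - p) / (p - 1)) *
    Real.log (1 / r) ^ (((N : ℝ) - p) / ((p + α) * (p - 1))) * y) (hlim.congr fun t => ?_)
  rw [one_div (Real.exp _), ← Real.exp_neg, neg_neg, Real.log_exp, ← Real.exp_mul, neg_mul,
    mul_comm t, div_eq_mul_inv, ← Real.exp_neg]
  ring

theorem supercritical [NeZero N] (h : IsPuncturedRadialSolution p α q R Ω u f G) (hp : 1 < p)
    (hpN : p < N) (hq : p - 1 < q) (hα : -p < α) (hsup : N + α < q * ((N - p) / (p - 1)))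
    (hsob : q < (N + α) * p / (N - p) - 1) :
    ExtendsAcrossZero p α q Ω u ∨
      Tendsto (fun x => ‖x‖ ^ ((p + α) / (q + 1 - p)) * u x) (𝓝[≠] 0)
        (𝓝 ((((p + α) / (q + 1 - p)) ^ (p - 1) *
          (N - (p * q + α * (p - 1)) / (q + 1 - p))) ^ (1 / (q + 1 - p)))) := by
  have hm : 0 < p - 1 := by linarith
  have hNp : 0 < N - p := by linarith
  have hqp : 0 < q + 1 - p := by linarith
  have hE := h.emdenFowler hp hpN hq hα
  have hw := h.tendsto_flux_zero hp hpN hq hα hsup.le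
  have e0 : q - (p - 1) = q + 1 - p := by ring
  set γ := (p + α) / (q + 1 - p) with hγ
  have hγ' : γ = ((N + α) - (N - p) / (p - 1) * (p - 1)) / (q - (p - 1)) := by
    rw [div_mul_cancel₀ _ hm.ne', e0, hγ]
    congr 1
    ring
  have e1 : (p - 1) * ((N - p) / (p - 1) - γ) = N - (p * q + α * (p - 1)) / (q + 1 - p) := by
    rw [hγ]
    field_simp
    ring
  -- This amounts to `N - p < p γ`, that is `(q + 1)(N - p) < (N + α) p`: the Sobolev-subcritical
  -- condition which makes the energy nonincreasing.
  have hS : (p - 1) * ((N - p) / (p - 1) - γ) < γ := by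
    rw [mul_sub, mul_div_cancel₀ _ hm.ne']
    have h1 : (q + 1) * (N - p) < (N + α) * p := by
      rw [lt_sub_iff_add_lt, lt_div_iff₀ hNp] at hsob
      exact hsob
    have h2 : N - p < p * γ := by
      rw [hγ, ← mul_div_assoc, lt_div_iff₀ hqp]
      nlinarith
    linarith
  refine (hE.bounded_or_tendsto_of_supercritical hw hsup hγ' hS).imp
    (h.extendsAcrossZero_of_tendsto hp hpN hq hα hw) fun hlim => ?_
  rw [e1, e0] at hlim
  refine h.tendsto_nhdsNE_zero (g := fun r y => r ^ γ * y) (hlim.congr fun t => ?_)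
  rw [← Real.exp_mul, mul_comm]
  congr 2
  ring

end IsPuncturedRadialSolution

theorem theorem1p1 (N : ℕ) (p α q : ℝ) (hp : 1 < p) (hpN : p < N)
    (Ω : Set (EuclideanSpace ℝ (Fin N))) (hΩ : IsOpen Ω) (hΩc : IsConnected Ω)
    (h0 : (0 : EuclideanSpace ℝ (Fin N)) ∈ Ω)
    (u : EuclideanSpace ℝ (Fin N) → ℝ) (hpos : ∀ x ∈ Ω \ {0}, 0 < u x)
    (hrad : IsRadialOn (Ω \ {0}) u) (hu : IsHenonSolution p α q (Ω \ {0}) u) :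
    (p - 1 < q → q < (N + α) * (p - 1) / (N - p) →
      ExtendsAcrossZero p α q Ω u ∨
      ∃ C > 0, ∃ C' > 0,
        Tendsto (fun x => u x / pFundamental N p x) (𝓝[≠] 0) (𝓝 C) ∧
        HasDiracSource p α q C' Ω u) ∧
    (p - 1 < q → q = (N + α) * (p - 1) / (N - p) →
      ExtendsAcrossZero p α q Ω u ∨
      Tendsto (fun x => ‖x‖ ^ ((N - p) / (p - 1)) *
          Real.log (1 / ‖x‖) ^ ((N - p) / ((p + α) * (p - 1))) * u x) (𝓝[≠] 0)
        (𝓝 (((N - p) / (p + α) * ((N - p) / (p - 1)) ^ (p - 1)) ^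
          ((N - p) / ((p + α) * (p - 1)))))) ∧
    ((N + α) * (p - 1) / (N - p) < q → q < (N + α) * p / (N - p) - 1 →
      ExtendsAcrossZero p α q Ω u ∨
      Tendsto (fun x => ‖x‖ ^ ((p + α) / (q + 1 - p)) * u x) (𝓝[≠] 0)
        (𝓝 ((((p + α) / (q + 1 - p)) ^ (p - 1) *
          (N - (p * q + α * (p - 1)) / (q + 1 - p))) ^ (1 / (q + 1 - p))))) := by
  have hm : 0 < p - 1 := by linarith
  have hNp : 0 < N - p := by linarith
  have hN : (0 : ℝ) < N := by linarith
  have : NeZero N := ⟨by exact_mod_cast hN.ne'⟩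
  obtain ⟨R, f, G, h⟩ := hu.exists_isPuncturedRadialSolution hp hΩ h0 hpos hrad
  -- The lower bound on `α` is not assumed: it holds as soon as the range of `q` is nonempty.
  have hα : p - 1 < (N + α) * (p - 1) / (N - p) → -p < α := by
    intro h1
    rw [lt_div_iff₀ hNp, mul_comm, mul_lt_mul_iff_of_pos_right hm] at h1
    linarith
  have e1 : q * ((N - p) / (p - 1)) = q * (N - p) / (p - 1) := (mul_div_assoc _ _ _).symm
  refine ⟨fun hq hsub => ?_, fun hq hcrit => ?_, fun hsup hsob => ?_⟩
  · refine h.subcritical hp hpN hq (hα (hq.trans hsub)) ?_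
    rwa [e1, div_lt_iff₀ hm, ← lt_div_iff₀ hNp]
  · refine h.critical hp hpN hq (hα (hcrit ▸ hq)) ?_
    rw [e1, div_eq_iff hm.ne', ← eq_div_iff hNp.ne']
    exact hcrit
  -- Nonemptiness of the supercritical range gives `-p < α`, and then the critical exponent exceeds
  -- `p - 1`, so `q > p - 1` also follows.
  · have h1 : (N + α) * (p - 1) / (N - p) < (N + α) * p / (N - p) - 1 := hsup.trans hsob
    rw [lt_sub_iff_add_lt, div_add_one hNp.ne', div_lt_div_iff_of_pos_right hNp] at h1
    have hα' : -p < α := by linarith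
    have hq : p - 1 < q := by
      refine lt_trans ?_ hsup
      rw [lt_div_iff₀ hNp, mul_comm, mul_lt_mul_iff_of_pos_right hm]
      linarith
    refine h.supercritical hp hpN hq hα' ?_ hsob
    rwa [e1, lt_div_iff₀ hm, ← div_lt_iff₀ hNp]
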